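/- **Setting.** Let $d,k\ge 1$, $T>0$, let $b:[0,T]\times\mathbb R^d\to\mathbb R^d$ and $\sigma:[0,T]\times\mathbb R^d\to\mathbb R^{d\times k}$, and write $|\cdot|$ for Euclidean norms (of vectors, of matrices, and of the array of partial derivatives $\nabla_x\sigma$). Assume: * $(H_1)$ $\sigma(t,x)$ is differentiable in $x$, and there are $\beta,\delta\in(0,1]$ and $M_0>0$, and for every $R\ge0$ some $M_R>0$, such that for all $s,t\in[0,T]$: $|\sigma(t,x)-\sigma(s,y)|\le M_0(|t-s|^\beta+|x-y|)$ for all $x,y\in\mathbb R^d$, and $|\nabla_x\sigma(t,y)-\nabla_x\sigma(s,z)|\le M_R(|t-s|^\beta+|y-z|^\delta)$ for all $|y|,|z|\le R$. * $(H_2)$ With $\alpha_0=\min\{\tfrac12,\beta,\tfrac{\delta}{1+\delta}\}$, there are $\mu\in(1-\alpha_0,1]$ and $L_0>0$, and for every $R\ge0$ some $L_R>0$, such that for all $r,s\in[0,T]$: $|b(r,x)-b(s,y)|\le L_R(|r-s|^\mu+|x-y|)$ for all $|x|,|y|\le R$, and $|b(s,x)|\le L_0(1+|x|)$ for all $x\in\mathbb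 R^d$. Let $1-\mu<\alpha<\alpha_0$ and let $g\in\tilde W^{1-\alpha,\infty}(0,T;\mathbb R^k)$, i.e. $g:[0,T]\to\mathbb R^k$ is continuous and $$\sup_{0<r<s<T}\Big(\frac{|g(s)-g(r)|}{(s-r)^{1-\alpha}}+\int_r^s\frac{|g(y)-g(r)|}{(y-r)^{2-\alpha}}\,dy\Big)<\infty .$$ Integrals against $g$ are the generalized Stieltjes integrals $\int_t^s f\,dg=(-1)^{\alpha}\int_t^s (D^\alpha_{t+}f)(r)\,(D^{1-\alpha}_{s-}g_{s-})(r)\,dr$, with $(-1)^\alpha=e^{i\pi\alpha}$ and $$(D^\alpha_{t+}f)(r)=\frac1{\Gamma(1-\alpha)}\Big(\frac{f(r)}{(r-t)^\alpha}+\alpha\int_t^r\frac{f(r)-f(y)}{(r-y)^{\alpha+1}}dy\Big),$$ $$(D^{1-\alpha}_{s-}g_{s-})(r)=\frac{e^{i\pi(1-\alpha)}}{\Gamma(\alpha)}\Big(\frac{g(r)-g(s)}{(s-r)^{1-\alpha}}+(1-\alpha)\int_r^s\frac{g(r)-g(y)}{(y-r)^{2-\alpha}}dy\Big).$$ Let $\mathcal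 K=\{K(t):t\in[0,T]\}$ be a family of nonempty closed subsets of $\mathbb R^d$. Call $\mathcal K$ *left-closed* if $s_n<t$, $s_n\to t$, $y_n\in K(s_n)$ and $y_n\to y$ imply $y\in K(t)$ (for $s_n,t\in[0,T]$). Consider: * **(j)** ($C^{1-\alpha}$-viability) For all $t\in[0,T]$ and $x\in K(t)$ there is $X\in C^{1-\alpha}([t,T];\mathbb R^d)$ with $X_s=x+\int_t^s b(r,X_r)\,dr+\int_t^s\sigma(r,X_r)\,dg(r)$ and $X_s\in K(s)$ for all $s\in[t,T]$. * **(jj)** ($(1-\alpha)$-fractional $g$-tangency everywhere) There are constants $D_R,\tilde D_R>0$ ($R>0$) such that for all $t\in[0,T]$ and $x\in K(t)$ there are $\bar h>0$ and, writing $I=[t,t+\bar h]\cap[0,T]$, functions $U:I\to\mathbb R^d$ and $V:I\to\mathbb R^{d\times k}$ with $U(t)=0$, $V(t)=0$, such that for all $s,\tau\in I$ and all $R>0$ with $|x|\le R$ $$|U(\tau)-U(s)|\le D_R|\tau-s|^{1-\alpha},\qquad |V(\tau)-V(s)|\le\tilde D_R|\tau-s|^{\min\{\beta,1-\alpha\}},$$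 and $x+\int_t^s[b(t,x)+U(r)]\,dr+\int_t^s[\sigma(t,x)+V(r)]\,dg(r)\in K(s)$ for all $s\in I$. * **(jjj)** ($(1-\alpha)$-fractional $g$-contingency everywhere) There are constants $G_R,\tilde G_R>0$ and $\gamma_R\in(0,1)$ ($R>0$) such that for all $t\in[0,T]$ and $x\in K(t)$ there are $\bar h>0$ and, writing $I=[t,t+\bar h]\cap[0,T]$, a function $Q:I\to\mathbb R^d$ such that for all $s,\tau\in I$ and all $R>0$ with $|x|\le R$ $$|Q(\tau)-Q(s)|\le G_R|\tau-s|^{1-\alpha},\qquad |Q(s)|\le\tilde G_R|s-t|^{1+\gamma_R},$$ and $x+(s-t)b(t,x)+\sigma(t,x)[g(s)-g(t)]+Q(s)\in K(s)$ for all $s\in I$. **Theorem.** If $\mathcal K$ is left-closed, then (j), (jj) and (jjj) are equivalent. Moreover, for every family $\mathcal K$ as above, left-closed or not, (j) implies that $\mathcal K$ is left-closed, and (jj) implies (jjj). (Hence, for every such family, (j) holds if and only if $\mathcal K$ is left-closed and (jj) holds, if and only if $\mathcal K$ is left-closed and (jjj) holds.) -/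

import Mathlib

open Set Filter Topology MeasureTheory

noncomputable section

namespace FracViability

/-- `ℝⁿ` with the Euclidean norm. -/
abbrev Eucl (n : ℕ) : Type := EuclideanSpace ℝ (Fin n)

/-- The Euclidean (Frobenius) norm `|A|` of a real `d × k` matrix, `|A|² = ∑ᵢⱼ (Aᵢⱼ)²`. -/
def frob {d k : ℕ} (A : Matrix (Fin d) (Fin k) ℝ) : ℝ :=
  Real.sqrt (∑ i, ∑ j, A i j ^ 2)

/-- The partial derivative `∂_{x_l} σ^{i,j}(t, x)`. -/
def partialDeriv {d k : ℕ} (σ : ℝ → Eucl d → Matrix (Fin d) (Fin k) ℝ)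
    (t : ℝ) (x : Eucl d) (l : Fin d) (i : Fin d) (j : Fin k) : ℝ :=
  fderiv ℝ (fun y : Eucl d => σ t y i j) x (EuclideanSpace.single l 1)

/-- `|∇ₓσ(t, y) - ∇ₓσ(s, z)|`, the Euclidean norm over all the indices `l, i, j`. -/
def gradDist {d k : ℕ} (σ : ℝ → Eucl d → Matrix (Fin d) (Fin k) ℝ)
    (t : ℝ) (y : Eucl d) (s : ℝ) (z : Eucl d) : ℝ :=
  Real.sqrt (∑ l, ∑ i, ∑ j, (partialDeriv σ t y l i j - partialDeriv σ s z l i j) ^ 2)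

/-- The threshold `α₀ = min {1/2, β, δ/(1+δ)}`. -/
def alphaZero (β δ : ℝ) : ℝ := min (1 / 2) (min β (δ / (1 + δ)))

/-- Assumption (H₁) on `σ : [0,T] × ℝᵈ → ℝ^{d×k}`, with exponents `β, δ`. -/
structure HypSigma {d k : ℕ} (T β δ : ℝ)
    (σ : ℝ → Eucl d → Matrix (Fin d) (Fin k) ℝ) : Prop where
  beta_pos : 0 < β
  beta_le : β ≤ 1
  delta_pos : 0 < δ
  delta_le : δ ≤ 1
  differentiable : ∀ t ∈ Icc 0 T, ∀ i j, Differentiable ℝ (fun x : Eucl d => σ t x i j)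
  lipschitz : ∃ M₀ : ℝ, 0 < M₀ ∧ ∀ t ∈ Icc 0 T, ∀ s ∈ Icc 0 T, ∀ x y : Eucl d,
    frob (σ t x - σ s y) ≤ M₀ * (|t - s| ^ β + ‖x - y‖)
  grad_holder : ∀ R : ℝ, 0 ≤ R → ∃ M : ℝ, 0 < M ∧
    ∀ t ∈ Icc 0 T, ∀ s ∈ Icc 0 T, ∀ y z : Eucl d, ‖y‖ ≤ R → ‖z‖ ≤ R →
      gradDist σ t y s z ≤ M * (|t - s| ^ β + ‖y - z‖ ^ δ)

/-- Assumption (H₂) on `b : [0,T] × ℝᵈ → ℝᵈ`, with exponent `μ ∈ (1 - α₀, 1]`. -/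
structure HypDrift {d : ℕ} (T β δ μ : ℝ) (b : ℝ → Eucl d → Eucl d) : Prop where
  mu_gt : 1 - alphaZero β δ < μ
  mu_le : μ ≤ 1
  lipschitz : ∀ R : ℝ, 0 ≤ R → ∃ L : ℝ, 0 < L ∧
    ∀ r ∈ Icc 0 T, ∀ s ∈ Icc 0 T, ∀ x y : Eucl d, ‖x‖ ≤ R → ‖y‖ ≤ R →
      ‖b r x - b s y‖ ≤ L * (|r - s| ^ μ + ‖x - y‖)
  growth : ∃ L₀ : ℝ, 0 < L₀ ∧ ∀ t ∈ Icc 0 T, ∀ x : Eucl d, ‖b t x‖ ≤ L₀ * (1 + ‖x‖)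

/-- The space `W̃^{1-α,∞}(t,T;ℝᵏ)`: continuous `g : [t,T] → ℝᵏ` with
`sup_{t<r<s<T} ( |g(s)-g(r)|/(s-r)^{1-α} + ∫_r^s |g(y)-g(r)|/(y-r)^{2-α} dy ) < ∞`. -/
def MemTildeW {k : ℕ} (α t T : ℝ) (g : ℝ → Eucl k) : Prop :=
  ContinuousOn g (Icc t T) ∧
  ∃ C : ℝ, ∀ r s : ℝ, t < r → r < s → s < T →
    IntegrableOn (fun y => ‖g y - g r‖ / (y - r) ^ (2 - α)) (Ioo r s) ∧
    ‖g s - g r‖ / (s - r) ^ (1 - α)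
      + (∫ y in Ioo r s, ‖g y - g r‖ / (y - r) ^ (2 - α)) ≤ C

/-- The left Weyl-Marchaud derivative `(D_{t+}^α f)(r)`, for `r > t`. -/
def derivLeft (α t : ℝ) (f : ℝ → ℝ) (r : ℝ) : ℝ :=
  1 / Real.Gamma (1 - α) *
    (f r / (r - t) ^ α + α * ∫ y in t..r, (f r - f y) / (r - y) ^ (α + 1))

/-- The right Weyl-Marchaud derivative `(D_{s-}^{1-α} g_{s-})(r)`, for `r < s`, without its
complex phase `e^{iπ(1-α)}`. -/
def derivRight (α s : ℝ) (g : ℝ → ℝ) (r : ℝ) : ℝ :=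
  1 / Real.Gamma α *
    ((g r - g s) / (s - r) ^ (1 - α)
      + (1 - α) * ∫ y in r..s, (g r - g y) / (y - r) ^ (2 - α))

/-- The generalized Stieltjes integral
`∫_t^s f dg = (-1)^α ∫_t^s (D_{t+}^α f)(r) (D_{s-}^{1-α} g_{s-})(r) dr` of scalar functions.
The phases combine to `(-1)^α e^{iπ(1-α)} = e^{iπα} e^{iπ(1-α)} = -1`. -/
def stieltjes (α t s : ℝ) (f g : ℝ → ℝ) : ℝ :=
  -∫ r in t..s, derivLeft α t f r * derivRight α s g r

/-- `∫_t^s f dg ∈ ℝᵈ` for a `d × k` matrix valued `f` and an `ℝᵏ` valued `g`. -/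
def stieltjesVec {d k : ℕ} (α t s : ℝ) (f : ℝ → Matrix (Fin d) (Fin k) ℝ)
    (g : ℝ → Eucl k) : Eucl d :=
  WithLp.toLp 2 fun i => ∑ j, stieltjes α t s (fun r => f r i j) (fun r => g r j)

/-- `A v` as a vector of the Euclidean space. -/
def mulVecE {d k : ℕ} (A : Matrix (Fin d) (Fin k) ℝ) (v : Eucl k) : Eucl d :=
  WithLp.toLp 2 fun i => ∑ j, A i j * v j

/-- `X` is `η`-Hölder continuous on the set `I`. -/
def HolderOnSet {d : ℕ} (η : ℝ) (I : Set ℝ) (X : ℝ → Eucl d) : Prop :=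
  ∃ C : ℝ, ∀ s ∈ I, ∀ r ∈ I, ‖X s - X r‖ ≤ C * |s - r| ^ η

/-- `X` is a solution of class `C^{1-α}([t,T];ℝᵈ)` of
`X_s = x + ∫_t^s b(r,X_r) dr + ∫_t^s σ(r,X_r) dg(r)`, `s ∈ [t,T]`. -/
def IsSolution {d k : ℕ} (α T : ℝ) (b : ℝ → Eucl d → Eucl d)
    (σ : ℝ → Eucl d → Matrix (Fin d) (Fin k) ℝ) (g : ℝ → Eucl k)
    (t : ℝ) (x : Eucl d) (X : ℝ → Eucl d) : Prop :=
  HolderOnSet (1 - α) (Icc t T) X ∧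
  ∀ s ∈ Icc t T,
    X s = x + (∫ r in t..s, b r (X r)) + stieltjesVec α t s (fun r => σ r (X r)) g

/-- (j): the family `K` is `C^{1-α}`-viable. -/
def Viable {d k : ℕ} (α T : ℝ) (b : ℝ → Eucl d → Eucl d)
    (σ : ℝ → Eucl d → Matrix (Fin d) (Fin k) ℝ) (g : ℝ → Eucl k)
    (K : ℝ → Set (Eucl d)) : Prop :=
  ∀ t ∈ Icc 0 T, ∀ x ∈ K t, ∃ X : ℝ → Eucl d,
    IsSolution α T b σ g t x X ∧ ∀ s ∈ Icc t T, X s ∈ K s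

/-- `(b(t,x), σ(t,x))` is `(1-α)`-fractional `g`-tangent at `(t,x)`, with the constants
`D R`, `D' R`. The time interval is `[t, t+h] ∩ [0,T]`, since `g` and `K` live on `[0,T]`. -/
def TangentAt {d k : ℕ} (α β T : ℝ) (b : ℝ → Eucl d → Eucl d)
    (σ : ℝ → Eucl d → Matrix (Fin d) (Fin k) ℝ) (g : ℝ → Eucl k)
    (K : ℝ → Set (Eucl d)) (D D' : ℝ → ℝ) (t : ℝ) (x : Eucl d) : Prop :=
  ∃ h : ℝ, 0 < h ∧ ∃ (U : ℝ → Eucl d) (V : ℝ → Matrix (Fin d) (Fin k) ℝ),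
    U t = 0 ∧ V t = 0 ∧
    (∀ R : ℝ, 0 < R → ‖x‖ ≤ R →
      ∀ s ∈ Icc t (min (t + h) T), ∀ τ ∈ Icc t (min (t + h) T),
        ‖U τ - U s‖ ≤ D R * |τ - s| ^ (1 - α) ∧
        frob (V τ - V s) ≤ D' R * |τ - s| ^ min β (1 - α)) ∧
    ∀ s ∈ Icc t (min (t + h) T),
      x + (∫ r in t..s, (b t x + U r)) + stieltjesVec α t s (fun r => σ t x + V r) g ∈ K s

/-- (jj): tangency at every point of the tube. The constants depend on `R` but neither on `t`
nor on the point `x` with `|x| ≤ R`. -/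
def Tangent {d k : ℕ} (α β T : ℝ) (b : ℝ → Eucl d → Eucl d)
    (σ : ℝ → Eucl d → Matrix (Fin d) (Fin k) ℝ) (g : ℝ → Eucl k)
    (K : ℝ → Set (Eucl d)) : Prop :=
  ∃ D D' : ℝ → ℝ, (∀ R : ℝ, 0 < R → 0 < D R ∧ 0 < D' R) ∧
    ∀ t ∈ Icc 0 T, ∀ x ∈ K t, TangentAt α β T b σ g K D D' t x

/-- `(b(t,x), σ(t,x))` is `(1-α)`-fractional `g`-contingent at `(t,x)`, with the constants
`G R`, `G' R` and `γ R`, on the time interval `[t, t+h] ∩ [0,T]`. -/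
def ContingentAt {d k : ℕ} (α T : ℝ) (b : ℝ → Eucl d → Eucl d)
    (σ : ℝ → Eucl d → Matrix (Fin d) (Fin k) ℝ) (g : ℝ → Eucl k)
    (K : ℝ → Set (Eucl d)) (G G' γ : ℝ → ℝ) (t : ℝ) (x : Eucl d) : Prop :=
  ∃ h : ℝ, 0 < h ∧ ∃ Q : ℝ → Eucl d,
    (∀ R : ℝ, 0 < R → ‖x‖ ≤ R →
      ∀ s ∈ Icc t (min (t + h) T), ∀ τ ∈ Icc t (min (t + h) T),
        ‖Q τ - Q s‖ ≤ G R * |τ - s| ^ (1 - α) ∧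
        ‖Q s‖ ≤ G' R * |s - t| ^ (1 + γ R)) ∧
    ∀ s ∈ Icc t (min (t + h) T),
      x + (s - t) • b t x + mulVecE (σ t x) (g s - g t) + Q s ∈ K s

/-- (jjj): contingency at every point of the tube. The constants depend on `R` but neither on
`t` nor on the point `x` with `|x| ≤ R`. -/
def Contingent {d k : ℕ} (α T : ℝ) (b : ℝ → Eucl d → Eucl d)
    (σ : ℝ → Eucl d → Matrix (Fin d) (Fin k) ℝ) (g : ℝ → Eucl k)
    (K : ℝ → Set (Eucl d)) : Prop :=
  ∃ G G' γ : ℝ → ℝ, (∀ R : ℝ, 0 < R → 0 < G R ∧ 0 < G' R ∧ γ R ∈ Ioo (0 : ℝ) 1) ∧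
    ∀ t ∈ Icc 0 T, ∀ x ∈ K t, ContingentAt α T b σ g K G G' γ t x

/-- The tube `{(s,y) : s ∈ [0,T], y ∈ K(s)}` is closed from the left in time: if `sₙ < t`,
`sₙ → t`, `yₙ ∈ K(sₙ)` and `yₙ → y`, then `y ∈ K(t)`. -/
def LeftClosed {d : ℕ} (T : ℝ) (K : ℝ → Set (Eucl d)) : Prop :=
  ∀ t ∈ Icc 0 T, ∀ (s : ℕ → ℝ) (y : ℕ → Eucl d) (z : Eucl d),
    (∀ n, s n ∈ Ico 0 t) → (∀ n, y n ∈ K (s n)) →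
    Tendsto s atTop (𝓝 t) → Tendsto y atTop (𝓝 z) → z ∈ K t

end FracViability

end

open Set Filter Topology MeasureTheory

noncomputable section

namespace FracViability

/-! ### Inversion of the right Weyl-Marchaud derivative: Beta integral and singular kernel. -/

section

/-! Put l = min(β, 1-α). The restrictions on α give α < l ≤ 1-α. Along a (1-α)-Hölder path the
integrand σ(r, X_r) is l-Hölder, and g is (1-α)-Hölder, so l + (1-α) > 1 and the integral is of
Young type: ∫_t^s f dg = ∫_t^r f dg + f(r)(g(s) - g(r)) + O((s-r)^{1+l-α}). This is
`abs_stieltjes_sub_sub_le`. It is not immediate, since D_{s-}^{1-α} g_{s-} depends on s, so that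
additivity in the limits of integration is hidden. The fractional derivative is inverted on
constants (`inversion_unit`), which integrates step functions exactly; then f is stopped at a time
p, and the defect of additivity, as a function of p, has increments of order greater than one, so it
is constant (`eq_of_norm_sub_le_rpow`). After this the integral enters only through the fields of
`YoungSystem`.

Since 1 + l - α > 1, a Hölder path solves the equation as soon as its first order remainder X_s -
X_r - (s-r) b(r,X_r) - σ(r,X_r)(g(s) - g(r)) is O((s-r)^{1+l-α}) (`isSolution_of_remainder`). Linear
growth and a bootstrap bound the Hölder constant of solutions on windows of a length independent of
the starting point. Hence viable solutions that start just before t are still near their starting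
points at time t, which gives left-closedness; U = b(r,X_r) - b(t,x) and V = σ(r,X_r) - σ(t,x) give
(jj); and the expansion at t turns (jj) into (jjj) with exponent 1 + l - α.

The substantial implication is (jjj) ⇒ (j). Contingency provides steps inside the tube, but their
length has no lower bound. Finite chains of steps with error rate below ε are considered. A discrete
sewing lemma bounds their Hölder constants and remainders independently of the number of steps
(`exists_chain_bounds`). If the times of infinitely many steps accumulate before T, the positions
converge, left-closedness puts the limit in the tube, and the uniform remainder bound lets a single
late jump to the limit replace the infinite tail (`reach_limit`). A greedy choice then reaches T
(`exists_reach_end`). As ε → 0, a limit of the chains along an ultrafilter is a viable path with the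
required remainder. -/

theorem intervalIntegrable_beta {α : ℝ} (h0 : 0 < α) (h1 : α < 1) :
    IntervalIntegrable (fun x : ℝ => x ^ (-α) * (1 - x) ^ (α - 1)) volume 0 1 := by
  have h := Complex.betaIntegral_convergent (u := ((1 - α : ℝ) : ℂ)) (v := (α : ℂ))
    (by simpa using h1) (by simpa using h0)
  have h2 : IntervalIntegrable (fun x : ℝ => ((x : ℂ) ^ (((1 - α : ℝ) : ℂ) - 1) *
      (1 - (x : ℂ)) ^ ((α : ℂ) - 1)).re) volume 0 1 := ⟨h.1.re, h.2.re⟩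
  refine h2.congr ?_
  intro x hx
  rw [uIoc_of_le zero_le_one] at hx
  have e1 : ((x : ℂ) ^ (((1 - α : ℝ) : ℂ) - 1)) = ((x ^ (-α) : ℝ) : ℂ) := by
    rw [Complex.ofReal_cpow hx.1.le]; congr 1; push_cast; ring
  have e2 : ((1 - (x : ℂ)) ^ ((α : ℂ) - 1)) = (((1 - x) ^ (α - 1) : ℝ) : ℂ) := by
    rw [Complex.ofReal_cpow (by linarith [hx.2])]; push_cast; rfl
  simp only [e1, e2]
  rw [← Complex.ofReal_mul, Complex.ofReal_re]

theorem integral_beta {α : ℝ} (h0 : 0 < α) (h1 : α < 1) :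
    ∫ x in (0 : ℝ)..1, x ^ (-α) * (1 - x) ^ (α - 1) = Real.Gamma α * Real.Gamma (1 - α) := by
  have h := Complex.Gamma_mul_Gamma_eq_betaIntegral (s := ((1 - α : ℝ) : ℂ)) (t := (α : ℂ))
    (by simpa using h1) (by simpa using h0)
  have e : Complex.betaIntegral ((1 - α : ℝ) : ℂ) (α : ℂ) =
      ((∫ x in (0 : ℝ)..1, x ^ (-α) * (1 - x) ^ (α - 1) : ℝ) : ℂ) := by
    rw [Complex.betaIntegral, ← intervalIntegral.integral_ofReal]
    refine intervalIntegral.integral_congr fun x hx => ?_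
    rw [uIcc_of_le zero_le_one] at hx
    have e1 : ((x : ℂ) ^ (((1 - α : ℝ) : ℂ) - 1)) = ((x ^ (-α) : ℝ) : ℂ) := by
      rw [Complex.ofReal_cpow hx.1]; congr 1; push_cast; ring
    have e2 : ((1 - (x : ℂ)) ^ ((α : ℂ) - 1)) = (((1 - x) ^ (α - 1) : ℝ) : ℂ) := by
      rw [Complex.ofReal_cpow (by linarith [hx.2])]; push_cast; rfl
    simp only [e1, e2, Complex.ofReal_mul]
  rw [e, Complex.Gamma_ofReal, Complex.Gamma_ofReal, ← Complex.ofReal_add] at h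
  simp only [sub_add_cancel, Complex.ofReal_one, Complex.Gamma_one, one_mul] at h
  rw [mul_comm]
  exact_mod_cast h.symm

theorem setIntegral_Ioo_ite_lt_right {a b u : ℝ} (hu : a ≤ u) (f : ℝ → ℝ) :
    ∫ y in Ioo a b, (if u < y then f y else 0) = ∫ y in Ioo u b, f y := by
  have : (fun y => if u < y then f y else 0) = (Ioi u).indicator f := by
    ext y; simp [indicator]
  rw [this, setIntegral_indicator measurableSet_Ioi]
  congr 2
  ext y; simp only [mem_inter_iff, mem_Ioo, mem_Ioi]
  constructor
  · rintro ⟨⟨_, h⟩, h'⟩; exact ⟨h', h⟩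
  · rintro ⟨h, h'⟩; exact ⟨⟨hu.trans_lt h, h'⟩, h⟩

theorem integrableOn_Ioo_ite_lt_right {a b u : ℝ} (hu : a ≤ u) (f : ℝ → ℝ) :
    IntegrableOn (fun y => if u < y then f y else 0) (Ioo a b) ↔ IntegrableOn f (Ioo u b) := by
  have : (fun y => if u < y then f y else 0) = (Ioi u).indicator f := by
    ext y; simp [indicator]
  rw [this, integrableOn_indicator_iff measurableSet_Ioi]
  have : Ioi u ∩ Ioo a b = Ioo u b := by
    ext y; simp only [mem_inter_iff, mem_Ioo, mem_Ioi]
    constructor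
    · rintro ⟨h', ⟨_, h⟩⟩; exact ⟨h', h⟩
    · rintro ⟨h, h'⟩; exact ⟨h, ⟨hu.trans_lt h, h'⟩⟩
  rw [this]

theorem setIntegral_Ioo_ite_lt_left {a b v : ℝ} (hv : v ≤ b) (f : ℝ → ℝ) :
    ∫ y in Ioo a b, (if y < v then f y else 0) = ∫ y in Ioo a v, f y := by
  have : (fun y => if y < v then f y else 0) = (Iio v).indicator f := by
    ext y; simp [indicator]
  rw [this, setIntegral_indicator measurableSet_Iio]
  congr 2
  ext y; simp only [mem_inter_iff, mem_Ioo, mem_Iio]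
  constructor
  · rintro ⟨⟨h, _⟩, h'⟩; exact ⟨h, h'⟩
  · rintro ⟨h, h'⟩; exact ⟨⟨h, h'.trans_le hv⟩, h'⟩

theorem integrableOn_Ioo_ite_lt_left {a b v : ℝ} (hv : v ≤ b) (f : ℝ → ℝ) :
    IntegrableOn (fun y => if y < v then f y else 0) (Ioo a b) ↔ IntegrableOn f (Ioo a v) := by
  have : (fun y => if y < v then f y else 0) = (Iio v).indicator f := by
    ext y; simp [indicator]
  rw [this, integrableOn_indicator_iff measurableSet_Iio]
  have : Iio v ∩ Ioo a b = Ioo a v := by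
    ext y; simp only [mem_inter_iff, mem_Ioo, mem_Iio]
    constructor
    · rintro ⟨h', ⟨h, _⟩⟩; exact ⟨h, h'⟩
    · rintro ⟨h, h'⟩; exact ⟨h', ⟨h, h'.trans_le hv⟩⟩
  rw [this]

theorem intervalIntegral_eq_Ioo {a b : ℝ} (hab : a ≤ b) (f : ℝ → ℝ) :
    ∫ y in a..b, f y = ∫ y in Ioo a b, f y := by
  rw [intervalIntegral.integral_of_le hab, integral_Ioc_eq_integral_Ioo]

theorem intervalIntegrable_iff_Ioo {a b : ℝ} (hab : a ≤ b) (f : ℝ → ℝ) :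
    IntervalIntegrable f volume a b ↔ IntegrableOn f (Ioo a b) := by
  rw [intervalIntegrable_iff_integrableOn_Ioo_of_le hab]

/-- The kernel `u^{-α} (G(u) - G(y)) (y - u)^{α - 2}` on `u < y`. -/
def fracKernel (α : ℝ) (G : ℝ → ℝ) (u y : ℝ) : ℝ :=
  if u < y then u ^ (-α) * ((G u - G y) / (y - u) ^ (2 - α)) else 0

theorem measurable_fracKernel (α : ℝ) {G : ℝ → ℝ} (hG : Continuous G) :
    Measurable (Function.uncurry (fracKernel α G)) := by
  unfold fracKernel Function.uncurry
  have := hG.measurable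
  refine Measurable.ite (measurableSet_lt measurable_fst measurable_snd) ?_ measurable_const
  fun_prop

/-- By Tonelli: the inner integrals in y are at most Λ u^{-α}, which is integrable because α < 1.
Absolute integrability is what licenses the exchanges of integrals below. -/
theorem integrable_fracKernel {α Λ : ℝ} (h1 : α < 1) {G : ℝ → ℝ}
    (hG : Continuous G)
    (hI : ∀ u ∈ Ioo (0 : ℝ) 1, IntegrableOn (fun y => (G u - G y) / (y - u) ^ (2 - α)) (Ioo u 1))
    (hB : ∀ u ∈ Ioo (0 : ℝ) 1, ∫ y in Ioo u 1, |(G u - G y) / (y - u) ^ (2 - α)| ≤ Λ) :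
    Integrable (Function.uncurry (fracKernel α G))
      ((volume.restrict (Ioo 0 1)).prod (volume.restrict (Ioo 0 1))) := by
  have hm := measurable_fracKernel α hG
  rw [integrable_prod_iff hm.aestronglyMeasurable]
  constructor
  · rw [ae_restrict_iff' measurableSet_Ioo]
    refine Eventually.of_forall fun u hu => ?_
    exact (integrableOn_Ioo_ite_lt_right (b := 1) hu.1.le _).2 ((hI u hu).const_mul (u ^ (-α)))
  · have hp : IntegrableOn (fun u : ℝ => Λ * u ^ (-α)) (Ioo 0 1) := by
      rw [← intervalIntegrable_iff_Ioo zero_le_one]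
      exact (intervalIntegral.intervalIntegrable_rpow' (by linarith)).const_mul _
    refine Integrable.mono' hp (hm.norm.stronglyMeasurable.integral_prod_right').aestronglyMeasurable
      ?_
    rw [ae_restrict_iff' measurableSet_Ioo]
    refine Eventually.of_forall fun u hu => ?_
    have e : ∫ y in Ioo (0 : ℝ) 1, ‖Function.uncurry (fracKernel α G) (u, y)‖ =
        u ^ (-α) * ∫ y in Ioo u 1, |(G u - G y) / (y - u) ^ (2 - α)| := by
      rw [← integral_const_mul, ← setIntegral_Ioo_ite_lt_right hu.1.le]
      refine integral_congr_ae (Eventually.of_forall fun y => ?_)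
      simp only [Function.uncurry, fracKernel]
      split_ifs
      · rw [Real.norm_eq_abs, abs_mul, abs_of_nonneg (Real.rpow_nonneg hu.1.le _)]
      · simp
    rw [e, Real.norm_eq_abs, abs_of_nonneg, mul_comm]
    · exact mul_le_mul_of_nonneg_right (hB u hu) (Real.rpow_nonneg hu.1.le _)
    · exact mul_nonneg (Real.rpow_nonneg hu.1.le _) (integral_nonneg fun _ => abs_nonneg _)

/-- The substitution u = θ y separates the variables: the powers of y, Jacobian included, add up to
1 - α + (α - 2) = -1. -/
theorem fracKernel_scale {α : ℝ} {G : ℝ → ℝ} {y θ : ℝ} (hy : 0 < y) (hθ : θ ∈ Ioo (0 : ℝ) 1) :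
    y * fracKernel α G (θ * y) y =
      θ ^ (-α) * (1 - θ) ^ (α - 2) * ((G (θ * y) - G y) / y) := by
  have h1 : θ * y < y := by nlinarith [hθ.2]
  have h2 : 0 < 1 - θ := by linarith [hθ.2]
  rw [fracKernel, if_pos h1, Real.mul_rpow hθ.1.le hy.le,
    show y - θ * y = (1 - θ) * y by ring, Real.mul_rpow h2.le hy.le, div_eq_mul_inv,
    mul_inv, ← Real.rpow_neg h2.le, ← Real.rpow_neg hy.le, show -(2 - α) = α - 2 by ring]
  have : y * y ^ (-α) * y ^ (α - 2) = y⁻¹ := by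
    nth_rewrite 1 [← Real.rpow_one y]
    rw [← Real.rpow_add hy, ← Real.rpow_add hy, ← Real.rpow_neg_one]
    congr 1; ring
  rw [div_eq_mul_inv, ← this]; ring

end

/-! ### Inversion, continued: dilation, a Frullani integral and integration by parts. -/

section

theorem integral_comp_mul_unit {y : ℝ} (hy0 : 0 < y) (hy1 : y ≤ 1) (f : ℝ → ℝ) :
    ∫ u in Ioo (0 : ℝ) 1, (if u < y then f u else 0) = ∫ θ in Ioo (0 : ℝ) 1, y * f (θ * y) := by
  rw [setIntegral_Ioo_ite_lt_left hy1, integral_const_mul, ← intervalIntegral_eq_Ioo hy0.le,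
    ← intervalIntegral_eq_Ioo zero_le_one, intervalIntegral.integral_comp_mul_right f hy0.ne']
  simp [hy0.ne']

theorem integrableOn_comp_mul_unit {y : ℝ} (hy0 : 0 < y) (hy1 : y ≤ 1) (f : ℝ → ℝ) :
    IntegrableOn (fun u => if u < y then f u else 0) (Ioo (0 : ℝ) 1) ↔
      IntegrableOn (fun θ => y * f (θ * y)) (Ioo (0 : ℝ) 1) := by
  rw [integrableOn_Ioo_ite_lt_left hy1, ← intervalIntegrable_iff_Ioo hy0.le,
    ← intervalIntegrable_iff_Ioo zero_le_one]
  have := IntervalIntegrable.comp_mul_left_iff (f := f) (a := 0) (b := y) hy0.ne'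
  rw [zero_div, div_self hy0.ne'] at this
  simp only [mul_comm y] at this
  rw [← this]
  constructor
  · intro h; exact h.const_mul y
  · intro h
    have := h.const_mul y⁻¹
    refine this.congr (fun x _ => ?_)
    simp [hy0.ne']

/-- `θ^{-α} (1-θ)^{α-2} (G(θ y) - G(y)) / y`. -/
def dilationKernel (α : ℝ) (G : ℝ → ℝ) (y θ : ℝ) : ℝ :=
  θ ^ (-α) * (1 - θ) ^ (α - 2) * ((G (θ * y) - G y) / y)

/-- The weight (1-θ)^{α-2} is not integrable by itself, so integrability is not estimated anew. It
is carried over from `fracKernel` slice by slice in y, where the two kernels differ by the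
substitution u = θ y. -/
theorem integrable_dilationKernel {α : ℝ} {G : ℝ → ℝ} (hG : Continuous G)
    (hk : Integrable (Function.uncurry (fracKernel α G))
      ((volume.restrict (Ioo 0 1)).prod (volume.restrict (Ioo 0 1)))) :
    Integrable (Function.uncurry (dilationKernel α G))
      ((volume.restrict (Ioo 0 1)).prod (volume.restrict (Ioo 0 1))) := by
  have hm : Measurable (Function.uncurry (dilationKernel α G)) := by
    unfold dilationKernel Function.uncurry
    have := hG.measurable
    fun_prop
  have hk' := (integrable_prod_iff' hk.aestronglyMeasurable).1 hk
  rw [integrable_prod_iff hm.aestronglyMeasurable]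
  have key : ∀ y ∈ Ioo (0 : ℝ) 1, ∀ θ ∈ Ioo (0 : ℝ) 1,
      y * (θ * y) ^ (-α) * ((G (θ * y) - G y) / (y - θ * y) ^ (2 - α)) =
        dilationKernel α G y θ := by
    intro y hy θ hθ
    have h1 : θ * y < y := by nlinarith [hθ.2, hy.1]
    rw [dilationKernel, ← fracKernel_scale hy.1 hθ, fracKernel, if_pos h1, mul_assoc]
  constructor
  · filter_upwards [hk'.1, ae_restrict_mem measurableSet_Ioo] with y h hy
    have := (integrableOn_comp_mul_unit hy.1 hy.2.le
      (fun u => u ^ (-α) * ((G u - G y) / (y - u) ^ (2 - α)))).1 h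
    refine this.congr ?_
    filter_upwards [ae_restrict_mem measurableSet_Ioo] with θ hθ
    rw [← mul_assoc]
    exact key y hy θ hθ
  · refine hk'.2.congr ?_
    filter_upwards [ae_restrict_mem measurableSet_Ioo] with y hy
    have := integral_comp_mul_unit hy.1 hy.2.le
      (fun u => ‖u ^ (-α) * ((G u - G y) / (y - u) ^ (2 - α))‖)
    have e : ∀ u, ‖Function.uncurry (fracKernel α G) (u, y)‖ =
        if u < y then ‖u ^ (-α) * ((G u - G y) / (y - u) ^ (2 - α))‖ else 0 := by
      intro u; simp only [Function.uncurry, fracKernel]; split_ifs <;> simp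
    simp only [e]
    rw [this]
    refine integral_congr_ae ?_
    filter_upwards [ae_restrict_mem measurableSet_Ioo] with θ hθ
    simp only [Function.uncurry]
    rw [← key y hy θ hθ, mul_assoc, norm_mul (y), Real.norm_of_nonneg hy.1.le]

/-- Fubini is applied twice: to make y the outer variable, and, after u = θ y in the inner integral,
to make θ the outer one. -/
theorem integral_fracKernel_swap {α : ℝ} {G : ℝ → ℝ} (hG : Continuous G)
    (hk : Integrable (Function.uncurry (fracKernel α G))
      ((volume.restrict (Ioo 0 1)).prod (volume.restrict (Ioo 0 1)))) :
    ∫ u in Ioo (0 : ℝ) 1, ∫ y in Ioo (0 : ℝ) 1, fracKernel α G u y =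
      ∫ θ in Ioo (0 : ℝ) 1, θ ^ (-α) * (1 - θ) ^ (α - 2) *
        ∫ y in Ioo (0 : ℝ) 1, (G (θ * y) - G y) / y := by
  rw [integral_integral_swap hk]
  have : ∫ y in Ioo (0 : ℝ) 1, ∫ u in Ioo (0 : ℝ) 1, fracKernel α G u y =
      ∫ y in Ioo (0 : ℝ) 1, ∫ θ in Ioo (0 : ℝ) 1, dilationKernel α G y θ := by
    refine setIntegral_congr_fun measurableSet_Ioo fun y hy => ?_
    have := integral_comp_mul_unit hy.1 hy.2.le
      (fun u => u ^ (-α) * ((G u - G y) / (y - u) ^ (2 - α)))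
    simp only [fracKernel]
    rw [this]
    refine setIntegral_congr_fun measurableSet_Ioo fun θ hθ => ?_
    have h1 : θ * y < y := by nlinarith [hθ.2, hy.1]
    rw [dilationKernel, ← fracKernel_scale hy.1 hθ, fracKernel, if_pos h1]
  rw [this, integral_integral_swap (integrable_dilationKernel hG hk)]
  simp only [dilationKernel, integral_const_mul]

section Frullani

variable {α Λ : ℝ} {G : ℝ → ℝ}

theorem abs_sub_div_le (hH : ∀ x ∈ Icc (0 : ℝ) 1, |G 0 - G x| ≤ Λ * x ^ (1 - α))
    {x : ℝ} (hx : x ∈ Ioc (0 : ℝ) 1) : |(G 0 - G x) / x| ≤ Λ * x ^ (-α) := by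
  rw [abs_div, abs_of_pos hx.1, div_le_iff₀ hx.1, mul_assoc]
  refine (hH x ⟨hx.1.le, hx.2⟩).trans_eq ?_
  rw [show (1 - α) = -α + 1 by ring, Real.rpow_add hx.1, Real.rpow_one]

theorem intervalIntegrable_sub_div (h1 : α < 1) (hG : Continuous G)
    (hH : ∀ x ∈ Icc (0 : ℝ) 1, |G 0 - G x| ≤ Λ * x ^ (1 - α)) :
    IntervalIntegrable (fun x => (G 0 - G x) / x) volume 0 1 := by
  have hp : IntervalIntegrable (fun u : ℝ => Λ * u ^ (-α)) volume 0 1 :=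
    (intervalIntegral.intervalIntegrable_rpow' (by linarith)).const_mul _
  refine hp.mono_fun' ?_ ?_
  · have := hG.measurable
    exact Measurable.aestronglyMeasurable (by fun_prop)
  · rw [uIoc_of_le zero_le_one]
    filter_upwards [ae_restrict_mem measurableSet_Ioc] with x hx
    exact abs_sub_div_le hH hx

/-- Frullani's trick: (G(θy) - G(y))/y is the difference of (G(0) - G(y))/y and its dilate. Each
converges at 0 by the Hölder bound, the dilate integrates to the same integral over (0, θ), and only
(θ, 1) survives. -/
theorem integral_dilation_sub_div (h1 : α < 1) (hG : Continuous G)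
    (hH : ∀ x ∈ Icc (0 : ℝ) 1, |G 0 - G x| ≤ Λ * x ^ (1 - α)) {θ : ℝ} (hθ : θ ∈ Ioo (0 : ℝ) 1) :
    ∫ y in Ioo (0 : ℝ) 1, (G (θ * y) - G y) / y = ∫ y in θ..1, (G 0 - G y) / y := by
  have hi := intervalIntegrable_sub_div h1 hG hH
  have hi1 : IntervalIntegrable (fun x => (G 0 - G x) / x) volume 0 θ :=
    hi.mono_set (by rw [uIcc_of_le hθ.1.le, uIcc_of_le zero_le_one]; exact Icc_subset_Icc_right hθ.2.le)
  have hi2 : IntervalIntegrable (fun x => (G 0 - G x) / x) volume θ 1 :=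
    hi.mono_set (by rw [uIcc_of_le hθ.2.le, uIcc_of_le zero_le_one]; exact Icc_subset_Icc_left hθ.1.le)
  have hc := hi1.comp_mul_left (c := θ)
  rw [zero_div, div_self hθ.1.ne'] at hc
  have e : ∀ y, (G (θ * y) - G y) / y = (G 0 - G y) / y - θ * ((G 0 - G (θ * y)) / (θ * y)) := by
    intro y
    have := hθ.1.ne'
    rcases eq_or_ne y 0 with rfl | hy
    · simp
    · field_simp; ring
  rw [← intervalIntegral_eq_Ioo zero_le_one]
  simp only [e]
  rw [intervalIntegral.integral_sub hi (hc.const_mul θ), intervalIntegral.integral_const_mul,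
    intervalIntegral.integral_comp_mul_left (fun x => (G 0 - G x) / x) hθ.1.ne',
    ← intervalIntegral.integral_add_adjacent_intervals hi1 hi2]
  rw [smul_eq_mul, ← mul_assoc, mul_inv_cancel₀ hθ.1.ne', mul_zero, mul_one]
  ring

theorem hasDerivAt_beta_weight {θ : ℝ} (hθ : θ ∈ Ioo (0 : ℝ) 1) :
    HasDerivAt (fun x : ℝ => x ^ (1 - α) * (1 - x) ^ (α - 1))
      ((1 - α) * (θ ^ (-α) * (1 - θ) ^ (α - 2))) θ := by
  have h2 : 0 < 1 - θ := by linarith [hθ.2]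
  have d1 := Real.hasDerivAt_rpow_const (x := θ) (p := 1 - α) (Or.inl hθ.1.ne')
  have d2 : HasDerivAt (fun x : ℝ => (1 - x) ^ (α - 1)) _ θ :=
    HasDerivAt.rpow_const (p := α - 1) ((hasDerivAt_id θ).const_sub 1) (Or.inl h2.ne')
  refine (d1.mul d2).congr_deriv ?_
  rw [show (1 : ℝ) - α - 1 = -α by ring, show α - 1 - 1 = α - 2 by ring,
    show 1 - α = -α + 1 by ring, Real.rpow_add hθ.1, Real.rpow_one,
    show α - 1 = α - 2 + 1 by ring, Real.rpow_add h2, Real.rpow_one]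
  ring

/-- Integration by parts: (1-α) θ^{-α} (1-θ)^{α-2} is the derivative of W(θ) = θ^{1-α} (1-θ)^{α-1},
and W F vanishes at both ends. The singularity at 1 drops from order 2-α to 1-α. -/
theorem integral_beta_weight_mul (h0 : 0 < α) (h1 : α < 1) (hG : Continuous G)
    (hH : ∀ x ∈ Icc (0 : ℝ) 1, |G 0 - G x| ≤ Λ * x ^ (1 - α))
    (hi : IntegrableOn (fun θ : ℝ => θ ^ (-α) * (1 - θ) ^ (α - 2) *
        ∫ y in θ..1, (G 0 - G y) / y) (Ioo 0 1)) :
    (1 - α) * ∫ θ in Ioo (0 : ℝ) 1, θ ^ (-α) * (1 - θ) ^ (α - 2) * ∫ y in θ..1, (G 0 - G y) / y =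
      ∫ θ in (0 : ℝ)..1, θ ^ (-α) * (1 - θ) ^ (α - 1) * (G 0 - G θ) := by
  set F : ℝ → ℝ := fun θ => ∫ y in θ..1, (G 0 - G y) / y with hF
  set W : ℝ → ℝ := fun x => x ^ (1 - α) * (1 - x) ^ (α - 1) with hW
  have hq := intervalIntegrable_sub_div h1 hG hH
  have hΛ : 0 ≤ Λ := by
    have := (abs_nonneg _).trans (hH 1 ⟨zero_le_one, le_rfl⟩)
    simpa using this
  have hFd : ∀ θ ∈ Ioo (0 : ℝ) 1, HasDerivAt F (-((G 0 - G θ) / θ)) θ := by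
    intro θ hθ
    refine intervalIntegral.integral_hasDerivAt_left ?_ ?_ ?_
    · exact hq.mono_set (by
        rw [uIcc_of_le hθ.2.le, uIcc_of_le zero_le_one]; exact Icc_subset_Icc_left hθ.1.le)
    · have := hG.measurable
      exact (Measurable.stronglyMeasurable (by fun_prop)).stronglyMeasurableAtFilter
    · exact ContinuousAt.div (by fun_prop) continuousAt_id hθ.1.ne'
  have hFc : ContinuousOn F (Icc 0 1) := by
    have := intervalIntegral.continuousOn_primitive_interval_left (μ := volume) (a := 0) (b := 1)
      (f := fun y => (G 0 - G y) / y) ?_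
    · rwa [uIcc_of_le zero_le_one] at this
    · rw [uIcc_of_le zero_le_one, integrableOn_Icc_iff_integrableOn_Ioo,
        ← intervalIntegrable_iff_Ioo zero_le_one]
      exact hq
  have hb := intervalIntegrable_beta h0 h1
  have hWF : ∀ θ ∈ Ioo (0 : ℝ) 1, HasDerivAt (fun x => W x * F x)
      ((1 - α) * (θ ^ (-α) * (1 - θ) ^ (α - 2) * F θ) -
        θ ^ (-α) * (1 - θ) ^ (α - 1) * (G 0 - G θ)) θ := by
    intro θ hθ
    refine ((hasDerivAt_beta_weight hθ).mul (hFd θ hθ)).congr_deriv ?_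
    have h3 := hθ.1.ne'
    rw [show 1 - α = -α + 1 by ring, Real.rpow_add hθ.1, Real.rpow_one]
    field_simp
    ring
  have i1 : IntervalIntegrable (fun θ : ℝ => (1 - α) * (θ ^ (-α) * (1 - θ) ^ (α - 2) * F θ))
      volume 0 1 := ((intervalIntegrable_iff_Ioo zero_le_one _).2 hi).const_mul _
  have i2 : IntervalIntegrable (fun θ : ℝ => θ ^ (-α) * (1 - θ) ^ (α - 1) * (G 0 - G θ))
      volume 0 1 := hb.mul_continuousOn (by fun_prop)
  have l0 : Tendsto (fun x => W x * F x) (𝓝[>] 0) (𝓝 0) := by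
    have w0 : ContinuousAt W 0 := by
      refine ContinuousAt.mul ?_ ?_
      · exact Real.continuousAt_rpow_const _ _ (Or.inr (by linarith))
      · exact ContinuousAt.rpow_const (by fun_prop) (Or.inl (by norm_num))
    have f0 : Tendsto F (𝓝[>] 0) (𝓝 (F 0)) :=
      (hFc 0 ⟨le_rfl, zero_le_one⟩).mono_left (by
        rw [← nhdsWithin_Ioo_eq_nhdsGT zero_lt_one]
        exact nhdsWithin_mono _ Ioo_subset_Icc_self)
    have w0' := (w0.tendsto.mono_left (nhdsWithin_le_nhds (s := Ioi 0))).mul f0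
    have hz : W 0 = 0 := by
      simp only [hW]; rw [Real.zero_rpow (by linarith), zero_mul]
    simpa [hz] using w0'
  -- W blows up at 1 like (1-x)^{α-1}, but F is O(1-x), so the product is O((1-x)^α). The
  -- restriction x > 1/2 keeps the factor 1/y in the integrand of F below 2.
  have l1 : Tendsto (fun x => W x * F x) (𝓝[<] 1) (𝓝 0) := by
    have hz : Tendsto (fun x : ℝ => 2 * Λ * (1 - x) ^ α) (𝓝[<] 1) (𝓝 0) := by
      have : ContinuousAt (fun x : ℝ => 2 * Λ * (1 - x) ^ α) 1 :=
        continuousAt_const.mul (ContinuousAt.rpow_const (by fun_prop) (Or.inr h0.le))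
      have h := this.tendsto.mono_left (nhdsWithin_le_nhds (s := Iio 1))
      simpa [Real.zero_rpow h0.ne'] using h
    refine squeeze_zero_norm' ?_ hz
    filter_upwards [Ioo_mem_nhdsLT (show (1 / 2 : ℝ) < 1 by norm_num)] with x hx
    have hx0 : 0 < x := by linarith [hx.1]
    have h2 : 0 < 1 - x := by linarith [hx.2]
    have bF : |F x| ≤ 2 * Λ * (1 - x) := by
      have := intervalIntegral.norm_integral_le_of_norm_le_const (a := x) (b := 1) (C := 2 * Λ)
        (f := fun y => (G 0 - G y) / y) ?_
      · rwa [Real.norm_eq_abs, abs_of_pos h2] at this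
      · intro y hy
        rw [uIoc_of_le hx.2.le] at hy
        have hy0 : 0 < y := hx0.trans hy.1
        rw [Real.norm_eq_abs, abs_div, abs_of_pos hy0, div_le_iff₀ hy0]
        have a1 := hH y ⟨hy0.le, hy.2⟩
        have a2 : y ^ (1 - α) ≤ 1 := Real.rpow_le_one hy0.le hy.2 (by linarith)
        have a3 : (1 : ℝ) ≤ 2 * y := by linarith [hy.1, hx.1]
        nlinarith
    rw [norm_mul, Real.norm_eq_abs, Real.norm_eq_abs]
    have bW : |W x| ≤ (1 - x) ^ (α - 1) := by
      simp only [hW]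
      rw [abs_of_nonneg (by positivity)]
      exact mul_le_of_le_one_left (by positivity) (Real.rpow_le_one hx0.le hx.2.le (by linarith))
    calc |W x| * |F x| ≤ (1 - x) ^ (α - 1) * (2 * Λ * (1 - x)) := by gcongr
      _ = 2 * Λ * (1 - x) ^ α := by
        rw [show α = (α - 1) + 1 by ring, Real.rpow_add h2, Real.rpow_one]
        ring_nf
  have := intervalIntegral.integral_eq_sub_of_hasDerivAt_of_tendsto zero_lt_one hWF
    (i1.sub i2) l0 l1
  rw [intervalIntegral.integral_sub i1 i2, intervalIntegral.integral_const_mul,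
    intervalIntegral_eq_Ioo zero_le_one] at this
  linarith

end Frullani

/-- Inversion of the right Weyl-Marchaud derivative on the unit interval. -/
theorem inversion_unit {α Λ : ℝ} (h0 : 0 < α) (h1 : α < 1) {G : ℝ → ℝ} (hG : Continuous G)
    (hH : ∀ x ∈ Icc (0 : ℝ) 1, |G 0 - G x| ≤ Λ * x ^ (1 - α))
    (hI : ∀ u ∈ Ioo (0 : ℝ) 1, IntegrableOn (fun y => (G u - G y) / (y - u) ^ (2 - α)) (Ioo u 1))
    (hB : ∀ u ∈ Ioo (0 : ℝ) 1, ∫ y in Ioo u 1, |(G u - G y) / (y - u) ^ (2 - α)| ≤ Λ) :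
    ∫ u in (0 : ℝ)..1, u ^ (-α) * ((G u - G 1) / (1 - u) ^ (1 - α)
      + (1 - α) * ∫ y in u..1, (G u - G y) / (y - u) ^ (2 - α)) =
      Real.Gamma α * Real.Gamma (1 - α) * (G 0 - G 1) := by
  have hk := integrable_fracKernel h1 hG hI hB
  have hd := (integrable_dilationKernel hG hk).integral_prod_right
  have sw := integral_fracKernel_swap hG hk
  have eF : ∀ θ ∈ Ioo (0 : ℝ) 1, ∫ y in Ioo (0 : ℝ) 1, dilationKernel α G y θ =
      θ ^ (-α) * (1 - θ) ^ (α - 2) * ∫ y in θ..1, (G 0 - G y) / y := by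
    intro θ hθ
    simp only [dilationKernel, integral_const_mul]
    rw [integral_dilation_sub_div h1 hG hH hθ]
  have hi : IntegrableOn (fun θ : ℝ => θ ^ (-α) * (1 - θ) ^ (α - 2) *
        ∫ y in θ..1, (G 0 - G y) / y) (Ioo 0 1) := by
    refine Integrable.congr hd ?_
    filter_upwards [ae_restrict_mem measurableSet_Ioo] with θ hθ
    exact eF θ hθ
  have hmain := integral_beta_weight_mul h0 h1 hG hH hi
  have e1 : ∫ u in Ioo (0 : ℝ) 1, ∫ y in Ioo (0 : ℝ) 1, fracKernel α G u y =
      ∫ θ in Ioo (0 : ℝ) 1, θ ^ (-α) * (1 - θ) ^ (α - 2) * ∫ y in θ..1, (G 0 - G y) / y := by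
    rw [sw]
    refine setIntegral_congr_fun measurableSet_Ioo fun θ hθ => ?_
    rw [integral_dilation_sub_div h1 hG hH hθ]
  have slice : ∀ u ∈ Ioo (0 : ℝ) 1, ∫ y in Ioo (0 : ℝ) 1, fracKernel α G u y =
      u ^ (-α) * ∫ y in u..1, (G u - G y) / (y - u) ^ (2 - α) := by
    intro u hu
    simp only [fracKernel]
    rw [setIntegral_Ioo_ite_lt_right hu.1.le, integral_const_mul, intervalIntegral_eq_Ioo hu.2.le]
  have hb := intervalIntegrable_beta h0 h1
  have ib : IntervalIntegrable (fun u : ℝ => u ^ (-α) * (1 - u) ^ (α - 1) * (G u - G 1)) volume 0 1 :=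
    hb.mul_continuousOn (by fun_prop)
  have ic : IntervalIntegrable (fun u : ℝ => u ^ (-α) * (1 - u) ^ (α - 1) * (G 0 - G u)) volume 0 1 :=
    hb.mul_continuousOn (by fun_prop)
  have ik : IntervalIntegrable (fun u : ℝ => (1 - α) * ∫ y in Ioo (0 : ℝ) 1, fracKernel α G u y)
      volume 0 1 := by
    rw [intervalIntegrable_iff_Ioo zero_le_one]
    exact hk.integral_prod_left.const_mul _
  have e2 : ∫ u in (0 : ℝ)..1, u ^ (-α) * ((G u - G 1) / (1 - u) ^ (1 - α)
      + (1 - α) * ∫ y in u..1, (G u - G y) / (y - u) ^ (2 - α)) =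
      ∫ u in (0 : ℝ)..1, (u ^ (-α) * (1 - u) ^ (α - 1) * (G u - G 1) +
        (1 - α) * ∫ y in Ioo (0 : ℝ) 1, fracKernel α G u y) := by
    rw [intervalIntegral_eq_Ioo zero_le_one, intervalIntegral_eq_Ioo zero_le_one]
    refine setIntegral_congr_fun measurableSet_Ioo fun u hu => ?_
    have e : (1 - u) ^ (α - 1) = ((1 - u) ^ (1 - α))⁻¹ := by
      rw [← Real.rpow_neg (by linarith [hu.2])]; congr 1; ring
    rw [slice u hu, e]
    ring
  rw [e2, intervalIntegral.integral_add ib ik, intervalIntegral.integral_const_mul,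
    intervalIntegral_eq_Ioo zero_le_one (fun u => ∫ y in Ioo (0 : ℝ) 1, fracKernel α G u y),
    e1, hmain, ← intervalIntegral.integral_add ib ic, ← integral_beta h0 h1,
    ← intervalIntegral.integral_mul_const]
  -- The boundary term contributes G(u) - G(1) and the double integral G(0) - G(u), against the same
  -- Beta weight. G(u) cancels and B(1-α, α)(G(0) - G(1)) is left.
  refine intervalIntegral.integral_congr fun u _ => ?_
  ring

end

/-! ### The generalized Stieltjes integral of a constant. -/

section

/-- Continuous scalar functions of class `W̃^{1-α,∞}` on `[0,T]`, with an explicit constant. -/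
structure StieltjesIntegrator (α T Λ : ℝ) (g : ℝ → ℝ) : Prop where
  cont : Continuous g
  holder : ∀ r ∈ Icc 0 T, ∀ s ∈ Icc 0 T, |g r - g s| ≤ Λ * |r - s| ^ (1 - α)
  integrable : ∀ r s, 0 < r → r < s → s ≤ T →
    IntegrableOn (fun y => (g r - g y) / (y - r) ^ (2 - α)) (Ioo r s)
  bound : ∀ r s, 0 < r → r < s → s ≤ T →
    ∫ y in Ioo r s, |(g r - g y) / (y - r) ^ (2 - α)| ≤ Λ

theorem StieltjesIntegrator.nonneg {α T Λ : ℝ} {g : ℝ → ℝ} (hg : StieltjesIntegrator α T Λ g)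
    (hT : 0 < T) : 0 ≤ Λ :=
  (integral_nonneg fun _ => abs_nonneg _).trans
    (hg.bound (T / 2) T (by positivity) (by linarith) le_rfl)

/-- The Hölder bound and the integral bound contribute Λ each, uniformly in r and s. With this
supremum bound, |∫ f dg| is controlled by the L¹ norm of the left derivative of f alone. -/
theorem StieltjesIntegrator.abs_derivRight_le {α T Λ : ℝ} {g : ℝ → ℝ} (h0 : 0 < α) (h1 : α < 1)
    (hg : StieltjesIntegrator α T Λ g) {r s : ℝ} (hr : 0 < r) (hrs : r < s) (hs : s ≤ T) :
    |derivRight α s g r| ≤ 2 * Λ / Real.Gamma α := by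
  have hG := Real.Gamma_pos_of_pos h0
  have hΛ := hg.nonneg (hr.trans (hrs.trans_le hs))
  have hsr : 0 < s - r := sub_pos.2 hrs
  rw [derivRight, abs_mul, abs_of_pos (by positivity : 0 < 1 / Real.Gamma α), one_div_mul_eq_div]
  gcongr
  have b1 : |(g r - g s) / (s - r) ^ (1 - α)| ≤ Λ := by
    rw [abs_div, abs_of_pos (Real.rpow_pos_of_pos hsr _), div_le_iff₀ (Real.rpow_pos_of_pos hsr _)]
    have := hg.holder r ⟨hr.le, hrs.le.trans hs⟩ s ⟨hr.le.trans hrs.le, hs⟩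
    rwa [abs_sub_comm r s, abs_of_pos hsr] at this
  have b2 : |∫ y in r..s, (g r - g y) / (y - r) ^ (2 - α)| ≤ Λ := by
    rw [intervalIntegral_eq_Ioo hrs.le]
    exact (abs_integral_le_integral_abs).trans (hg.bound r s hr hrs hs)
  refine (abs_add_le _ _).trans ?_
  rw [abs_mul, abs_of_pos (by linarith : 0 < 1 - α)]
  nlinarith

theorem stronglyMeasurable_intervalIntegral {f : ℝ → ℝ → ℝ}
    (hf : Measurable (Function.uncurry f)) {a b : ℝ → ℝ} (ha : Measurable a) (hb : Measurable b) :
    StronglyMeasurable fun u => ∫ y in a u..b u, f u y := by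
  have key : ∀ {a b : ℝ → ℝ}, Measurable a → Measurable b →
      StronglyMeasurable fun u => ∫ y in Ioc (a u) (b u), f u y := by
    intro a b ha hb
    have : (fun u => ∫ y in Ioc (a u) (b u), f u y) =
        fun u => ∫ y, (if a u < y ∧ y ≤ b u then f u y else 0) := by
      ext u
      rw [← integral_indicator measurableSet_Ioc]
      simp only [indicator, mem_Ioc]
    rw [this]
    have hm : Measurable (Function.uncurry fun u y => if a u < y ∧ y ≤ b u then f u y else 0) := by
      refine Measurable.ite ?_ hf measurable_const
      exact (measurableSet_lt (ha.comp measurable_fst) measurable_snd).inter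
        (measurableSet_le measurable_snd (hb.comp measurable_fst))
    exact hm.stronglyMeasurable.integral_prod_right
  exact (key ha hb).sub (key hb ha)

theorem measurable_derivRight (α s : ℝ) {g : ℝ → ℝ} (hg : Measurable g) :
    Measurable (derivRight α s g) := by
  unfold derivRight
  have hm : Measurable (Function.uncurry fun r y : ℝ => (g r - g y) / (y - r) ^ (2 - α)) := by
    unfold Function.uncurry; fun_prop
  have := (stronglyMeasurable_intervalIntegral hm measurable_id (measurable_const (a := s))).measurable
  simp only [id] at this
  fun_prop

theorem measurable_derivLeft (α t : ℝ) {f : ℝ → ℝ} (hf : Measurable f) :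
    Measurable (derivLeft α t f) := by
  unfold derivLeft
  have hm : Measurable (Function.uncurry fun r y : ℝ => (f r - f y) / (r - y) ^ (α + 1)) := by
    unfold Function.uncurry; fun_prop
  have := (stronglyMeasurable_intervalIntegral hm (measurable_const (a := t)) measurable_id).measurable
  simp only [id] at this
  fun_prop

theorem derivLeft_const (α t c r : ℝ) :
    derivLeft α t (fun _ => c) r = 1 / Real.Gamma (1 - α) * (c / (r - t) ^ α) := by
  simp [derivLeft]

/-- Both terms have degree α - 1 under dilation: l^{-(1-α)} for the boundary term, l · l^{-(2-α)}
for the integral. -/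
theorem derivRight_affine {α a l x : ℝ} (hl : 0 < l) (hx : x < 1) (g : ℝ → ℝ) :
    derivRight α (a + l) g (a + l * x) =
      l ^ (α - 1) * derivRight α 1 (fun x => g (a + l * x)) x := by
  have hx' : 0 < 1 - x := by linarith
  have e1 : (a + l - (a + l * x)) ^ (1 - α) = l ^ (1 - α) * (1 - x) ^ (1 - α) := by
    rw [← Real.mul_rpow hl.le hx'.le]; congr 1; ring
  have e2 : ∫ y in (a + l * x)..(a + l), (g (a + l * x) - g y) / (y - (a + l * x)) ^ (2 - α) =
      l ^ (α - 1) * ∫ y in x..1, (g (a + l * x) - g (a + l * y)) / (y - x) ^ (2 - α) := by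
    have h := intervalIntegral.integral_comp_add_mul (a := x) (b := 1)
      (fun y => (g (a + l * x) - g y) / (y - (a + l * x)) ^ (2 - α)) hl.ne' a
    rw [mul_one, smul_eq_mul, eq_inv_mul_iff_mul_eq₀ hl.ne'] at h
    rw [← h, ← intervalIntegral.integral_const_mul, ← intervalIntegral.integral_const_mul]
    refine intervalIntegral.integral_congr fun y hy => ?_
    rw [uIcc_of_le hx.le] at hy
    have hy' : 0 ≤ y - x := by linarith [hy.1]
    have : (a + l * y - (a + l * x)) ^ (2 - α) = l ^ (2 - α) * (y - x) ^ (2 - α) := by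
      rw [← Real.mul_rpow hl.le hy']; congr 1; ring
    simp only [this]
    rw [show α - 1 = 1 + -(2 - α) by ring, Real.rpow_add hl, Real.rpow_one, Real.rpow_neg hl.le]
    rw [div_eq_mul_inv, div_eq_mul_inv, mul_inv]
    ring
  rw [derivRight, derivRight, e1, e2, show α - 1 = -(1 - α) by ring, Real.rpow_neg hl.le]
  simp only [mul_one]
  rw [div_eq_mul_inv, div_eq_mul_inv, mul_inv]
  ring

/-- The left derivative of a constant is c (r-a)^{-α}/Γ(1-α), so after rescaling [a,s] to [0,1] the
integral is the one of `inversion_unit`. The minus sign in `stieltjes` turns G(0) - G(1) into an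
increment of g. -/
theorem StieltjesIntegrator.stieltjes_const {α T Λ : ℝ} {g : ℝ → ℝ} (h0 : 0 < α) (h1 : α < 1)
    (hg : StieltjesIntegrator α T Λ g) {a s : ℝ} (ha : 0 ≤ a) (has : a ≤ s) (hs : s ≤ T) (c : ℝ) :
    stieltjes α a s (fun _ => c) g = c * (g s - g a) := by
  rcases has.eq_or_lt with rfl | has
  · simp [stieltjes]
  obtain ⟨l, hl, rfl⟩ : ∃ l, 0 < l ∧ s = a + l := ⟨s - a, by linarith, by ring⟩
  set G : ℝ → ℝ := fun x => g (a + l * x) with hGdef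
  have hGc : Continuous G := hg.cont.comp (by fun_prop)
  have hmem : ∀ x ∈ Icc (0 : ℝ) 1, a + l * x ∈ Icc 0 T := fun x hx =>
    ⟨by nlinarith [hx.1], by nlinarith [hx.2]⟩
  have hscale : ∀ u y : ℝ, u ≤ y → (g (a + l * u) - g (a + l * y)) /
      (a + l * y - (a + l * u)) ^ (2 - α) =
      (l ^ (2 - α))⁻¹ * ((G u - G y) / (y - u) ^ (2 - α)) := by
    intro u y huy
    have : (a + l * y - (a + l * u)) ^ (2 - α) = l ^ (2 - α) * (y - u) ^ (2 - α) := by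
      rw [← Real.mul_rpow hl.le (sub_nonneg.2 huy)]; congr 1; ring
    rw [this, div_eq_mul_inv, div_eq_mul_inv, mul_inv]
    ring
  have hlp : 0 < l ^ (2 - α) := Real.rpow_pos_of_pos hl _
  have hinv := inversion_unit (Λ := Λ * l ^ (1 - α)) h0 h1 hGc ?_ ?_ ?_
  · rw [stieltjes]
    have e := intervalIntegral.integral_comp_add_mul (a := 0) (b := 1)
      (fun r => derivLeft α a (fun _ => c) r * derivRight α (a + l) g r) hl.ne' a
    rw [mul_zero, add_zero, mul_one, smul_eq_mul, eq_inv_mul_iff_mul_eq₀ hl.ne'] at e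
    have hΓ1 := (Real.Gamma_pos_of_pos h0).ne'
    have hΓ2 := (Real.Gamma_pos_of_pos (sub_pos.2 h1)).ne'
    have e2 : ∫ x in (0 : ℝ)..1, derivLeft α a (fun _ => c) (a + l * x) *
        derivRight α (a + l) g (a + l * x) =
        (c * l⁻¹ / (Real.Gamma α * Real.Gamma (1 - α))) *
        ∫ u in (0 : ℝ)..1, u ^ (-α) * ((G u - G 1) / (1 - u) ^ (1 - α)
      + (1 - α) * ∫ y in u..1, (G u - G y) / (y - u) ^ (2 - α)) := by
      rw [← intervalIntegral.integral_const_mul, intervalIntegral_eq_Ioo zero_le_one,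
        intervalIntegral_eq_Ioo zero_le_one]
      refine setIntegral_congr_fun measurableSet_Ioo fun x hx => ?_
      rw [derivLeft_const, derivRight_affine hl hx.2, derivRight, add_sub_cancel_left,
        Real.mul_rpow hl.le hx.1.le, Real.rpow_sub_one hl.ne', Real.rpow_neg hx.1.le]
      have := (Real.rpow_pos_of_pos hl α).ne'
      field_simp
      simp only [hGdef, mul_one]
    rw [← e, e2, hinv]
    simp only [hGdef, mul_zero, add_zero, mul_one]
    field_simp
    ring
  · intro x hx
    have := hg.holder _ (hmem 0 ⟨le_rfl, zero_le_one⟩) _ (hmem x hx)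
    refine this.trans_eq ?_
    rw [mul_assoc, ← Real.mul_rpow hl.le hx.1,
      show a + l * 0 - (a + l * x) = -(l * x) by ring, abs_neg, abs_of_nonneg (by nlinarith [hx.1])]
  · intro u hu
    have h := hg.integrable (a + l * u) (a + l) (by nlinarith [hu.1]) (by nlinarith [hu.2]) hs
    rw [← intervalIntegrable_iff_Ioo (by nlinarith [hu.2])] at h
    have h2 := (h.comp_add_left a).comp_mul_left (c := l)
    rw [add_sub_cancel_left, add_sub_cancel_left, div_self hl.ne', mul_div_cancel_left₀ _ hl.ne',
      intervalIntegrable_iff_Ioo hu.2.le] at h2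
    refine (h2.const_mul (l ^ (2 - α))).congr ?_
    filter_upwards [ae_restrict_mem measurableSet_Ioo] with y hy
    rw [hscale u y hy.1.le, mul_inv_cancel_left₀ hlp.ne']
  · intro u hu
    have h := hg.bound (a + l * u) (a + l) (by nlinarith [hu.1]) (by nlinarith [hu.2]) hs
    have e := intervalIntegral.integral_comp_add_mul (a := u) (b := 1)
      (fun y => |(g (a + l * u) - g y) / (y - (a + l * u)) ^ (2 - α)|) hl.ne' a
    rw [mul_one, smul_eq_mul, eq_inv_mul_iff_mul_eq₀ hl.ne'] at e
    rw [← intervalIntegral_eq_Ioo (by nlinarith [hu.2]), ← e] at h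
    have e3 : ∫ y in u..1, |(g (a + l * u) - g (a + l * y)) /
        (a + l * y - (a + l * u)) ^ (2 - α)| =
        (l ^ (2 - α))⁻¹ * ∫ y in Ioo u 1, |(G u - G y) / (y - u) ^ (2 - α)| := by
      rw [← integral_const_mul, intervalIntegral_eq_Ioo hu.2.le]
      refine setIntegral_congr_fun measurableSet_Ioo fun y hy => ?_
      rw [hscale u y hy.1.le, abs_mul, abs_of_pos (inv_pos.2 hlp)]
    rw [e3, ← mul_assoc, show (2 : ℝ) - α = 1 + (1 - α) by ring, Real.rpow_add hl, Real.rpow_one,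
      mul_inv, mul_inv_cancel_left₀ hl.ne', inv_mul_le_iff₀ (Real.rpow_pos_of_pos hl _),
      mul_comm] at h
    rw [show (2 : ℝ) - α = 1 + (1 - α) by ring]
    exact h

end

/-! ### Linearity of the integral and extension of the integrand by zero. -/

section

/-- The exponent exceeds 1, so the right derivative is zero everywhere. This replaces a limit over
partitions wherever an additivity or an integral identity is proved. -/
theorem eq_of_norm_sub_le_rpow {E : Type*} [NormedAddCommGroup E] [NormedSpace ℝ E]
    {Y : ℝ → E} {a b C θ : ℝ} (hθ : 0 < θ)
    (h : ∀ x y, a ≤ x → x ≤ y → y ≤ b → ‖Y y - Y x‖ ≤ C * (y - x) ^ (1 + θ)) :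
    ∀ x ∈ Icc a b, Y x = Y a := by
  have hd : ∀ x ∈ Ico a b, HasDerivWithinAt Y 0 (Ici x) x := by
    intro x hx
    rw [hasDerivWithinAt_iff_isLittleO, Asymptotics.isLittleO_iff]
    intro c hc
    have hlim : Tendsto (fun y => C * (y - x) ^ θ) (𝓝[≥] x) (𝓝 0) := by
      have : ContinuousAt (fun y : ℝ => C * (y - x) ^ θ) x :=
        continuousAt_const.mul (ContinuousAt.rpow_const (by fun_prop) (Or.inr hθ.le))
      have h2 := this.tendsto.mono_left (nhdsWithin_le_nhds (s := Ici x))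
      simpa [Real.zero_rpow hθ.ne'] using h2
    filter_upwards [hlim.eventually (gt_mem_nhds hc), Icc_mem_nhdsGE hx.2] with y hy hyb
    have h3 := h x y hx.1 hyb.1 hyb.2
    have h4 : 0 ≤ y - x := sub_nonneg.2 hyb.1
    rw [smul_zero, sub_zero, Real.norm_of_nonneg h4]
    refine h3.trans ?_
    rw [Real.rpow_add_of_nonneg h4 zero_le_one hθ.le, Real.rpow_one]
    nlinarith
  refine constant_of_has_deriv_right_zero ?_ hd
  intro x hx
  have key : ∀ y ∈ Icc a b, ‖Y y - Y x‖ ≤ C * |y - x| ^ (1 + θ) := by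
    intro y hy
    rcases le_total x y with hxy | hxy
    · rw [abs_of_nonneg (sub_nonneg.2 hxy)]; exact h x y hx.1 hxy hy.2
    · rw [norm_sub_rev, abs_sub_comm, abs_of_nonneg (sub_nonneg.2 hxy)]; exact h y x hy.1 hxy hx.2
  rw [ContinuousWithinAt, tendsto_iff_norm_sub_tendsto_zero]
  have hlim : Tendsto (fun y => C * |y - x| ^ (1 + θ)) (𝓝[Icc a b] x) (𝓝 0) := by
    have : ContinuousAt (fun y : ℝ => C * |y - x| ^ (1 + θ)) x :=
      continuousAt_const.mul (ContinuousAt.rpow_const (by fun_prop) (Or.inr (by linarith)))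
    have h2 := this.tendsto.mono_left (nhdsWithin_le_nhds (s := Icc a b))
    simpa [Real.zero_rpow (by linarith : (1 + θ) ≠ 0)] using h2
  refine squeeze_zero' (Eventually.of_forall fun _ => norm_nonneg _) ?_ hlim
  filter_upwards [self_mem_nhdsWithin] with y hy using key y hy

variable {α t s : ℝ} {f f₁ f₂ g : ℝ → ℝ}

/-- The functions whose left Weyl-Marchaud derivative of order `α` on `(t,s)` is given by absolutely
convergent integrals and is itself integrable. -/
def FracDiff (α t s : ℝ) (f : ℝ → ℝ) : Prop :=
  (∀ᵐ u, u ∈ Ioo t s →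
    IntervalIntegrable (fun y => (f u - f y) / (u - y) ^ (α + 1)) volume t u) ∧
  IntegrableOn (derivLeft α t f) (Ioo t s)

theorem derivLeft_congr {u : ℝ} (htu : t ≤ u) (h : EqOn f₁ f₂ (Icc t u)) :
    derivLeft α t f₁ u = derivLeft α t f₂ u := by
  rw [derivLeft, derivLeft, h ⟨htu, le_rfl⟩]
  congr 3
  refine intervalIntegral.integral_congr fun y hy => ?_
  rw [uIcc_of_le htu] at hy
  simp only [h hy]

theorem derivRight_congr {u : ℝ} (hus : u ≤ s) (h : EqOn f₁ f₂ (Icc u s)) :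
    derivRight α s f₁ u = derivRight α s f₂ u := by
  rw [derivRight, derivRight, h ⟨hus, le_rfl⟩, h ⟨le_rfl, hus⟩]
  congr 3
  refine intervalIntegral.integral_congr fun y hy => ?_
  rw [uIcc_of_le hus] at hy
  simp only [h hy]

theorem stieltjes_congr {g₁ g₂ : ℝ → ℝ} (hts : t ≤ s) (hf : EqOn f₁ f₂ (Icc t s))
    (hg : EqOn g₁ g₂ (Icc t s)) : stieltjes α t s f₁ g₁ = stieltjes α t s f₂ g₂ := by
  rw [stieltjes, stieltjes]
  congr 1
  refine intervalIntegral.integral_congr fun u hu => ?_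
  rw [uIcc_of_le hts] at hu
  simp only [derivLeft_congr (α := α) hu.1 (hf.mono (Icc_subset_Icc_right hu.2)),
    derivRight_congr (α := α) hu.2 (hg.mono (Icc_subset_Icc_left hu.1))]

theorem FracDiff.congr (h : FracDiff α t s f₁) (e : EqOn f₁ f₂ (Icc t s)) : FracDiff α t s f₂ := by
  refine ⟨?_, h.2.congr ?_⟩
  · filter_upwards [h.1] with u hu hus
    refine (hu hus).congr fun y hy => ?_
    rw [uIoc_of_le hus.1.le] at hy
    simp only [e ⟨hus.1.le, hus.2.le⟩, e ⟨hy.1.le, hy.2.trans hus.2.le⟩]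
  · filter_upwards [ae_restrict_mem measurableSet_Ioo] with u hu
    exact derivLeft_congr hu.1.le (e.mono (Icc_subset_Icc_right hu.2.le))

theorem derivLeft_const_mul (c u : ℝ) :
    derivLeft α t (fun x => c * f x) u = c * derivLeft α t f u := by
  have : ∀ y, (c * f u - c * f y) / (u - y) ^ (α + 1) =
      c * ((f u - f y) / (u - y) ^ (α + 1)) := fun y => by ring
  simp only [derivLeft, this, intervalIntegral.integral_const_mul]
  ring

theorem FracDiff.const_mul (h : FracDiff α t s f) (c : ℝ) : FracDiff α t s fun x => c * f x := by
  constructor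
  · filter_upwards [h.1] with u hu hus
    have := (hu hus).const_mul c
    refine this.congr fun y _ => ?_
    ring
  · have : derivLeft α t (fun x => c * f x) = fun u => c * derivLeft α t f u :=
      funext fun u => derivLeft_const_mul c u
    rw [this]
    exact h.2.const_mul c

theorem FracDiff.derivLeft_sub (h₁ : FracDiff α t s f₁) (h₂ : FracDiff α t s f₂) :
    ∀ᵐ u, u ∈ Ioo t s →
      derivLeft α t (fun x => f₁ x - f₂ x) u = derivLeft α t f₁ u - derivLeft α t f₂ u := by
  filter_upwards [h₁.1, h₂.1] with u hu₁ hu₂ hu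
  have : ∀ y, (f₁ u - f₂ u - (f₁ y - f₂ y)) / (u - y) ^ (α + 1) =
      (f₁ u - f₁ y) / (u - y) ^ (α + 1) - (f₂ u - f₂ y) / (u - y) ^ (α + 1) := fun y => by ring
  simp only [derivLeft, this]
  rw [intervalIntegral.integral_sub (hu₁ hu) (hu₂ hu)]
  ring

theorem FracDiff.sub (h₁ : FracDiff α t s f₁) (h₂ : FracDiff α t s f₂) :
    FracDiff α t s fun x => f₁ x - f₂ x := by
  constructor
  · filter_upwards [h₁.1, h₂.1] with u hu₁ hu₂ hu
    refine ((hu₁ hu).sub (hu₂ hu)).congr fun y _ => ?_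
    ring
  · refine (h₁.2.sub h₂.2).congr ?_
    filter_upwards [ae_restrict_of_ae (h₁.derivLeft_sub h₂), ae_restrict_mem measurableSet_Ioo]
      with u h hu
    exact (h hu).symm

variable {T Λ : ℝ}

theorem FracDiff.integrableOn_mul (h0 : 0 < α) (h1 : α < 1) (hg : StieltjesIntegrator α T Λ g)
    (h : FracDiff α t s f) (ht : 0 ≤ t) (hs : s ≤ T) :
    IntegrableOn (fun u => derivLeft α t f u * derivRight α s g u) (Ioo t s) := by
  refine Integrable.mul_bdd (c := 2 * Λ / Real.Gamma α) h.2
    (measurable_derivRight α s hg.cont.measurable).aestronglyMeasurable ?_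
  filter_upwards [ae_restrict_mem measurableSet_Ioo] with u hu
  exact hg.abs_derivRight_le h0 h1 (ht.trans_lt hu.1) hu.2 hs

theorem FracDiff.stieltjes_sub (h0 : 0 < α) (h1 : α < 1) (hg : StieltjesIntegrator α T Λ g)
    (h₁ : FracDiff α t s f₁) (h₂ : FracDiff α t s f₂) (ht : 0 ≤ t) (hts : t ≤ s) (hs : s ≤ T) :
    stieltjes α t s (fun x => f₁ x - f₂ x) g = stieltjes α t s f₁ g - stieltjes α t s f₂ g := by
  have i₁ := h₁.integrableOn_mul h0 h1 hg ht hs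
  have i₂ := h₂.integrableOn_mul h0 h1 hg ht hs
  rw [stieltjes, stieltjes, stieltjes, intervalIntegral_eq_Ioo hts, intervalIntegral_eq_Ioo hts,
    intervalIntegral_eq_Ioo hts, ← neg_sub', ← integral_sub i₁ i₂]
  congr 1
  refine integral_congr_ae ?_
  filter_upwards [ae_restrict_of_ae (h₁.derivLeft_sub h₂), ae_restrict_mem measurableSet_Ioo]
    with u h hu
  rw [h hu]; ring

theorem stieltjes_const_mul (c : ℝ) :
    stieltjes α t s (fun x => c * f x) g = c * stieltjes α t s f g := by
  simp only [stieltjes, derivLeft_const_mul, mul_assoc, intervalIntegral.integral_const_mul]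
  ring

theorem abs_stieltjes_le (h0 : 0 < α) (h1 : α < 1) (hg : StieltjesIntegrator α T Λ g)
    (ht : 0 ≤ t) (hts : t ≤ s) (hs : s ≤ T) {B : ℝ → ℝ} (hB : IntegrableOn B (Ioo t s))
    (h : ∀ᵐ u, u ∈ Ioo t s → |derivLeft α t f u| ≤ B u) :
    |stieltjes α t s f g| ≤ 2 * Λ / Real.Gamma α * ∫ u in Ioo t s, B u := by
  rw [stieltjes, abs_neg, intervalIntegral_eq_Ioo hts, ← integral_const_mul, ← Real.norm_eq_abs]
  refine norm_integral_le_of_norm_le (hB.const_mul _) ?_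
  filter_upwards [ae_restrict_of_ae h, ae_restrict_mem measurableSet_Ioo] with u h hu
  rw [norm_mul, mul_comm]
  have h1 := hg.abs_derivRight_le h0 h1 (ht.trans_lt hu.1) hu.2 hs
  have h2 := h hu
  simp only [Real.norm_eq_abs]
  exact mul_le_mul h1 h2 (abs_nonneg _) ((abs_nonneg _).trans h1)

theorem integral_left_kernel (h0 : 0 < α) {r u : ℝ} (htr : t ≤ r) (hru : r < u) :
    IntervalIntegrable (fun y => 1 / (u - y) ^ (α + 1)) volume t r ∧
    ∫ y in t..r, 1 / (u - y) ^ (α + 1) = ((u - r) ^ (-α) - (u - t) ^ (-α)) / α := by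
  have hpos : ∀ y ∈ uIcc t r, 0 < u - y := by
    intro y hy; rw [uIcc_of_le htr] at hy; linarith [hy.2]
  have hi : IntervalIntegrable (fun y => 1 / (u - y) ^ (α + 1)) volume t r := by
    refine ContinuousOn.intervalIntegrable fun y hy => ContinuousAt.continuousWithinAt ?_
    refine continuousAt_const.div (ContinuousAt.rpow_const (by fun_prop) (Or.inl (hpos y hy).ne')) ?_
    exact (Real.rpow_pos_of_pos (hpos y hy) _).ne'
  refine ⟨hi, ?_⟩
  rw [intervalIntegral.integral_eq_sub_of_hasDerivAt (f := fun y => (u - y) ^ (-α) / α) ?_ hi]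
  · ring
  · intro y hy
    have := (HasDerivAt.rpow_const (p := -α) ((hasDerivAt_id y).const_sub u)
      (Or.inl (hpos y hy).ne')).div_const α
    refine this.congr_deriv ?_
    rw [show -α - 1 = -(α + 1) by ring, id, Real.rpow_neg (hpos y hy).le]
    field_simp

theorem derivLeft_of_eqOn_zero_left {r u : ℝ} (htu : t ≤ u) (hur : u < r)
    (hf : ∀ y ∈ Ico t r, f y = 0) :
    IntervalIntegrable (fun y => (f u - f y) / (u - y) ^ (α + 1)) volume t u ∧
    derivLeft α t f u = 0 := by
  have e : ∀ y ∈ Icc t u, (f u - f y) / (u - y) ^ (α + 1) = 0 := by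
    intro y hy
    rw [hf u ⟨htu, hur⟩, hf y ⟨hy.1, hy.2.trans_lt hur⟩]; simp
  constructor
  · refine (intervalIntegrable_const (c := (0 : ℝ))).congr fun y hy => ?_
    rw [uIoc_of_le htu] at hy
    exact (e y ⟨hy.1.le, hy.2⟩).symm
  · rw [derivLeft, intervalIntegral.integral_congr (g := fun _ => 0), hf u ⟨htu, hur⟩]
    · simp
    · intro y hy; rw [uIcc_of_le htu] at hy; exact e y hy

/-- On [t,r) the difference quotient is f(u)(u-y)^{-α-1}, whose integral is explicit. Times α, it
equals f(u)((u-r)^{-α} - (u-t)^{-α}), which exactly trades the boundary term at t for the one at r.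
-/
theorem derivLeft_of_eqOn_zero_right (h0 : 0 < α) {r u : ℝ} (htr : t ≤ r) (hru : r < u)
    (hf : ∀ y ∈ Ico t r, f y = 0)
    (hi : IntervalIntegrable (fun y => (f u - f y) / (u - y) ^ (α + 1)) volume r u) :
    IntervalIntegrable (fun y => (f u - f y) / (u - y) ^ (α + 1)) volume t u ∧
    derivLeft α t f u = derivLeft α r f u := by
  obtain ⟨k1, k2⟩ := integral_left_kernel h0 htr hru
  have e : EqOn (fun y => f u * (1 / (u - y) ^ (α + 1)))
      (fun y => (f u - f y) / (u - y) ^ (α + 1)) (Ioo t r) := by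
    intro y hy
    simp only [hf y ⟨hy.1.le, hy.2⟩]; ring
  have i1 : IntervalIntegrable (fun y => (f u - f y) / (u - y) ^ (α + 1)) volume t r := by
    rw [intervalIntegrable_iff_Ioo htr]
    exact ((intervalIntegrable_iff_Ioo htr _).1 (k1.const_mul (f u))).congr_fun e measurableSet_Ioo
  refine ⟨i1.trans hi, ?_⟩
  have e2 : ∫ y in t..r, (f u - f y) / (u - y) ^ (α + 1) =
      f u * (((u - r) ^ (-α) - (u - t) ^ (-α)) / α) := by
    rw [← k2, ← intervalIntegral.integral_const_mul, intervalIntegral_eq_Ioo htr,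
      intervalIntegral_eq_Ioo htr]
    exact (setIntegral_congr_fun measurableSet_Ioo e).symm
  rw [derivLeft, derivLeft, ← intervalIntegral.integral_add_adjacent_intervals i1 hi, e2,
    Real.rpow_neg (by linarith), Real.rpow_neg (by linarith)]
  field_simp
  ring

theorem ae_ne (a : ℝ) : ∀ᵐ u : ℝ, u ≠ a := by
  rw [ae_iff]; simp

/-- The left derivatives based at t and at r agree after r, and the former is zero before r. The
lower limit of integration can thus be moved freely through a zero stretch of the integrand. -/
theorem FracDiff.extend_left (h0 : 0 < α) {r : ℝ} (htr : t ≤ r) (hrs : r ≤ s)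
    (hf : ∀ y ∈ Ico t r, f y = 0) (h : FracDiff α r s f) :
    FracDiff α t s f ∧ stieltjes α t s f g = stieltjes α r s f g := by
  have hder : ∀ᵐ u, u ∈ Ioo t s → derivLeft α t f u = (Ioo r s).indicator (derivLeft α r f) u := by
    filter_upwards [h.1, ae_ne r] with u hu hur hus
    rcases lt_or_gt_of_ne hur with h1 | h1
    · rw [(derivLeft_of_eqOn_zero_left hus.1.le h1 hf).2, indicator_of_notMem]
      exact fun hm => (hm.1.trans h1).false
    · rw [(derivLeft_of_eqOn_zero_right h0 htr h1 hf (hu ⟨h1, hus.2⟩)).2,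
        indicator_of_mem (show u ∈ Ioo r s from ⟨h1, hus.2⟩)]
  have hsub : Ioo r s ∩ Ioo t s = Ioo r s :=
    inter_eq_left.2 (Ioo_subset_Ioo_left htr)
  refine ⟨⟨?_, ?_⟩, ?_⟩
  · filter_upwards [h.1, ae_ne r] with u hu hur hus
    rcases lt_or_gt_of_ne hur with h1 | h1
    · exact (derivLeft_of_eqOn_zero_left hus.1.le h1 hf).1
    · exact (derivLeft_of_eqOn_zero_right h0 htr h1 hf (hu ⟨h1, hus.2⟩)).1
  · have : IntegrableOn ((Ioo r s).indicator (derivLeft α r f)) (Ioo t s) := by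
      rw [integrableOn_indicator_iff measurableSet_Ioo, hsub]; exact h.2
    refine this.congr ?_
    filter_upwards [ae_restrict_of_ae hder, ae_restrict_mem measurableSet_Ioo] with u hu hus
    exact (hu hus).symm
  · rw [stieltjes, stieltjes, intervalIntegral_eq_Ioo (htr.trans hrs), intervalIntegral_eq_Ioo hrs]
    congr 1
    have : ∫ u in Ioo t s, derivLeft α t f u * derivRight α s g u =
        ∫ u in Ioo t s, (Ioo r s).indicator (fun u => derivLeft α r f u * derivRight α s g u) u := by
      refine integral_congr_ae ?_
      filter_upwards [ae_restrict_of_ae hder, ae_restrict_mem measurableSet_Ioo] with u hu hus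
      rw [hu hus]
      by_cases hm : u ∈ Ioo r s
      · rw [indicator_of_mem hm, indicator_of_mem hm]
      · rw [indicator_of_notMem hm, indicator_of_notMem hm, zero_mul]
    rw [this, setIntegral_indicator measurableSet_Ioo, inter_comm, hsub]

end

/-! ### Estimates for Hölder integrands, step functions and bumps. -/

section

variable {α l t s T Λ A : ℝ} {f g : ℝ → ℝ}

theorem integral_rpow_sub_left {p u : ℝ} (hp : -1 < p) :
    IntervalIntegrable (fun y => (u - y) ^ p) volume t u ∧
    ∫ y in t..u, (u - y) ^ p = (u - t) ^ (p + 1) / (p + 1) := by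
  constructor
  · have := (intervalIntegral.intervalIntegrable_rpow' (a := u - t) (b := 0) hp).comp_sub_left u
    simpa using this
  · rw [intervalIntegral.integral_comp_sub_left (fun y => y ^ p), integral_rpow (Or.inl hp),
      sub_self, Real.zero_rpow (by linarith), sub_zero]

theorem integral_rpow_sub_right {p u : ℝ} (hp : -1 < p) :
    IntervalIntegrable (fun y => (y - t) ^ p) volume t u ∧
    ∫ y in t..u, (y - t) ^ p = (u - t) ^ (p + 1) / (p + 1) := by
  constructor
  · have := (intervalIntegral.intervalIntegrable_rpow' (a := 0) (b := u - t) hp).comp_sub_right t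
    simpa using this
  · rw [intervalIntegral.integral_comp_sub_right (fun y => y ^ p), integral_rpow (Or.inl hp),
      sub_self, Real.zero_rpow (by linarith), sub_zero]

/-- The constant of the fractional derivative of order `α` of an `l`-Hölder function. -/
def holderConst (α l : ℝ) : ℝ := (1 + α / (l - α)) / Real.Gamma (1 - α)

theorem holderConst_nonneg (h0 : 0 < α) (h1 : α < 1) (hl : α < l) : 0 ≤ holderConst α l := by
  have := Real.Gamma_pos_of_pos (sub_pos.2 h1)
  have := sub_pos.2 hl
  unfold holderConst; positivity

/-- The Hölder bound leaves (u-y)^{l-α-1} in the integral, integrable because α < l. The value f(t)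
is kept apart: it alone produces the singular term (u-t)^{-α}, absent when f(t) = 0. -/
theorem derivLeft_holder (h0 : 0 < α) (h1 : α < 1) (hl : α < l) (hf : Measurable f) {u : ℝ}
    (htu : t < u) (hH : ∀ y ∈ Icc t u, |f u - f y| ≤ A * (u - y) ^ l) :
    IntervalIntegrable (fun y => (f u - f y) / (u - y) ^ (α + 1)) volume t u ∧
    |derivLeft α t f u| ≤
      1 / Real.Gamma (1 - α) * (|f t| * (u - t) ^ (-α)) + holderConst α l * A * (u - t) ^ (l - α) := by
  have hΓ := Real.Gamma_pos_of_pos (sub_pos.2 h1)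
  have hut := sub_pos.2 htu
  have hla := sub_pos.2 hl
  obtain ⟨k1, k2⟩ := integral_rpow_sub_left (t := t) (u := u) (p := l - α - 1) (by linarith)
  have hb : ∀ y ∈ Ioo t u, ‖(f u - f y) / (u - y) ^ (α + 1)‖ ≤ A * (u - y) ^ (l - α - 1) := by
    intro y hy
    have hy' := sub_pos.2 hy.2
    rw [Real.norm_eq_abs, abs_div, abs_of_pos (Real.rpow_pos_of_pos hy' _),
      div_le_iff₀ (Real.rpow_pos_of_pos hy' _), mul_assoc, ← Real.rpow_add hy']
    refine (hH y ⟨hy.1.le, hy.2.le⟩).trans_eq ?_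
    congr 2; ring
  have hi : IntervalIntegrable (fun y => (f u - f y) / (u - y) ^ (α + 1)) volume t u := by
    rw [intervalIntegrable_iff_Ioo htu.le]
    refine Integrable.mono' ((intervalIntegrable_iff_Ioo htu.le _).1 (k1.const_mul A))
      (Measurable.aestronglyMeasurable (by fun_prop)) ?_
    filter_upwards [ae_restrict_mem measurableSet_Ioo] with y hy using hb y hy
  refine ⟨hi, ?_⟩
  have hint : |∫ y in t..u, (f u - f y) / (u - y) ^ (α + 1)| ≤ A * ((u - t) ^ (l - α) / (l - α)) := by
    have e := k2
    rw [sub_add_cancel] at e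
    rw [← e, ← intervalIntegral.integral_const_mul, intervalIntegral_eq_Ioo htu.le,
      intervalIntegral_eq_Ioo htu.le, ← Real.norm_eq_abs]
    refine norm_integral_le_of_norm_le
      ((intervalIntegrable_iff_Ioo htu.le _).1 (k1.const_mul A)) ?_
    filter_upwards [ae_restrict_mem measurableSet_Ioo] with y hy using hb y hy
  have hfu : |f u| ≤ |f t| + A * (u - t) ^ l := by
    have := hH t ⟨le_rfl, htu.le⟩
    have h2 := abs_add_le (f u - f t) (f t)
    rw [sub_add_cancel] at h2
    linarith
  have hfu' : |f u / (u - t) ^ α| ≤ |f t| * (u - t) ^ (-α) + A * (u - t) ^ (l - α) := by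
    rw [abs_div, abs_of_pos (Real.rpow_pos_of_pos hut _), div_eq_mul_inv, ← Real.rpow_neg hut.le,
      sub_eq_add_neg l α, Real.rpow_add hut, ← mul_assoc, ← add_mul]
    exact mul_le_mul_of_nonneg_right hfu (Real.rpow_nonneg hut.le _)
  rw [derivLeft, abs_mul, abs_of_pos (by positivity : 0 < 1 / Real.Gamma (1 - α)), holderConst]
  have h3 : |f u / (u - t) ^ α + α * ∫ y in t..u, (f u - f y) / (u - y) ^ (α + 1)| ≤
      |f t| * (u - t) ^ (-α) + (1 + α / (l - α)) * (A * (u - t) ^ (l - α)) := by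
    refine (abs_add_le _ _).trans ?_
    rw [abs_mul, abs_of_pos h0]
    have := mul_le_mul_of_nonneg_left hint h0.le
    have e : α * (A * ((u - t) ^ (l - α) / (l - α))) = α / (l - α) * (A * (u - t) ^ (l - α)) := by
      ring
    linarith
  refine (mul_le_mul_of_nonneg_left h3 (by positivity)).trans_eq ?_
  ring

theorem fracDiff_of_holder (h0 : 0 < α) (h1 : α < 1) (hl : α < l) (hf : Measurable f)
    (hts : t ≤ s) (hH : ∀ x ∈ Icc t s, ∀ y ∈ Icc t s, |f x - f y| ≤ A * |x - y| ^ l) :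
    FracDiff α t s f := by
  have hH' : ∀ u ∈ Ioo t s, ∀ y ∈ Icc t u, |f u - f y| ≤ A * (u - y) ^ l := by
    intro u hu y hy
    have := hH u ⟨hu.1.le, hu.2.le⟩ y ⟨hy.1, hy.2.trans hu.2.le⟩
    rwa [abs_of_nonneg (sub_nonneg.2 hy.2)] at this
  refine ⟨Eventually.of_forall fun u hu => (derivLeft_holder h0 h1 hl hf hu.1 (hH' u hu)).1, ?_⟩
  have k1 := (integral_rpow_sub_right (t := t) (u := s) (p := -α) (by linarith)).1
  have k2 := (integral_rpow_sub_right (t := t) (u := s) (p := l - α) (by linarith)).1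
  refine Integrable.mono' ((intervalIntegrable_iff_Ioo hts _).1
    (((k1.const_mul |f t|).const_mul (1 / Real.Gamma (1 - α))).add
      (k2.const_mul (holderConst α l * A)))) (measurable_derivLeft α t hf).aestronglyMeasurable ?_
  filter_upwards [ae_restrict_mem measurableSet_Ioo] with u hu
  exact (derivLeft_holder h0 h1 hl hf hu.1 (hH' u hu)).2

theorem fracDiff_const (h0 : 0 < α) (h1 : α < 1) (hts : t ≤ s) (c : ℝ) :
    FracDiff α t s fun _ => c :=
  fracDiff_of_holder (l := 1) (A := 0) h0 h1 h1 measurable_const hts (by simp)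

theorem abs_stieltjes_le_of_holder (h0 : 0 < α) (h1 : α < 1) (hl : α < l) (hA : 0 ≤ A)
    (hg : StieltjesIntegrator α T Λ g) (hΛ : 0 ≤ Λ) (hf : Measurable f)
    (ht : 0 ≤ t) (hts : t ≤ s) (hs : s ≤ T) (hft : f t = 0)
    (hH : ∀ x ∈ Icc t s, ∀ y ∈ Icc t s, |f x - f y| ≤ A * |x - y| ^ l) :
    |stieltjes α t s f g| ≤ 2 * Λ / Real.Gamma α * holderConst α l * A * (s - t) ^ (1 + l - α) := by
  obtain ⟨k1, k2⟩ := integral_rpow_sub_right (t := t) (u := s) (p := l - α) (by linarith)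
  have hΓ := Real.Gamma_pos_of_pos h0
  have hc := holderConst_nonneg h0 h1 hl
  have h := abs_stieltjes_le (f := f) h0 h1 hg ht hts hs
    ((intervalIntegrable_iff_Ioo hts _).1 (k1.const_mul (holderConst α l * A))) ?_
  · refine h.trans ?_
    rw [integral_const_mul, ← intervalIntegral_eq_Ioo hts, k2]
    have : (s - t) ^ (l - α + 1) / (l - α + 1) ≤ (s - t) ^ (1 + l - α) := by
      rw [show l - α + 1 = 1 + l - α by ring]
      exact div_le_self (Real.rpow_nonneg (sub_nonneg.2 hts) _) (by linarith)
    calc _ = 2 * Λ / Real.Gamma α * holderConst α l * A * ((s - t) ^ (l - α + 1) / (l - α + 1)) := by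
          ring
      _ ≤ _ := mul_le_mul_of_nonneg_left this (by positivity)
  · refine Eventually.of_forall fun u hu => ?_
    have := (derivLeft_holder (A := A) h0 h1 hl hf hu.1 (fun y hy => ?_)).2
    · simpa [hft] using this
    · have := hH u ⟨hu.1.le, hu.2.le⟩ y ⟨hy.1, hy.2.trans hu.2.le⟩
      rwa [abs_of_nonneg (sub_nonneg.2 hy.2)] at this

/-- The indicator function of `[a, ∞)`. -/
def stepAt (a u : ℝ) : ℝ := if a ≤ u then 1 else 0

theorem measurable_stepAt (a : ℝ) : Measurable (stepAt a) :=
  Measurable.ite measurableSet_Ici measurable_const measurable_const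

/-- The step is zero before a and constant after, so the lower limit moves to a and
`stieltjes_const` applies. -/
theorem stieltjes_stepAt (h0 : 0 < α) (h1 : α < 1) (hg : StieltjesIntegrator α T Λ g)
    (ht : 0 ≤ t) {a : ℝ} (hta : t ≤ a) (has : a ≤ s) (hs : s ≤ T) :
    FracDiff α t s (stepAt a) ∧ stieltjes α t s (stepAt a) g = g s - g a := by
  have e : EqOn (fun _ => (1 : ℝ)) (stepAt a) (Icc a s) := fun u hu => by simp [stepAt, hu.1]
  obtain ⟨h2, h3⟩ := FracDiff.extend_left (g := g) h0 hta has
    (fun y hy => by simp [stepAt, hy.2]) ((fracDiff_const h0 h1 has 1).congr e)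
  refine ⟨h2, h3.trans ?_⟩
  rw [← stieltjes_congr has e (fun _ _ => rfl), hg.stieltjes_const h0 h1 (ht.trans hta) has hs,
    one_mul]

theorem holder_min (hl : 0 ≤ l) (hA : 0 ≤ A) {r : ℝ} (htr : t ≤ r)
    (hH : ∀ x ∈ Icc t s, ∀ y ∈ Icc t s, |f x - f y| ≤ A * |x - y| ^ l) :
    ∀ x ∈ Icc t s, ∀ y ∈ Icc t s, |f (min x r) - f (min y r)| ≤ A * |x - y| ^ l := by
  intro x hx y hy
  refine (hH _ ⟨le_min hx.1 htr, (min_le_left _ _).trans hx.2⟩ _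
    ⟨le_min hy.1 htr, (min_le_left _ _).trans hy.2⟩).trans ?_
  exact mul_le_mul_of_nonneg_left
    (Real.rpow_le_rpow (abs_nonneg _) (abs_inf_sub_inf_le_abs x y r) hl) hA

/-- The part of `f - f r` on `[r, r')`, extended by zero. -/
def bump (f : ℝ → ℝ) (r r' u : ℝ) : ℝ :=
  f (min u r') - f (min u r) - (f r' - f r) * stepAt r' u

theorem bump_left {r r' u : ℝ} (hr : r ≤ r') (hu : u < r) : bump f r r' u = 0 := by
  rw [bump, min_eq_left (hu.le.trans hr), min_eq_left hu.le, stepAt, if_neg (by linarith)]; ring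

theorem bump_mid {r r' u : ℝ} (hu : r ≤ u) (hu' : u < r') : bump f r r' u = f u - f r := by
  rw [bump, min_eq_left hu'.le, min_eq_right hu, stepAt, if_neg (by linarith)]; ring

theorem bump_right {r r' u : ℝ} (hr : r ≤ r') (hu : r' ≤ u) : bump f r r' u = 0 := by
  rw [bump, min_eq_right hu, min_eq_right (hr.trans hu), stepAt, if_pos hu]; ring

theorem measurable_bump (hf : Measurable f) (r r' : ℝ) : Measurable (bump f r r') := by
  have := measurable_stepAt r'
  unfold bump
  fun_prop

theorem abs_derivLeft_bump_le (h0 : 0 < α) (h1 : α < 1) {r r' u : ℝ} (hr : r ≤ r') (hu : r' < u) (hf : Measurable f)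
    (hH : ∀ x ∈ Icc r r', |f x - f r| ≤ A * (r' - r) ^ l) :
    |derivLeft α r (bump f r r') u| ≤
      1 / Real.Gamma (1 - α) * (A * (r' - r) ^ l * ((u - r') ^ (-α) - (u - r) ^ (-α))) := by
  have hΓ := Real.Gamma_pos_of_pos (sub_pos.2 h1)
  obtain ⟨k1, k2⟩ := integral_left_kernel h0 hr hu
  have hb : ∀ y ∈ Ioo r r', ‖(bump f r r' u - bump f r r' y) / (u - y) ^ (α + 1)‖ ≤
      A * (r' - r) ^ l * (1 / (u - y) ^ (α + 1)) := by
    intro y hy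
    have hy' : 0 < u - y := by linarith [hy.2]
    rw [bump_right hr hu.le, bump_mid hy.1.le hy.2, zero_sub, norm_div, norm_neg, Real.norm_eq_abs,
      Real.norm_of_nonneg (Real.rpow_nonneg hy'.le _), mul_one_div]
    gcongr
    exact hH y ⟨hy.1.le, hy.2.le⟩
  have hm := measurable_bump hf r r'
  have i1 : IntervalIntegrable
      (fun y => (bump f r r' u - bump f r r' y) / (u - y) ^ (α + 1)) volume r r' := by
    rw [intervalIntegrable_iff_Ioo hr]
    refine Integrable.mono' ((intervalIntegrable_iff_Ioo hr _).1 (k1.const_mul (A * (r' - r) ^ l)))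
      (Measurable.aestronglyMeasurable (by fun_prop)) ?_
    filter_upwards [ae_restrict_mem measurableSet_Ioo] with y hy using hb y hy
  have e : EqOn (fun _ => (0 : ℝ)) (fun y => (bump f r r' u - bump f r r' y) / (u - y) ^ (α + 1))
      (uIcc r' u) := by
    intro y hy
    rw [uIcc_of_le hu.le] at hy
    simp only [bump_right hr hu.le, bump_right hr hy.1, sub_self, zero_div]
  have i2 : IntervalIntegrable
      (fun y => (bump f r r' u - bump f r r' y) / (u - y) ^ (α + 1)) volume r' u :=
    (intervalIntegrable_const (c := (0 : ℝ))).congr (e.mono uIoc_subset_uIcc)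
  have hint : |∫ y in r..u, (bump f r r' u - bump f r r' y) / (u - y) ^ (α + 1)| ≤
      A * (r' - r) ^ l * (((u - r') ^ (-α) - (u - r) ^ (-α)) / α) := by
    rw [← intervalIntegral.integral_add_adjacent_intervals i1 i2,
      ← intervalIntegral.integral_congr e, intervalIntegral.integral_const, smul_zero, add_zero,
      ← k2, ← intervalIntegral.integral_const_mul, intervalIntegral_eq_Ioo hr,
      intervalIntegral_eq_Ioo hr, ← Real.norm_eq_abs]
    refine norm_integral_le_of_norm_le
      ((intervalIntegrable_iff_Ioo hr _).1 (k1.const_mul (A * (r' - r) ^ l))) ?_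
    filter_upwards [ae_restrict_mem measurableSet_Ioo] with y hy using hb y hy
  rw [derivLeft, bump_right hr hu.le, zero_div, zero_add, abs_mul, abs_mul,
    abs_of_pos (by positivity : 0 < 1 / Real.Gamma (1 - α)), abs_of_pos h0]
  rw [bump_right hr hu.le] at hint
  refine mul_le_mul_of_nonneg_left ((mul_le_mul_of_nonneg_left hint h0.le).trans_eq ?_)
    (by positivity)
  field_simp

/-- The constant in the bound of `stieltjes_bump`. -/
def bumpConst (α l : ℝ) : ℝ := holderConst α l + 1 / (Real.Gamma (1 - α) * (1 - α))

/-- Two regimes. Inside [r, r') the bump is f - f(r), and its derivative is O((u-r)^{l-α}). Past r'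
the bump is zero but its derivative remembers it, with size (r'-r)^l ((u-r')^{-α} - (u-r)^{-α}).
Both integrate to O((r'-r)^{1+l-α}), however far s lies beyond r'. -/
theorem abs_stieltjes_bump_le (h0 : 0 < α) (h1 : α < 1) (hl : α < l) (hA : 0 ≤ A)
    (hg : StieltjesIntegrator α T Λ g) (hΛ : 0 ≤ Λ) (hf : Measurable f) {r r' : ℝ}
    (hr0 : 0 ≤ r) (hr : r ≤ r') (hr's : r' ≤ s) (hs : s ≤ T)
    (hH : ∀ x ∈ Icc r s, ∀ y ∈ Icc r s, |f x - f y| ≤ A * |x - y| ^ l) :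
    |stieltjes α r s (bump f r r') g| ≤
      2 * Λ / Real.Gamma α * bumpConst α l * A * (r' - r) ^ (1 + l - α) := by
  have hΓ := Real.Gamma_pos_of_pos (sub_pos.2 h1)
  have hΓ' := Real.Gamma_pos_of_pos h0
  have hd : 0 ≤ r' - r := sub_nonneg.2 hr
  have hH1 : ∀ x ∈ Icc r r', |f x - f r| ≤ A * (r' - r) ^ l := by
    intro x hx
    refine (hH x ⟨hx.1, hx.2.trans hr's⟩ r ⟨le_rfl, hr.trans hr's⟩).trans ?_
    have : |x - r| ≤ r' - r := by rw [abs_of_nonneg (sub_nonneg.2 hx.1)]; linarith [hx.2]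
    have := Real.rpow_le_rpow (abs_nonneg _) this (h0.trans hl).le
    gcongr
  obtain ⟨k1, k2⟩ := integral_rpow_sub_right (t := r) (u := r') (p := l - α) (by linarith)
  have j1 := integral_rpow_sub_right (t := r') (u := s) (p := -α) (by linarith)
  have j2 := integral_rpow_sub_right (t := r) (u := s) (p := -α) (by linarith)
  have j3 := integral_rpow_sub_right (t := r) (u := r') (p := -α) (by linarith)
  have j4 : IntervalIntegrable (fun y => (y - r) ^ (-α)) volume r' s := j2.1.mono_set (by
    rw [uIcc_of_le hr's, uIcc_of_le (hr.trans hr's)]; exact Icc_subset_Icc_left hr)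
  have j5 := intervalIntegral.integral_add_adjacent_intervals j3.1 j4
  rw [j2.2, j3.2] at j5
  set c1 := holderConst α l * A
  set c2 := 1 / Real.Gamma (1 - α) * (A * (r' - r) ^ l)
  have hc1 : 0 ≤ c1 := mul_nonneg (holderConst_nonneg h0 h1 hl) hA
  have hc2 : 0 ≤ c2 := by positivity
  set B : ℝ → ℝ := fun u => if u < r' then c1 * (u - r) ^ (l - α)
    else c2 * ((u - r') ^ (-α) - (u - r) ^ (-α)) with hB
  have e1 : EqOn (fun u => c1 * (u - r) ^ (l - α)) B (Ioo r r') := fun u hu => by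
    simp only [hB, if_pos hu.2]
  have e2 : EqOn (fun u => c2 * ((u - r') ^ (-α) - (u - r) ^ (-α))) B (Ioo r' s) := fun u hu => by
    simp only [hB, if_neg hu.1.le.not_gt]
  have b1 : IntervalIntegrable B volume r r' := by
    rw [intervalIntegrable_iff_Ioo hr]
    exact ((intervalIntegrable_iff_Ioo hr _).1 (k1.const_mul c1)).congr_fun e1 measurableSet_Ioo
  have b2 : IntervalIntegrable B volume r' s := by
    rw [intervalIntegrable_iff_Ioo hr's]
    exact ((intervalIntegrable_iff_Ioo hr's _).1
      ((j1.1.sub j4).const_mul c2)).congr_fun e2 measurableSet_Ioo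
  have hBi : ∫ u in Ioo r s, B u ≤ bumpConst α l * A * (r' - r) ^ (1 + l - α) := by
    rw [← intervalIntegral_eq_Ioo (hr.trans hr's),
      ← intervalIntegral.integral_add_adjacent_intervals b1 b2, intervalIntegral_eq_Ioo hr,
      intervalIntegral_eq_Ioo hr's, ← setIntegral_congr_fun measurableSet_Ioo e1,
      ← setIntegral_congr_fun measurableSet_Ioo e2, integral_const_mul, integral_const_mul,
      ← intervalIntegral_eq_Ioo hr, ← intervalIntegral_eq_Ioo hr's,
      intervalIntegral.integral_sub j1.1 j4, k2, j1.2]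
    have q1 : (r' - r) ^ (l - α + 1) / (l - α + 1) ≤ (r' - r) ^ (1 + l - α) := by
      rw [show l - α + 1 = 1 + l - α by ring]
      exact div_le_self (Real.rpow_nonneg hd _) (by linarith)
    -- The tail (u-r')^{-α} - (u-r)^{-α} has total mass at most that of (u-r)^{-α} on [r, r'], since
    -- a translate of u^{-α} has less mass on the shorter interval. This removes s from the bound.
    have q2 : (s - r') ^ (-α + 1) / (-α + 1) - ∫ u in r'..s, (u - r) ^ (-α) ≤
        (r' - r) ^ (-α + 1) / (-α + 1) := by
      have : (s - r') ^ (-α + 1) / (-α + 1) ≤ (s - r) ^ (-α + 1) / (-α + 1) := by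
        have h2 : 0 < -α + 1 := by linarith
        have := sub_nonneg.2 hr's
        gcongr
      linarith
    refine (add_le_add (mul_le_mul_of_nonneg_left q1 hc1)
      (mul_le_mul_of_nonneg_left q2 hc2)).trans_eq ?_
    simp only [c1, c2, bumpConst]
    rcases hd.eq_or_lt with hd | hd
    · rw [← hd, Real.zero_rpow (by linarith), Real.zero_rpow (by linarith : -α + 1 ≠ 0)]; ring
    · rw [show 1 + l - α = l + (-α + 1) by ring, Real.rpow_add hd]
      have : 1 - α ≠ 0 := by linarith
      have : -α + 1 ≠ 0 := by linarith
      field_simp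
      ring
  have h := abs_stieltjes_le (f := bump f r r') (B := B) h0 h1 hg hr0 (hr.trans hr's) hs
    ((intervalIntegrable_iff_Ioo (hr.trans hr's) _).1 (b1.trans b2)) ?_
  · refine h.trans ((mul_le_mul_of_nonneg_left hBi (by positivity)).trans_eq (by ring))
  · filter_upwards [ae_ne r'] with u hur' hu
    simp only [hB]
    split_ifs with hlt
    · rw [derivLeft_congr (f₂ := fun x => f x - f r) hu.1.le
        (fun y hy => bump_mid hy.1 (hy.2.trans_lt hlt))]
      have := (derivLeft_holder (f := fun x => f x - f r) (A := A) h0 h1 hl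
        (by fun_prop) hu.1 (fun y hy => ?_)).2
      · simpa using this
      · have := hH u ⟨hu.1.le, hu.2.le⟩ y ⟨hy.1, hy.2.trans hu.2.le⟩
        rw [abs_of_nonneg (sub_nonneg.2 hy.2)] at this
        simpa using this
    · have := abs_derivLeft_bump_le h0 h1 hr
        (lt_of_le_of_ne (not_lt.1 hlt) (Ne.symm hur')) hf hH1
      refine this.trans_eq ?_
      simp only [c2]; ring

end

/-! ### The local expansion of the integral. -/

section

variable {α l t s T Λ A : ℝ} {f g : ℝ → ℝ}

/-- Moving the stopping time from p to q changes the integrand by a step of height f(q) - f(p) at q,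
integrated exactly, plus a bump on [p, q), which is negligible to first order. -/
theorem abs_stieltjes_min_sub_le (h0 : 0 < α) (h1 : α < 1) (hl : α < l) (hA : 0 ≤ A)
    (hg : StieltjesIntegrator α T Λ g) (hΛ : 0 ≤ Λ) (hf : Measurable f)
    (ht : 0 ≤ t) (hs : s ≤ T)
    (hH : ∀ x ∈ Icc t s, ∀ y ∈ Icc t s, |f x - f y| ≤ A * |x - y| ^ l) {p q : ℝ}
    (htp : t ≤ p) (hpq : p ≤ q) (hqs : q ≤ s) :
    |stieltjes α t s (fun u => f (min u q)) g - stieltjes α t s (fun u => f (min u p)) g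
      - (f q - f p) * (g s - g q)| ≤
      2 * Λ / Real.Gamma α * bumpConst α l * A * (q - p) ^ (1 + l - α) := by
  have hts : t ≤ s := htp.trans (hpq.trans hqs)
  have hl0 : 0 ≤ l := (h0.trans hl).le
  have hm : ∀ r, Measurable fun u => f (min u r) := fun r => by fun_prop
  have d : ∀ r, t ≤ r → FracDiff α t s fun u => f (min u r) := fun r hr =>
    fracDiff_of_holder h0 h1 hl (hm r) hts (holder_min hl0 hA hr hH)
  obtain ⟨d3, e3⟩ := stieltjes_stepAt (a := q) (g := g) h0 h1 hg ht (htp.trans hpq) hqs hs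
  have e : stieltjes α t s (bump f p q) g =
      stieltjes α t s (fun u => f (min u q)) g - stieltjes α t s (fun u => f (min u p)) g
        - (f q - f p) * (g s - g q) := by
    have := FracDiff.stieltjes_sub h0 h1 hg ((d q (htp.trans hpq)).sub (d p htp))
      (d3.const_mul (f q - f p)) ht hts hs
    rw [stieltjes_const_mul, e3, FracDiff.stieltjes_sub h0 h1 hg (d q (htp.trans hpq)) (d p htp)
      ht hts hs] at this
    exact this
  have hHp : ∀ x ∈ Icc p s, ∀ y ∈ Icc p s, |f x - f y| ≤ A * |x - y| ^ l := fun x hx y hy =>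
    hH x ⟨htp.trans hx.1, hx.2⟩ y ⟨htp.trans hy.1, hy.2⟩
  have db : FracDiff α p s (bump f p q) := by
    have d' : ∀ r, p ≤ r → FracDiff α p s fun u => f (min u r) := fun r hr =>
      fracDiff_of_holder h0 h1 hl (hm r) (hpq.trans hqs) (holder_min hl0 hA hr hHp)
    exact ((d' q hpq).sub (d' p le_rfl)).sub
      ((stieltjes_stepAt (a := q) (g := g) h0 h1 hg (ht.trans htp) hpq hqs hs).1.const_mul _)
  rw [← e, (db.extend_left (g := g) h0 htp (hpq.trans hqs)
    (fun y hy => bump_left hpq hy.2)).2]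
  exact abs_stieltjes_bump_le h0 h1 hl hA hg hΛ hf (ht.trans htp) hpq hqs hs hHp

/-- The local expansion of the generalized Stieltjes integral of a Hölder function. -/
theorem abs_stieltjes_sub_sub_le (h0 : 0 < α) (h1 : α < 1) (hl : α < l) (hA : 0 ≤ A)
    (hg : StieltjesIntegrator α T Λ g) (hΛ : 0 ≤ Λ) (hf : Measurable f) {r : ℝ}
    (ht : 0 ≤ t) (htr : t ≤ r) (hrs : r ≤ s) (hs : s ≤ T)
    (hH : ∀ x ∈ Icc t s, ∀ y ∈ Icc t s, |f x - f y| ≤ A * |x - y| ^ l) :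
    |stieltjes α t s f g - stieltjes α t r f g - f r * (g s - g r)| ≤
      2 * Λ / Real.Gamma α * holderConst α l * A * (s - r) ^ (1 + l - α) := by
  have hts := htr.trans hrs
  have hl0 : 0 ≤ l := (h0.trans hl).le
  have hm : ∀ r, Measurable fun u => f (min u r) := fun r => by fun_prop
  have hHr : ∀ x ∈ Icc t r, ∀ y ∈ Icc t r, |f x - f y| ≤ A * |x - y| ^ l := fun x hx y hy =>
    hH x ⟨hx.1, hx.2.trans hrs⟩ y ⟨hy.1, hy.2.trans hrs⟩
  -- Ψ(p) is the defect of additivity at r for f stopped at p. When p moves to q ≤ r, the main terms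
  -- (f(q)-f(p))(g(s)-g(q)) and (f(q)-f(p))(g(r)-g(q)) differ by (f(q)-f(p))(g(s)-g(r)), which the
  -- last term removes. Two bumps remain, whence the factor 2 in the constant below.
  set Ψ : ℝ → ℝ := fun p => stieltjes α t s (fun u => f (min u p)) g -
    stieltjes α t r (fun u => f (min u p)) g - f p * (g s - g r) with hΨ
  have hconst := eq_of_norm_sub_le_rpow (Y := Ψ) (a := t) (b := r) (θ := l - α)
    (C := 2 * (2 * Λ / Real.Gamma α * bumpConst α l * A)) (sub_pos.2 hl) ?_ r ⟨htr, le_rfl⟩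
  · have z : Ψ t = 0 := by
      have e1 : stieltjes α t s (fun u => f (min u t)) g = f t * (g s - g t) := by
        rw [← hg.stieltjes_const h0 h1 ht hts hs (f t)]
        exact stieltjes_congr hts (fun u hu => by simp [min_eq_right hu.1]) (fun _ _ => rfl)
      have e2 : stieltjes α t r (fun u => f (min u t)) g = f t * (g r - g t) := by
        rw [← hg.stieltjes_const h0 h1 ht htr (hrs.trans hs) (f t)]
        exact stieltjes_congr htr (fun u hu => by simp [min_eq_right hu.1]) (fun _ _ => rfl)
      simp only [hΨ, e1, e2]; ring
    rw [z] at hconst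
    have e3 : stieltjes α t r (fun u => f (min u r)) g = stieltjes α t r f g :=
      stieltjes_congr htr (fun u hu => by simp [min_eq_left hu.2]) (fun _ _ => rfl)
    simp only [hΨ, e3] at hconst
    have d1 := fracDiff_of_holder h0 h1 hl hf hts hH
    have d2 := fracDiff_of_holder h0 h1 hl (hm r) hts (holder_min hl0 hA htr hH)
    have e4 := FracDiff.stieltjes_sub h0 h1 hg d1 d2 ht hts hs
    -- By Ψ(r) = 0, the integral over [t,s] of f stopped at r is the integral of f over [t,r] plus
    -- f(r)(g(s)-g(r)). The rest of the integrand vanishes before r and is l-Hölder after it.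
    have e5 : stieltjes α t s f g - stieltjes α t r f g - f r * (g s - g r) =
        stieltjes α t s (fun u => f u - f (min u r)) g := by
      rw [e4]; linarith
    have e6 : EqOn (fun u => f u - f r) (fun u => f u - f (min u r)) (Icc r s) :=
      fun u hu => by simp [min_eq_right hu.1]
    have hHs : ∀ x ∈ Icc r s, ∀ y ∈ Icc r s, |(f x - f r) - (f y - f r)| ≤ A * |x - y| ^ l :=
      fun x hx y hy => by
        simpa using hH x ⟨htr.trans hx.1, hx.2⟩ y ⟨htr.trans hy.1, hy.2⟩
    have d3 := (fracDiff_of_holder h0 h1 hl (by fun_prop : Measurable fun u => f u - f r) hrs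
      hHs).congr e6
    rw [e5, (d3.extend_left (g := g) h0 htr hrs
      (fun y hy => by simp [min_eq_left hy.2.le])).2, ← stieltjes_congr hrs e6 (fun _ _ => rfl)]
    exact abs_stieltjes_le_of_holder h0 h1 hl hA hg hΛ (by fun_prop) (ht.trans htr) hrs hs
      (sub_self _) hHs
  · intro p q htp hpq hqr
    have b1 := abs_stieltjes_min_sub_le h0 h1 hl hA hg hΛ hf ht hs hH htp hpq (hqr.trans hrs)
    have b2 := abs_stieltjes_min_sub_le h0 h1 hl hA hg hΛ hf ht (hrs.trans hs) hHr htp hpq hqr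
    rw [show 1 + (l - α) = 1 + l - α by ring, Real.norm_eq_abs, mul_assoc 2, two_mul]
    refine le_trans (le_of_eq ?_) ((abs_sub _ _).trans (add_le_add b1 b2))
    congr 1
    simp only [hΨ]; ring

end

/-! ### Matrix norms, the class of g, and the vector valued integral. -/

section

section Matrices

variable {d k : ℕ}

theorem frob_eq_norm (A : Matrix (Fin d) (Fin k) ℝ) :
    frob A = ‖(WithLp.toLp 2 fun p : Fin d × Fin k => A p.1 p.2 : EuclideanSpace ℝ (Fin d × Fin k))‖ := by
  rw [frob, EuclideanSpace.norm_eq, Fintype.sum_prod_type]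
  simp

theorem frob_nonneg (A : Matrix (Fin d) (Fin k) ℝ) : 0 ≤ frob A := Real.sqrt_nonneg _

theorem frob_zero : frob (0 : Matrix (Fin d) (Fin k) ℝ) = 0 := by simp [frob]

theorem frob_add_le (A B : Matrix (Fin d) (Fin k) ℝ) : frob (A + B) ≤ frob A + frob B := by
  have e : ∀ M : Matrix (Fin d) (Fin k) ℝ, frob M = ‖(WithLp.toLp 2 fun p : Fin d × Fin k => M p.1 p.2 :
    EuclideanSpace ℝ (Fin d × Fin k))‖ := frob_eq_norm
  rw [e A, e B, e (A + B)]
  exact norm_add_le (WithLp.toLp 2 fun p : Fin d × Fin k => A p.1 p.2 :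
    EuclideanSpace ℝ (Fin d × Fin k)) (WithLp.toLp 2 fun p : Fin d × Fin k => B p.1 p.2)

theorem frob_sub_comm (A B : Matrix (Fin d) (Fin k) ℝ) : frob (A - B) = frob (B - A) := by
  rw [frob, frob]
  congr 1
  refine Finset.sum_congr rfl fun i _ => Finset.sum_congr rfl fun j _ => ?_
  simp only [Matrix.sub_apply]; ring

theorem frob_le_add_sub (A B : Matrix (Fin d) (Fin k) ℝ) : frob A ≤ frob B + frob (A - B) := by
  have := frob_add_le B (A - B)
  rwa [add_sub_cancel] at this

theorem abs_apply_le_frob (A : Matrix (Fin d) (Fin k) ℝ) (i : Fin d) (j : Fin k) :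
    |A i j| ≤ frob A := by
  rw [frob_eq_norm]
  exact PiLp.norm_apply_le (p := 2)
    (WithLp.toLp 2 fun p : Fin d × Fin k => A p.1 p.2 : EuclideanSpace ℝ (Fin d × Fin k)) (i, j)

theorem norm_mulVecE_le (A : Matrix (Fin d) (Fin k) ℝ) (v : Eucl k) :
    ‖mulVecE A v‖ ≤ frob A * ‖v‖ := by
  rw [EuclideanSpace.norm_eq, EuclideanSpace.norm_eq v]
  refine le_trans (Real.sqrt_le_sqrt ?_) (Real.sqrt_mul (Finset.sum_nonneg fun i _ =>
    Finset.sum_nonneg fun j _ => sq_nonneg (A i j)) (∑ j, ‖v j‖ ^ 2)).le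
  rw [Finset.sum_mul]
  refine Finset.sum_le_sum fun i _ => ?_
  simp only [Real.norm_eq_abs, sq_abs]
  exact Finset.sum_mul_sq_le_sq_mul_sq Finset.univ (fun j => A i j) (fun j => v j)

theorem mulVecE_sub_left (A B : Matrix (Fin d) (Fin k) ℝ) (v : Eucl k) :
    mulVecE (A - B) v = mulVecE A v - mulVecE B v := by
  ext i
  simp [mulVecE, sub_mul, Finset.sum_sub_distrib]

theorem mulVecE_sub_right (A : Matrix (Fin d) (Fin k) ℝ) (v w : Eucl k) :
    mulVecE A (v - w) = mulVecE A v - mulVecE A w := by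
  ext i
  simp [mulVecE, mul_sub, Finset.sum_sub_distrib]

theorem norm_le_of_abs_apply_le (v : Eucl d) {c : ℝ} (h : ∀ i, |v i| ≤ c) : ‖v‖ ≤ d * c := by
  have h1 : ‖v‖ ≤ ∑ i, |v i| := by
    rw [EuclideanSpace.norm_eq]
    refine Real.sqrt_le_iff.2 ⟨Finset.sum_nonneg fun _ _ => abs_nonneg _, ?_⟩
    simp only [Real.norm_eq_abs]
    exact Finset.sum_sq_le_sq_sum_of_nonneg fun i _ => abs_nonneg _
  refine h1.trans ((Finset.sum_le_sum fun i _ => h i).trans_eq ?_)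
  simp

end Matrices

theorem continuousOn_of_holder {E F : Type*} [NormedAddCommGroup E] [NormedAddCommGroup F]
    {f : E → F} {S : Set E} {A l : ℝ} (hl : 0 < l)
    (h : ∀ x ∈ S, ∀ y ∈ S, ‖f x - f y‖ ≤ A * ‖x - y‖ ^ l) : ContinuousOn f S := by
  intro x hx
  rw [ContinuousWithinAt, tendsto_iff_norm_sub_tendsto_zero]
  have hlim : Tendsto (fun y => A * ‖y - x‖ ^ l) (𝓝[S] x) (𝓝 0) := by
    have : ContinuousAt (fun y : E => A * ‖y - x‖ ^ l) x :=
      continuousAt_const.mul (ContinuousAt.rpow_const (by fun_prop) (Or.inr hl.le))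
    have h2 := this.tendsto.mono_left (nhdsWithin_le_nhds (s := S))
    simpa [Real.zero_rpow hl.ne'] using h2
  refine squeeze_zero' (Eventually.of_forall fun _ => norm_nonneg _) ?_ hlim
  filter_upwards [self_mem_nhdsWithin] with y hy using h y hy x hx

/-- Projection of the real line to `[a, b]`. -/
def clamp (a b u : ℝ) : ℝ := max a (min u b)

theorem clamp_mem {a b : ℝ} (hab : a ≤ b) (u : ℝ) : clamp a b u ∈ Icc a b :=
  ⟨le_max_left _ _, max_le hab (min_le_right _ _)⟩

theorem clamp_eq {a b u : ℝ} (hu : u ∈ Icc a b) : clamp a b u = u := by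
  rw [clamp, min_eq_left hu.2, max_eq_right hu.1]

theorem continuous_comp_clamp {E : Type*} [TopologicalSpace E] {f : ℝ → E} {a b : ℝ} (hab : a ≤ b)
    (hf : ContinuousOn f (Icc a b)) : Continuous fun u => f (clamp a b u) :=
  hf.comp_continuous (by unfold clamp; fun_prop) (clamp_mem hab)

section Integrator

variable {k : ℕ} {α T : ℝ} {g : ℝ → Eucl k}

/-- The defining supremum involves only 0 < r < s < T, while solutions run up to time T. Continuity
of g extends the Hölder bound to the closed interval; at s = T the integral is proper away from r,
and its bound is the limit from the left. -/
theorem MemTildeW.integrable_bound (h1 : α < 1) (hT : 0 < T) (hg : MemTildeW α 0 T g) :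
    ∃ Λ : ℝ, 0 ≤ Λ ∧
      (∀ r ∈ Icc 0 T, ∀ s ∈ Icc 0 T, ‖g r - g s‖ ≤ Λ * |r - s| ^ (1 - α)) ∧
      ∀ r s, 0 < r → r < s → s ≤ T →
        IntegrableOn (fun y => ‖g y - g r‖ / (y - r) ^ (2 - α)) (Ioo r s) ∧
        ∫ y in Ioo r s, ‖g y - g r‖ / (y - r) ^ (2 - α) ≤ Λ := by
  obtain ⟨hc, C, hC⟩ := hg
  have hcl := continuous_comp_clamp hT.le hc
  have hint_nn : ∀ r s : ℝ, 0 ≤ ∫ y in Ioo r s, ‖g y - g r‖ / (y - r) ^ (2 - α) := fun r s =>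
    setIntegral_nonneg measurableSet_Ioo fun y hy =>
      div_nonneg (norm_nonneg _) (Real.rpow_nonneg (sub_nonneg.2 hy.1.le) _)
  have hq_nn : ∀ r s : ℝ, r < s → 0 ≤ ‖g s - g r‖ / (s - r) ^ (1 - α) := fun r s hrs =>
    div_nonneg (norm_nonneg _) (Real.rpow_nonneg (sub_nonneg.2 hrs.le) _)
  have hC0 : 0 ≤ C := by
    have h := (hC (T / 3) (T / 2) (by positivity) (by linarith) (by linarith)).2
    linarith [hint_nn (T / 3) (T / 2), hq_nn (T / 3) (T / 2) (by linarith)]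
  have hopen : ∀ r s, 0 < r → r < s → s < T → ‖g s - g r‖ ≤ C * (s - r) ^ (1 - α) := by
    intro r s hr hrs hs
    have h := (hC r s hr hrs hs).2
    rw [← div_le_iff₀ (Real.rpow_pos_of_pos (sub_pos.2 hrs) _)]
    linarith [hint_nn r s]
  have hlt : ∀ r ∈ Icc 0 T, ∀ s ∈ Icc 0 T, r < s → ‖g s - g r‖ ≤ C * (s - r) ^ (1 - α) := by
    intro r hr s hs hrs
    have c1 : ContinuousAt (fun e => ‖g (clamp 0 T (s - e)) - g (clamp 0 T (r + e))‖) 0 :=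
      Continuous.continuousAt
        ((hcl.comp (continuous_const.sub continuous_id)).sub
          (hcl.comp (continuous_const.add continuous_id))).norm
    have c2 : ContinuousAt (fun e => C * (s - e - (r + e)) ^ (1 - α)) 0 :=
      continuousAt_const.mul (ContinuousAt.rpow_const (by fun_prop) (Or.inr (by linarith)))
    have l1 := c1.tendsto.mono_left (nhdsWithin_le_nhds (s := Ioi 0))
    have l2 := c2.tendsto.mono_left (nhdsWithin_le_nhds (s := Ioi 0))
    simp only [sub_zero, add_zero, clamp_eq hr, clamp_eq hs] at l1 l2
    refine le_of_tendsto_of_tendsto l1 l2 ?_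
    filter_upwards [Ioo_mem_nhdsGT (show (0 : ℝ) < (s - r) / 2 by linarith)] with e he
    have q1 : 0 < r + e := by linarith [he.1, hr.1]
    have q2 : r + e < s - e := by linarith [he.2]
    have q3 : s - e < T := by linarith [he.1, hs.2]
    rw [clamp_eq ⟨(q1.trans q2).le, q3.le⟩, clamp_eq ⟨q1.le, (q2.trans q3).le⟩]
    exact hopen _ _ q1 q2 q3
  refine ⟨C, hC0, ?_, ?_⟩
  · intro r hr s hs
    rcases lt_trichotomy r s with h | h | h
    · rw [norm_sub_rev, abs_sub_comm, abs_of_pos (sub_pos.2 h)]; exact hlt r hr s hs h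
    · subst h; simp only [sub_self, norm_zero, abs_zero]; positivity
    · rw [abs_of_pos (sub_pos.2 h)]; exact hlt s hs r hr h
  · intro r s hr hrs hs
    rcases hs.lt_or_eq with hs | rfl
    · exact ⟨(hC r s hr hrs hs).1, by linarith [(hC r s hr hrs hs).2, hq_nn r s hrs]⟩
    · have hi : IntegrableOn (fun y => ‖g y - g r‖ / (y - r) ^ (2 - α)) (Ioo r s) := by
        obtain ⟨m', hm1, hm2⟩ := exists_between hrs
        obtain ⟨m, hm3, hm4⟩ := exists_between hm1
        have i1 := (hC r m' hr hm1 hm2).1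
        have i2 : IntegrableOn (fun y => ‖g y - g r‖ / (y - r) ^ (2 - α)) (Icc m s) := by
          refine ContinuousOn.integrableOn_Icc ?_
          have hsub : Icc m s ⊆ Icc 0 s := Icc_subset_Icc_left (hr.trans hm3).le
          refine ContinuousOn.div ((hc.mono hsub).sub continuousOn_const).norm ?_ ?_
          · refine ContinuousOn.rpow_const (by fun_prop) fun y hy => Or.inl ?_
            linarith [hy.1]
          · intro y hy
            exact (Real.rpow_pos_of_pos (by linarith [hy.1]) _).ne'
        refine (i1.union i2).mono_set fun y hy => ?_
        rcases lt_or_ge y m' with h | h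
        · exact Or.inl ⟨hy.1, h⟩
        · exact Or.inr ⟨hm4.le.trans h, hy.2.le⟩
      refine ⟨hi, ?_⟩
      have hii : IntegrableOn (fun y => ‖g y - g r‖ / (y - r) ^ (2 - α)) (Icc r s) := by
        rwa [integrableOn_Icc_iff_integrableOn_Ioo]
      have hcont := intervalIntegral.continuousOn_primitive hii s ⟨hrs.le, le_rfl⟩
      have l1 := hcont.tendsto.mono_left (nhdsWithin_mono s (Ioo_subset_Icc_self))
      rw [nhdsWithin_Ioo_eq_nhdsLT hrs] at l1
      simp only [integral_Ioc_eq_integral_Ioo] at l1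
      refine le_of_tendsto l1 ?_
      filter_upwards [Ioo_mem_nhdsLT hrs] with y hy
      linarith [(hC r y hr hy.1 hy.2).2, hq_nn r y hy.1]

/-- Every component of a function in `W̃^{1-α,∞}`, extended by constants, is an integrator. -/
theorem MemTildeW.exists_integrator (h1 : α < 1) (hT : 0 < T) (hg : MemTildeW α 0 T g) :
    ∃ Λ : ℝ, 0 ≤ Λ ∧
      (∀ r ∈ Icc 0 T, ∀ s ∈ Icc 0 T, ‖g r - g s‖ ≤ Λ * |r - s| ^ (1 - α)) ∧
      ∀ j, StieltjesIntegrator α T Λ fun u => g (clamp 0 T u) j := by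
  obtain ⟨Λ, hΛ, hH, hI⟩ := hg.integrable_bound h1 hT
  have hc := continuous_comp_clamp hT.le hg.1
  have hcj : ∀ j, Continuous fun u => g (clamp 0 T u) j := fun j =>
    (EuclideanSpace.proj (𝕜 := ℝ) j).continuous.comp hc
  have hcomp : ∀ (v : Eucl k) j, |v j| ≤ ‖v‖ := fun v j => by
    have := PiLp.norm_apply_le (p := 2) v j
    rwa [Real.norm_eq_abs] at this
  refine ⟨Λ, hΛ, hH, fun j => ?_⟩
  have hb : ∀ r s, 0 < r → r < s → s ≤ T → ∀ y ∈ Ioo r s,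
      ‖(g (clamp 0 T r) j - g (clamp 0 T y) j) / (y - r) ^ (2 - α)‖ ≤
        ‖g y - g r‖ / (y - r) ^ (2 - α) := by
    intro r s hr hrs hs y hy
    have hy0 : 0 < y - r := sub_pos.2 hy.1
    rw [clamp_eq ⟨hr.le, hrs.le.trans hs⟩, clamp_eq ⟨(hr.trans hy.1).le, hy.2.le.trans hs⟩,
      norm_div, Real.norm_of_nonneg (Real.rpow_nonneg hy0.le _), norm_sub_rev (g y)]
    exact div_le_div_of_nonneg_right (hcomp (g r - g y) j) (Real.rpow_nonneg hy0.le _)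
  have hm : ∀ r : ℝ, Measurable
      fun y => (g (clamp 0 T r) j - g (clamp 0 T y) j) / (y - r) ^ (2 - α) := fun r => by
    exact (measurable_const.sub (hcj j).measurable).div
      ((measurable_id.sub measurable_const).pow measurable_const)
  have hint : ∀ r s, 0 < r → r < s → s ≤ T → IntegrableOn
      (fun y => (g (clamp 0 T r) j - g (clamp 0 T y) j) / (y - r) ^ (2 - α)) (Ioo r s) := by
    intro r s hr hrs hs
    refine Integrable.mono' (hI r s hr hrs hs).1 (hm r).aestronglyMeasurable ?_
    filter_upwards [ae_restrict_mem measurableSet_Ioo] with y hy using hb r s hr hrs hs y hy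
  refine ⟨hcj j, ?_, hint, ?_⟩
  · intro r hr s hs
    rw [clamp_eq hr, clamp_eq hs]
    exact (hcomp (g r - g s) j).trans (hH r hr s hs)
  · intro r s hr hrs hs
    refine le_trans ?_ (hI r s hr hrs hs).2
    exact setIntegral_mono_on (hint r s hr hrs hs).abs (hI r s hr hrs hs).1 measurableSet_Ioo
      (hb r s hr hrs hs)

end Integrator

/-- The local expansion of the matrix valued generalized Stieltjes integral. -/
theorem exists_stieltjesVec_bound {d k : ℕ} {α T Λ l : ℝ} {g : ℝ → Eucl k} (h0 : 0 < α)
    (h1 : α < 1) (hl : α < l) (hΛ : 0 ≤ Λ)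
    (hg : ∀ j, StieltjesIntegrator α T Λ fun u => g (clamp 0 T u) j) :
    ∃ C : ℝ, 0 ≤ C ∧ ∀ (F : ℝ → Matrix (Fin d) (Fin k) ℝ) (A t r s : ℝ), 0 ≤ A → 0 ≤ t → t ≤ r →
      r ≤ s → s ≤ T →
      (∀ x ∈ Icc t s, ∀ y ∈ Icc t s, frob (F x - F y) ≤ A * |x - y| ^ l) →
      ‖stieltjesVec α t s F g - stieltjesVec α t r F g - mulVecE (F r) (g s - g r)‖ ≤
        C * A * (s - r) ^ (1 + l - α) := by
  have hΓ := Real.Gamma_pos_of_pos h0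
  have hc := holderConst_nonneg h0 h1 hl
  refine ⟨d * (k * (2 * Λ / Real.Gamma α * holderConst α l)), by positivity, ?_⟩
  intro F A t r s hA ht htr hrs hs hF
  have hts := htr.trans hrs
  have hT : t ∈ Icc 0 T ∧ r ∈ Icc 0 T ∧ s ∈ Icc 0 T :=
    ⟨⟨ht, hts.trans hs⟩, ⟨ht.trans htr, hrs.trans hs⟩, ⟨ht.trans hts, hs⟩⟩
  have comp : ∀ i j, |stieltjes α t s (fun u => F u i j) (fun u => g u j) -
      stieltjes α t r (fun u => F u i j) (fun u => g u j) - F r i j * (g s j - g r j)| ≤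
      2 * Λ / Real.Gamma α * holderConst α l * A * (s - r) ^ (1 + l - α) := by
    intro i j
    have hFij : ∀ x ∈ Icc t s, ∀ y ∈ Icc t s, |F x i j - F y i j| ≤ A * |x - y| ^ l :=
      fun x hx y hy => (abs_apply_le_frob (F x - F y) i j).trans (hF x hx y hy)
    -- F and g are controlled on their intervals only. Composing with `clamp` makes them globally
    -- continuous, hence measurable, and leaves the integrals unchanged.
    have hcont : ContinuousOn (fun u => F u i j) (Icc t s) :=
      continuousOn_of_holder (h0.trans hl) hFij
    have hm := (continuous_comp_clamp hts hcont).measurable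
    have key := abs_stieltjes_sub_sub_le (s := s) h0 h1 hl hA (hg j) hΛ hm ht htr hrs hs
      (fun x hx y hy => by simpa only [clamp_eq hx, clamp_eq hy] using hFij x hx y hy)
    rw [clamp_eq hT.2.1, clamp_eq hT.2.2, clamp_eq (⟨htr, hrs⟩ : r ∈ Icc t s)] at key
    have hgeq : EqOn (fun u => g (clamp 0 T u) j) (fun u => g u j) (Icc t s) := fun u hu => by
      simp only [clamp_eq (⟨ht.trans hu.1, hu.2.trans hs⟩ : u ∈ Icc 0 T)]
    have hFeq : EqOn (fun u => F (clamp t s u) i j) (fun u => F u i j) (Icc t s) := fun u hu => by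
      simp only [clamp_eq hu]
    rwa [stieltjes_congr hts hFeq hgeq, stieltjes_congr htr
      (hFeq.mono (Icc_subset_Icc_right hrs)) (hgeq.mono (Icc_subset_Icc_right hrs))] at key
  have := norm_le_of_abs_apply_le
    (stieltjesVec α t s F g - stieltjesVec α t r F g - mulVecE (F r) (g s - g r))
    (c := k * (2 * Λ / Real.Gamma α * holderConst α l * A * (s - r) ^ (1 + l - α))) ?_
  · refine this.trans_eq ?_; ring
  · intro i
    have e : (stieltjesVec α t s F g - stieltjesVec α t r F g - mulVecE (F r) (g s - g r)) i =
        ∑ j, (stieltjes α t s (fun u => F u i j) (fun u => g u j) -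
          stieltjes α t r (fun u => F u i j) (fun u => g u j) - F r i j * (g s j - g r j)) := by
      simp [stieltjesVec, mulVecE, Finset.sum_sub_distrib]
    rw [e]
    refine (Finset.abs_sum_le_sum_abs _ _).trans ((Finset.sum_le_sum fun j _ => comp i j).trans_eq ?_)
    simp

end

/-! ### The equation as a Young system, and a priori Hölder bounds for solutions. -/

section

theorem rpow_le_mul_rpow {x T p q : ℝ} (hx : 0 ≤ x) (hxT : x ≤ T) (hq : 0 < q) (hqp : q ≤ p) :
    x ^ p ≤ (1 + T) ^ (p - q) * x ^ q := by
  rcases hx.eq_or_lt with rfl | hx'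
  · rw [Real.zero_rpow (by linarith), Real.zero_rpow hq.ne', mul_zero]
  · have : x ^ p = x ^ (p - q) * x ^ q := by rw [← Real.rpow_add hx', sub_add_cancel]
    rw [this]
    exact mul_le_mul_of_nonneg_right (Real.rpow_le_rpow hx (by linarith) (by linarith))
      (Real.rpow_nonneg hx _)

theorem rpow_le_rpow_of_le_one {x p q : ℝ} (hx : 0 ≤ x) (hx1 : x ≤ 1) (hq : 0 < q) (hqp : q ≤ p) :
    x ^ p ≤ x ^ q :=
  Real.rpow_le_rpow_of_exponent_ge_of_imp hx hx1 hqp fun _ h => absurd h (hq.trans_le hqp).ne'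

/-- The consequences of the hypotheses on `b, σ, g` that govern the equation, with Hölder
exponent `l` for `σ` in time, and one constant `M` for all the global bounds. -/
structure YoungSystem {d k : ℕ} (α l T M : ℝ) (b : ℝ → Eucl d → Eucl d)
    (σ : ℝ → Eucl d → Matrix (Fin d) (Fin k) ℝ) (g : ℝ → Eucl k) : Prop where
  alpha_pos : 0 < α
  alpha_lt : α < l
  l_le : l ≤ 1 - α
  T_pos : 0 < T
  M_nonneg : 0 ≤ M
  sigma_lipschitz : ∀ t ∈ Icc 0 T, ∀ s ∈ Icc 0 T, ∀ x y : Eucl d,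
    frob (σ t x - σ s y) ≤ M * (|t - s| ^ l + ‖x - y‖)
  sigma_growth : ∀ t ∈ Icc 0 T, ∀ x : Eucl d, frob (σ t x) ≤ M * (1 + ‖x‖)
  b_growth : ∀ t ∈ Icc 0 T, ∀ x : Eucl d, ‖b t x‖ ≤ M * (1 + ‖x‖)
  b_lipschitz : ∀ R : ℝ, 0 ≤ R → ∃ L : ℝ, 0 ≤ L ∧
    ∀ t ∈ Icc 0 T, ∀ s ∈ Icc 0 T, ∀ x y : Eucl d, ‖x‖ ≤ R → ‖y‖ ≤ R →
      ‖b t x - b s y‖ ≤ L * (|t - s| ^ (1 - α) + ‖x - y‖)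
  g_holder : ∀ r ∈ Icc 0 T, ∀ s ∈ Icc 0 T, ‖g r - g s‖ ≤ M * |r - s| ^ (1 - α)
  young : ∀ (F : ℝ → Matrix (Fin d) (Fin k) ℝ) (A t r s : ℝ), 0 ≤ A → 0 ≤ t → t ≤ r →
      r ≤ s → s ≤ T →
      (∀ x ∈ Icc t s, ∀ y ∈ Icc t s, frob (F x - F y) ≤ A * |x - y| ^ l) →
      ‖stieltjesVec α t s F g - stieltjesVec α t r F g - mulVecE (F r) (g s - g r)‖ ≤
        M * A * (s - r) ^ (1 + l - α)

theorem exists_youngSystem {d k : ℕ} {T α β δ μ : ℝ} (hT : 0 < T)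
    {b : ℝ → Eucl d → Eucl d} {σ : ℝ → Eucl d → Matrix (Fin d) (Fin k) ℝ} {g : ℝ → Eucl k}
    (hσ : HypSigma T β δ σ) (hb : HypDrift T β δ μ b)
    (hα : 1 - μ < α) (hα₀ : α < alphaZero β δ) (hg : MemTildeW α 0 T g) :
    ∃ M, YoungSystem α (min β (1 - α)) T M b σ g := by
  have h0 : 0 < α := by linarith [hb.mu_le]
  have hhalf : α < 1 / 2 := hα₀.trans_le (min_le_left _ _)
  have hβ : α < β := hα₀.trans_le ((min_le_right _ _).trans (min_le_left _ _))
  have h1 : α < 1 := by linarith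
  set l := min β (1 - α) with hl
  have hal : α < l := lt_min hβ (by linarith)
  have hl0 : 0 < l := h0.trans hal
  obtain ⟨Λ, hΛ, hgH, hgI⟩ := hg.exists_integrator h1 hT
  obtain ⟨C, hC, hY⟩ := exists_stieltjesVec_bound (d := d) h0 h1 hal hΛ hgI
  obtain ⟨M₀, hM₀, hlip⟩ := hσ.lipschitz
  obtain ⟨L₀, hL₀, hgr⟩ := hb.growth
  -- On [0,T] a power β of a time difference is at most c times its power l. Likewise `c'` below
  -- lowers the exponent μ of the drift to 1-α, possible because 1-μ < α.
  set c := (1 + T) ^ (β - l) with hc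
  have hc0 : 0 < c := Real.rpow_pos_of_pos (by linarith) _
  have hTl : 0 ≤ T ^ l := Real.rpow_nonneg hT.le _
  set M₁ := M₀ * (1 + c) with hM₁
  have hM₁0 : 0 ≤ M₁ := by positivity
  set f₀ := frob (σ 0 0) with hf₀
  have hf₀' : 0 ≤ f₀ := frob_nonneg _
  set M := Λ + C + L₀ + (f₀ + M₁ * (1 + T ^ l)) with hM
  have hMT : 0 ≤ M₁ * (1 + T ^ l) := by positivity
  have habs : ∀ t ∈ Icc 0 T, ∀ s ∈ Icc 0 T, |t - s| ≤ T := fun t ht s hs =>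
    abs_sub_le_iff.2 ⟨by linarith [ht.2, hs.1], by linarith [hs.2, ht.1]⟩
  have hlip' : ∀ t ∈ Icc 0 T, ∀ s ∈ Icc 0 T, ∀ x y : Eucl d,
      frob (σ t x - σ s y) ≤ M₁ * (|t - s| ^ l + ‖x - y‖) := by
    intro t ht s hs x y
    refine (hlip t ht s hs x y).trans ?_
    have := rpow_le_mul_rpow (abs_nonneg (t - s)) (habs t ht s hs) hl0 (min_le_left β (1 - α))
    have h2 : 0 ≤ |t - s| ^ l := Real.rpow_nonneg (abs_nonneg _) _
    rw [hM₁, mul_assoc]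
    refine mul_le_mul_of_nonneg_left ?_ hM₀.le
    nlinarith [norm_nonneg (x - y), mul_nonneg hc0.le (norm_nonneg (x - y))]
  have hMM : ∀ q, 0 ≤ q → q ≤ M → ∀ z, 0 ≤ z → q * z ≤ M * z := fun q _ h z hz =>
    mul_le_mul_of_nonneg_right h hz
  have hM₁M : M₁ ≤ M := by
    have : M₁ ≤ M₁ * (1 + T ^ l) := le_mul_of_one_le_right hM₁0 (by linarith)
    linarith
  refine ⟨M, h0, hal, min_le_right _ _, hT, by positivity, ?_, ?_, ?_, ?_, ?_, ?_⟩
  · intro t ht s hs x y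
    exact (hlip' t ht s hs x y).trans (hMM _ hM₁0 hM₁M _ (by positivity))
  · intro t ht x
    have h2 := frob_le_add_sub (σ t x) (σ 0 0)
    have h3 := hlip' t ht 0 ⟨le_rfl, hT.le⟩ x 0
    rw [sub_zero, sub_zero, abs_of_nonneg ht.1] at h3
    have h4 : t ^ l ≤ T ^ l := Real.rpow_le_rpow ht.1 ht.2 hl0.le
    have h5 : M₁ * (t ^ l + ‖x‖) ≤ M₁ * (1 + T ^ l) * (1 + ‖x‖) := by
      rw [mul_assoc M₁]
      refine mul_le_mul_of_nonneg_left ?_ hM₁0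
      nlinarith [norm_nonneg x, mul_nonneg hTl (norm_nonneg x)]
    have h6 : f₀ + M₁ * (1 + T ^ l) ≤ M := by linarith
    have h7 := mul_le_mul_of_nonneg_right h6 (by positivity : 0 ≤ 1 + ‖x‖)
    nlinarith [norm_nonneg x, mul_nonneg hf₀' (norm_nonneg x)]
  · intro t ht x
    exact (hgr t ht x).trans (hMM _ hL₀.le (by linarith) _ (by positivity))
  · intro R hR
    obtain ⟨L, hL, h⟩ := hb.lipschitz R hR
    set c' := (1 + T) ^ (μ - (1 - α)) with hc'
    have hc0' : 0 < c' := Real.rpow_pos_of_pos (by linarith) _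
    refine ⟨L * (1 + c'), by positivity, fun t ht s hs x y hx hy => ?_⟩
    refine (h t ht s hs x y hx hy).trans ?_
    have := rpow_le_mul_rpow (abs_nonneg (t - s)) (habs t ht s hs)
      (by linarith : 0 < 1 - α) (by linarith : 1 - α ≤ μ)
    have h2 : 0 ≤ |t - s| ^ (1 - α) := Real.rpow_nonneg (abs_nonneg _) _
    rw [mul_assoc]
    refine mul_le_mul_of_nonneg_left ?_ hL.le
    nlinarith [norm_nonneg (x - y), mul_nonneg hc0'.le (norm_nonneg (x - y))]
  · intro r hr s hs
    exact (hgH r hr s hs).trans (hMM _ hΛ (by linarith) _ (by positivity))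
  · intro F A t r s hA ht htr hrs hs hF
    refine (hY F A t r s hA ht htr hrs hs hF).trans ?_
    rw [mul_assoc, mul_assoc]
    exact hMM _ hC (by linarith) _ (mul_nonneg hA (Real.rpow_nonneg (sub_nonneg.2 hrs) _))

/-- `X` is `η`-Hölder with constant `A` on the set of times `S`. -/
def HolderWithOn {E : Type*} [NormedAddCommGroup E] (A η : ℝ) (S : Set ℝ) (X : ℝ → E) : Prop :=
  ∀ r ∈ S, ∀ s ∈ S, r ≤ s → ‖X s - X r‖ ≤ A * (s - r) ^ η

/-- The map B ↦ K + B/2 contracts to its fixed point 2K. The initial constant A only has to be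
finite and disappears in the limit. -/
theorem HolderWithOn.bootstrap {E : Type*} [NormedAddCommGroup E] {A η K : ℝ} {S : Set ℝ}
    {X : ℝ → E} (hA : 0 ≤ A) (hK : 0 ≤ K) (h : HolderWithOn A η S X)
    (hstep : ∀ B, 0 ≤ B → HolderWithOn B η S X → HolderWithOn (K + B / 2) η S X) :
    HolderWithOn (2 * K) η S X := by
  have hn : ∀ n : ℕ, HolderWithOn (2 * K + A * (1 / 2) ^ n) η S X := by
    intro n
    induction n with
    | zero =>
      intro r hr s hs hrs
      refine (h r hr s hs hrs).trans (mul_le_mul_of_nonneg_right ?_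
        (Real.rpow_nonneg (sub_nonneg.2 hrs) _))
      simp only [pow_zero, mul_one]; linarith
    | succ n ih =>
      have := hstep _ (by positivity) ih
      rw [show 2 * K + A * (1 / 2) ^ (n + 1) = K + (2 * K + A * (1 / 2) ^ n) / 2 by ring]
      exact this
  intro r hr s hs hrs
  have hlim : Tendsto (fun n : ℕ => (2 * K + A * (1 / 2 : ℝ) ^ n) * (s - r) ^ η) atTop
      (𝓝 ((2 * K + A * 0) * (s - r) ^ η)) :=
    ((tendsto_const_nhds.add ((tendsto_pow_atTop_nhds_zero_of_lt_one (by norm_num)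
      (by norm_num)).const_mul A)).mul_const _)
  rw [mul_zero, add_zero] at hlim
  exact ge_of_tendsto' hlim fun n => hn n r hr s hs hrs

variable {d k : ℕ} {α l T M : ℝ} {b : ℝ → Eucl d → Eucl d}
  {σ : ℝ → Eucl d → Matrix (Fin d) (Fin k) ℝ} {g : ℝ → Eucl k}

theorem exists_small_rpow {c l : ℝ} (hl : 0 < l) {e : ℝ} (he : 0 < e) :
    ∃ h : ℝ, 0 < h ∧ h ≤ 1 ∧ c * h ^ l ≤ e := by
  have : ContinuousAt (fun h : ℝ => c * h ^ l) 0 :=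
    continuousAt_const.mul (ContinuousAt.rpow_const (by fun_prop) (Or.inr hl.le))
  have h2 := this.tendsto.mono_left (nhdsWithin_le_nhds (s := Ioi 0))
  simp only [Real.zero_rpow hl.ne', mul_zero] at h2
  obtain ⟨h, hh, hh'⟩ := ((h2.eventually (gt_mem_nhds he)).and
    (Ioo_mem_nhdsGT (show (0 : ℝ) < 1 by norm_num))).exists
  exact ⟨h, hh'.1, hh'.2.le, hh.le⟩

/-- A uniform Hölder bound on a short window, for any path on a set of times that satisfies
a first order expansion whose remainder is controlled by its own Hölder constant. -/
theorem YoungSystem.exists_holder_window (hs : YoungSystem α l T M b σ g) {c : ℝ} (hc : 0 ≤ c) :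
    ∃ h K : ℝ, 0 < h ∧ h ≤ 1 ∧ 0 ≤ K ∧ ∀ (S : Set ℝ) (t : ℝ) (X : ℝ → Eucl d),
      S ⊆ Icc t (t + h) → S ⊆ Icc 0 T → t ∈ S → (∃ A, 0 ≤ A ∧ HolderWithOn A (1 - α) S X) →
      (∀ A, 0 ≤ A → HolderWithOn A (1 - α) S X → ∀ r ∈ S, ∀ s ∈ S, r ≤ s →
        ‖X s - X r - mulVecE (σ r (X r)) (g s - g r)‖ ≤
          (1 + M * (1 + (‖X t‖ + A * h ^ (1 - α)))) * (s - r) + c * (1 + A) * (s - r) ^ (1 + l - α)) →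
      HolderWithOn (K * (1 + ‖X t‖)) (1 - α) S X := by
  have hM := hs.M_nonneg
  have hl0 := hs.alpha_pos.trans hs.alpha_lt
  have h1 : 0 < 1 - α := hl0.trans_le hs.l_le
  -- The factor M² + M + c collects the contributions to the new Hölder constant that are
  -- proportional to the old one: noise, drift and remainder. Since h^{1-α} ≤ h^l for h ≤ 1, this
  -- choice makes their sum at most A/2. By linear growth h does not depend on X(t), which enters
  -- only through the factor 1 + |X(t)|.
  obtain ⟨h, h0, hh1, hsmall⟩ := exists_small_rpow (c := M ^ 2 + M + c) hl0
    (show (0 : ℝ) < 1 / 2 by norm_num)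
  refine ⟨h, 2 * (M ^ 2 + M + 1 + c), h0, hh1, by positivity, ?_⟩
  intro S t X hS hST ht ⟨A₀, hA₀, hX₀⟩ hrem
  have hx := norm_nonneg (X t)
  have := hX₀.bootstrap (K := (M ^ 2 + M + 1 + c) * (1 + ‖X t‖)) hA₀ (by positivity) ?_
  · rwa [← mul_assoc] at this
  intro A hA hX r hr s hsS hrs
  have hrs0 : 0 ≤ s - r := sub_nonneg.2 hrs
  have hrsh : s - r ≤ h := by linarith [(hS hr).1, (hS hsS).2]
  set P := (s - r) ^ (1 - α) with hP
  have hP0 : 0 ≤ P := Real.rpow_nonneg hrs0 _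
  have e1 : s - r ≤ P := by
    have := rpow_le_rpow_of_le_one hrs0 (hrsh.trans hh1) h1 (by linarith [hs.alpha_pos] : 1 - α ≤ 1)
    rwa [Real.rpow_one] at this
  have e2 : (s - r) ^ (1 + l - α) ≤ h ^ l * P := by
    rw [show 1 + l - α = l + (1 - α) by ring, Real.rpow_add_of_nonneg hrs0 hl0.le h1.le]
    exact mul_le_mul_of_nonneg_right (Real.rpow_le_rpow hrs0 hrsh hl0.le) hP0
  have e3 : h ^ (1 - α) ≤ h ^ l := rpow_le_rpow_of_le_one h0.le hh1 hl0 hs.l_le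
  have hhl : h ^ l ≤ 1 := Real.rpow_le_one h0.le hh1 hl0.le
  have hhl0 : 0 ≤ h ^ l := Real.rpow_nonneg h0.le _
  have hh10 : 0 ≤ h ^ (1 - α) := Real.rpow_nonneg h0.le _
  set N := ‖X t‖ + A * h ^ (1 - α) with hN
  have hN0 : 0 ≤ N := by positivity
  have hXr : ‖X r‖ ≤ N := by
    have q1 := hX t ht r hr (hS hr).1
    have q2 : (r - t) ^ (1 - α) ≤ h ^ (1 - α) :=
      Real.rpow_le_rpow (by linarith [(hS hr).1]) (by linarith [(hS hr).2]) h1.le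
    have q3 := norm_le_norm_add_norm_sub' (X r) (X t)
    have := mul_le_mul_of_nonneg_left q2 hA
    linarith
  have hσ : ‖mulVecE (σ r (X r)) (g s - g r)‖ ≤ M * (1 + N) * (M * P) := by
    refine (norm_mulVecE_le _ _).trans (mul_le_mul ?_ ?_ (norm_nonneg _) (by positivity))
    · exact (hs.sigma_growth r (hST hr) _).trans (mul_le_mul_of_nonneg_left (by linarith) hM)
    · have := hs.g_holder s (hST hsS) r (hST hr)
      rwa [abs_of_nonneg hrs0] at this
  have hR := hrem A hA hX r hr s hsS hrs
  have htri : ‖X s - X r‖ ≤ ‖X s - X r - mulVecE (σ r (X r)) (g s - g r)‖ +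
      ‖mulVecE (σ r (X r)) (g s - g r)‖ := by
    have := norm_add_le (X s - X r - mulVecE (σ r (X r)) (g s - g r))
      (mulVecE (σ r (X r)) (g s - g r))
    rwa [sub_add_cancel] at this
  have f1 : (1 + M * (1 + N)) * (s - r) ≤ (1 + M * (1 + N)) * P :=
    mul_le_mul_of_nonneg_left e1 (by positivity)
  have f2 : c * (1 + A) * (s - r) ^ (1 + l - α) ≤ c * (1 + A) * (h ^ l * P) :=
    mul_le_mul_of_nonneg_left e2 (by positivity)
  have hcoef : M * (1 + N) * M + (1 + M * (1 + N)) + c * (1 + A) * h ^ l ≤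
      (M ^ 2 + M + 1 + c) * (1 + ‖X t‖) + A / 2 := by
    have g1 : (M ^ 2 + M) * (A * h ^ (1 - α)) + c * A * h ^ l ≤ A / 2 := by
      have g2 : (M ^ 2 + M) * (A * h ^ (1 - α)) ≤ (M ^ 2 + M) * (A * h ^ l) := by gcongr
      have g3 := mul_le_mul_of_nonneg_left hsmall hA
      nlinarith
    have g4 : c * h ^ l ≤ c := mul_le_of_le_one_right hc hhl
    have g5 : 0 ≤ c * ‖X t‖ := by positivity
    rw [hN]
    nlinarith
  have := mul_le_mul_of_nonneg_right hcoef hP0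
  nlinarith

theorem IsSolution.apply_left {t x X} (ht : t ≤ T) (hX : IsSolution α T b σ g t x X) : X t = x := by
  have := hX.2 t ⟨le_rfl, ht⟩
  rw [this]
  ext i
  simp [stieltjesVec, stieltjes]

theorem YoungSystem.continuousOn_drift (hs : YoungSystem α l T M b σ g) {t s A : ℝ} {X : ℝ → Eucl d}
    (ht : 0 ≤ t) (hsT : s ≤ T) (hA : 0 ≤ A) (hX : HolderWithOn A (1 - α) (Icc t s) X) :
    ContinuousOn (fun r => b r (X r)) (Icc t s) := by
  have h1 : 0 < 1 - α := (hs.alpha_pos.trans hs.alpha_lt).trans_le hs.l_le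
  have habs : ∀ x ∈ Icc t s, ∀ y ∈ Icc t s, ‖X x - X y‖ ≤ A * |x - y| ^ (1 - α) := by
    intro x hx y hy
    rcases le_total x y with h | h
    · rw [norm_sub_rev, abs_sub_comm, abs_of_nonneg (sub_nonneg.2 h)]; exact hX x hx y hy h
    · rw [abs_of_nonneg (sub_nonneg.2 h)]; exact hX y hy x hx h
  rcases lt_or_ge s t with hst | hts
  · rw [Icc_eq_empty hst.not_ge]; exact continuousOn_empty _
  have hbd : ∀ x ∈ Icc t s, ‖X x‖ ≤ ‖X t‖ + A * (s - t) ^ (1 - α) := by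
    intro x hx
    have q1 := hX t ⟨le_rfl, hts⟩ x hx hx.1
    have q2 : (x - t) ^ (1 - α) ≤ (s - t) ^ (1 - α) :=
      Real.rpow_le_rpow (by linarith [hx.1]) (by linarith [hx.2]) h1.le
    have q3 := norm_le_norm_add_norm_sub' (X x) (X t)
    have := mul_le_mul_of_nonneg_left q2 hA
    linarith
  obtain ⟨L, hL, hlip⟩ := hs.b_lipschitz (‖X t‖ + A * (s - t) ^ (1 - α))
    (by have := Real.rpow_nonneg (sub_nonneg.2 hts) (1 - α); positivity)
  refine continuousOn_of_holder (A := L * (1 + A)) h1 fun x hx y hy => ?_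
  refine (hlip x ⟨ht.trans hx.1, hx.2.trans hsT⟩ y ⟨ht.trans hy.1, hy.2.trans hsT⟩ _ _
    (hbd x hx) (hbd y hy)).trans ?_
  rw [mul_assoc, Real.norm_eq_abs]
  refine mul_le_mul_of_nonneg_left ?_ hL
  have := habs x hx y hy
  linarith

theorem HolderWithOn.frob_sigma (hs : YoungSystem α l T M b σ g) {t s A : ℝ} {X : ℝ → Eucl d}
    (ht : 0 ≤ t) (hsT : s ≤ T) (hA : 0 ≤ A) (hX : HolderWithOn A (1 - α) (Icc t s) X)
    (hlen : s - t ≤ 1) :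
    ∀ x ∈ Icc t s, ∀ y ∈ Icc t s, frob (σ x (X x) - σ y (X y)) ≤ M * (1 + A) * |x - y| ^ l := by
  have hl0 := hs.alpha_pos.trans hs.alpha_lt
  have key : ∀ x ∈ Icc t s, ∀ y ∈ Icc t s, x ≤ y →
      frob (σ x (X x) - σ y (X y)) ≤ M * (1 + A) * |x - y| ^ l := by
    intro x hx y hy hxy
    have q := hX x hx y hy hxy
    refine (hs.sigma_lipschitz x ⟨ht.trans hx.1, hx.2.trans hsT⟩ y ⟨ht.trans hy.1, hy.2.trans hsT⟩
      _ _).trans ?_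
    rw [mul_assoc]
    refine mul_le_mul_of_nonneg_left ?_ hs.M_nonneg
    rw [norm_sub_rev, abs_sub_comm, abs_of_nonneg (sub_nonneg.2 hxy)]
    have := rpow_le_rpow_of_le_one (sub_nonneg.2 hxy) (by linarith [hx.1, hy.2]) hl0 hs.l_le
    have := mul_le_mul_of_nonneg_left this hA
    linarith
  intro x hx y hy
  rcases le_total x y with h | h
  · exact key x hx y hy h
  · rw [frob_sub_comm, abs_sub_comm]; exact key y hy x hx h

theorem HolderOnSet.holderWithOn {η : ℝ} {I : Set ℝ} {X : ℝ → Eucl d} (h : HolderOnSet η I X) :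
    ∃ A, 0 ≤ A ∧ HolderWithOn A η I X := by
  obtain ⟨C, hC⟩ := h
  refine ⟨|C|, abs_nonneg _, fun r hr s hs hrs => (hC s hs r hr).trans ?_⟩
  rw [abs_of_nonneg (sub_nonneg.2 hrs)]
  exact mul_le_mul_of_nonneg_right (le_abs_self C) (Real.rpow_nonneg (sub_nonneg.2 hrs) _)

theorem HolderWithOn.mono {E : Type*} [NormedAddCommGroup E] {A η : ℝ} {S S' : Set ℝ} {X : ℝ → E}
    (h : HolderWithOn A η S X) (hS : S' ⊆ S) : HolderWithOn A η S' X :=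
  fun r hr s hs => h r (hS hr) s (hS hs)

theorem IsSolution.sub_eq (hs : YoungSystem α l T M b σ g) {t x X} (ht : t ∈ Icc 0 T)
    (hX : IsSolution α T b σ g t x X) {r s : ℝ} (htr : t ≤ r) (hrs : r ≤ s) (hsT : s ≤ T) :
    X s - X r = (∫ u in r..s, b u (X u)) +
      (stieltjesVec α t s (fun u => σ u (X u)) g - stieltjesVec α t r (fun u => σ u (X u)) g) := by
  obtain ⟨A, hA, hXA⟩ := hX.1.holderWithOn
  have hc := hs.continuousOn_drift ht.1 le_rfl hA hXA
  have i1 : IntervalIntegrable (fun u => b u (X u)) volume t r :=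
    (hc.mono (by rw [uIcc_of_le htr]; exact Icc_subset_Icc_right (hrs.trans hsT))).intervalIntegrable
  have i2 : IntervalIntegrable (fun u => b u (X u)) volume r s :=
    (hc.mono (by rw [uIcc_of_le hrs]; exact Icc_subset_Icc htr hsT)).intervalIntegrable
  rw [hX.2 s ⟨htr.trans hrs, hsT⟩, hX.2 r ⟨htr, hrs.trans hsT⟩,
    ← intervalIntegral.integral_add_adjacent_intervals i1 i2]
  abel

/-- Solutions are Hölder on a window of uniform length, with a uniform constant. -/
theorem YoungSystem.exists_solution_holder (hs : YoungSystem α l T M b σ g) :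
    ∃ h K : ℝ, 0 < h ∧ h ≤ 1 ∧ 0 ≤ K ∧ ∀ t ∈ Icc 0 T, ∀ (x : Eucl d) (X : ℝ → Eucl d),
      IsSolution α T b σ g t x X →
      HolderWithOn (K * (1 + ‖x‖)) (1 - α) (Icc t (min (t + h) T)) X := by
  have hM := hs.M_nonneg
  -- One factor M is the Young constant, the other comes from the Hölder constant M(1+A) of σ along
  -- X.
  obtain ⟨h, K, h0, hh1, hK, hw⟩ := hs.exists_holder_window (c := M * M) (by positivity)
  refine ⟨h, K, h0, hh1, hK, fun t ht x X hX => ?_⟩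
  have htm : t ≤ min (t + h) T := le_min (by linarith) ht.2
  have hxX := hX.apply_left ht.2
  rw [← hxX]
  have hsub : Icc t (min (t + h) T) ⊆ Icc t T := Icc_subset_Icc_right (min_le_right _ _)
  obtain ⟨A₀, hA₀, hXA₀⟩ := hX.1.holderWithOn
  refine hw _ t X (Icc_subset_Icc_right (min_le_left _ _)) (hsub.trans (Icc_subset_Icc_left ht.1))
    ⟨le_rfl, htm⟩ ⟨A₀, hA₀, hXA₀.mono hsub⟩ ?_
  intro A hA hXA r hr s hsS hrs
  have hsT : s ≤ T := hsS.2.trans (min_le_right _ _)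
  have hsh : s ≤ t + h := hsS.2.trans (min_le_left _ _)
  have hXA' : HolderWithOn A (1 - α) (Icc t s) X := hXA.mono (Icc_subset_Icc_right hsS.2)
  have hY := hs.young (fun u => σ u (X u)) (M * (1 + A)) t r s (by positivity) ht.1 hr.1 hrs hsT
    (hXA'.frob_sigma hs ht.1 hsT hA (by linarith))
  have hI : ‖∫ u in r..s, b u (X u)‖ ≤ M * (1 + (‖X t‖ + A * h ^ (1 - α))) * (s - r) := by
    have := intervalIntegral.norm_integral_le_of_norm_le_const (a := r) (b := s)
      (f := fun u => b u (X u)) (C := M * (1 + (‖X t‖ + A * h ^ (1 - α)))) ?_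
    · rwa [abs_of_nonneg (sub_nonneg.2 hrs)] at this
    · intro u hu
      rw [uIoc_of_le hrs] at hu
      have hut : t ≤ u := hr.1.trans hu.1.le
      refine (hs.b_growth u ⟨ht.1.trans hut, hu.2.trans hsT⟩ _).trans ?_
      refine mul_le_mul_of_nonneg_left ?_ hM
      have q1 := hXA' t ⟨le_rfl, hut.trans hu.2⟩ u ⟨hut, hu.2⟩ hut
      have q2 : (u - t) ^ (1 - α) ≤ h ^ (1 - α) :=
        Real.rpow_le_rpow (by linarith) (by linarith [hu.2])
          ((hs.alpha_pos.trans hs.alpha_lt).le.trans hs.l_le)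
      have q3 := norm_le_norm_add_norm_sub' (X u) (X t)
      have := mul_le_mul_of_nonneg_left q2 hA
      linarith
  rw [hX.sub_eq hs ht hr.1 hrs hsT, add_sub_assoc]
  refine (norm_add_le _ _).trans (add_le_add (hI.trans ?_) (hY.trans_eq (by ring)))
  have := sub_nonneg.2 hrs
  nlinarith

end

/-! ### Viability implies left-closedness and tangency; tangency implies contingency. -/

section

variable {d k : ℕ} {α l T M : ℝ} {b : ℝ → Eucl d → Eucl d}
  {σ : ℝ → Eucl d → Matrix (Fin d) (Fin k) ℝ} {g : ℝ → Eucl k} {K : ℝ → Set (Eucl d)}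

theorem HolderWithOn.norm_sub_le {E : Type*} [NormedAddCommGroup E] {A η : ℝ} {S : Set ℝ}
    {X : ℝ → E} (h : HolderWithOn A η S X) {r s : ℝ} (hr : r ∈ S) (hs : s ∈ S) :
    ‖X s - X r‖ ≤ A * |s - r| ^ η := by
  rcases le_total r s with hrs | hrs
  · rw [abs_of_nonneg (sub_nonneg.2 hrs)]; exact h r hr s hs hrs
  · rw [norm_sub_rev, abs_sub_comm, abs_of_nonneg (sub_nonneg.2 hrs)]; exact h s hs r hr hrs

theorem stieltjesVec_self (α t : ℝ) (F : ℝ → Matrix (Fin d) (Fin k) ℝ) (g : ℝ → Eucl k) :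
    stieltjesVec α t t F g = 0 := by
  ext i; simp [stieltjesVec, stieltjes]

theorem YoungSystem.one_sub_pos (hs : YoungSystem α l T M b σ g) : 0 < 1 - α :=
  (hs.alpha_pos.trans hs.alpha_lt).trans_le hs.l_le

/-- The viable solution from (s_n, y_n) moves by at most K₀(1+|y_n|)(t-s_n)^{1-α} up to time t,
where it lies in K(t). These end points have the same limit as y_n, and K(t) is closed. -/
theorem YoungSystem.leftClosed_of_viable (hs : YoungSystem α l T M b σ g)
    (hKcl : ∀ t ∈ Icc 0 T, IsClosed (K t)) (hV : Viable α T b σ g K) : LeftClosed T K := by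
  obtain ⟨h, K₀, h0, -, hK₀, hsol⟩ := hs.exists_solution_holder
  intro t ht s y z hsn hy hst hyz
  have hmem : ∀ n, s n ∈ Icc 0 T := fun n => ⟨(hsn n).1, (hsn n).2.le.trans ht.2⟩
  choose X hX hXK using fun n => hV (s n) (hmem n) (y n) (hy n)
  have hlim : Tendsto (fun n => K₀ * (1 + ‖y n‖) * (t - s n) ^ (1 - α)) atTop (𝓝 0) := by
    have e1 : Tendsto (fun n => (t - s n) ^ (1 - α)) atTop (𝓝 0) := by
      have : ContinuousAt (fun u : ℝ => (t - u) ^ (1 - α)) t :=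
        ContinuousAt.rpow_const (by fun_prop) (Or.inr hs.one_sub_pos.le)
      have h2 := this.tendsto.comp hst
      simpa [Function.comp_def, Real.zero_rpow hs.one_sub_pos.ne'] using h2
    have e2 := ((hyz.norm.const_add 1).const_mul K₀).mul e1
    simpa using e2
  have hXt : Tendsto (fun n => X n t - y n) atTop (𝓝 0) := by
    rw [tendsto_zero_iff_norm_tendsto_zero]
    refine squeeze_zero' (Eventually.of_forall fun _ => norm_nonneg _) ?_ hlim
    have hev : ∀ᶠ n in atTop, t - h < s n := hst.eventually (lt_mem_nhds (by linarith))
    filter_upwards [hev] with n hn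
    have htn : t ≤ min (s n + h) T := le_min (by linarith) ht.2
    have := hsol (s n) (hmem n) (y n) (X n) (hX n) (s n) ⟨le_rfl, (hsn n).2.le.trans htn⟩ t
      ⟨(hsn n).2.le, htn⟩ (hsn n).2.le
    rwa [(hX n).apply_left (hmem n).2] at this
  have hXz : Tendsto (fun n => X n t) atTop (𝓝 z) := by
    have := hXt.add hyz
    simpa using this
  exact (hKcl t ht).mem_of_tendsto hXz
    (Eventually.of_forall fun n => hXK n t ⟨(hsn n).2.le, ht.2⟩)

/-- With U and V the increments of b and σ along a viable solution, the tangency expression is the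
solution itself. The uniform window makes the constants depend on R only. -/
theorem YoungSystem.tangent_of_viable {β : ℝ} (hs : YoungSystem α (min β (1 - α)) T M b σ g)
    (hV : Viable α T b σ g K) : Tangent α β T b σ g K := by
  obtain ⟨h, K₀, h0, hh1, hK₀, hsol⟩ := hs.exists_solution_holder
  have hM := hs.M_nonneg
  have hL : ∀ R : ℝ, ∃ L : ℝ, 0 ≤ L ∧ (0 < R → ∀ t ∈ Icc 0 T, ∀ s ∈ Icc 0 T, ∀ x y : Eucl d,
      ‖x‖ ≤ R + K₀ * (1 + R) → ‖y‖ ≤ R + K₀ * (1 + R) →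
      ‖b t x - b s y‖ ≤ L * (|t - s| ^ (1 - α) + ‖x - y‖)) := by
    intro R
    by_cases hR : 0 < R
    · obtain ⟨L, hL, h⟩ := hs.b_lipschitz (R + K₀ * (1 + R)) (by positivity)
      exact ⟨L, hL, fun _ => h⟩
    -- For R ≤ 0 nothing is claimed; the value 0 only makes R ↦ L R total.
    · exact ⟨0, le_rfl, fun h => absurd h hR⟩
  choose L hL0 hL using hL
  refine ⟨fun R => L R * (1 + K₀ * (1 + R)) + 1, fun R => M * (1 + K₀ * (1 + R)) + 1,
    fun R hR => ⟨?_, ?_⟩, ?_⟩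
  · have := hL0 R; positivity
  · positivity
  intro t ht x hx
  obtain ⟨X, hX, hXK⟩ := hV t ht x hx
  have hXt := hX.apply_left ht.2
  have hH := hsol t ht x X hX
  have htm : t ≤ min (t + h) T := le_min (by linarith) ht.2
  refine ⟨h, h0, fun r => b r (X r) - b t x, fun r => σ r (X r) - σ t x, ?_, ?_, ?_, ?_⟩
  · simp [hXt]
  · simp [hXt]
  · intro R hR hxR s hsS τ hτ
    have hmem : ∀ u ∈ Icc t (min (t + h) T), u ∈ Icc 0 T := fun u hu =>
      ⟨ht.1.trans hu.1, hu.2.trans (min_le_right _ _)⟩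
    have hbd : ∀ u ∈ Icc t (min (t + h) T), ‖X u‖ ≤ R + K₀ * (1 + R) := by
      intro u hu
      have q1 := hH t ⟨le_rfl, htm⟩ u hu hu.1
      rw [hXt] at q1
      have q2 : (u - t) ^ (1 - α) ≤ 1 := Real.rpow_le_one (by linarith [hu.1])
        (by linarith [hu.2.trans (min_le_left _ _)]) hs.one_sub_pos.le
      have q3 := norm_le_norm_add_norm_sub' (X u) x
      have q4 : K₀ * (1 + ‖x‖) * (u - t) ^ (1 - α) ≤ K₀ * (1 + ‖x‖) :=
        mul_le_of_le_one_right (by positivity) q2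
      have q5 : K₀ * (1 + ‖x‖) ≤ K₀ * (1 + R) := by gcongr
      linarith
    have hd : ‖X τ - X s‖ ≤ K₀ * (1 + R) * |τ - s| ^ (1 - α) := by
      refine (hH.norm_sub_le hsS hτ).trans ?_
      gcongr
    have hP : 0 ≤ |τ - s| ^ (1 - α) := Real.rpow_nonneg (abs_nonneg _) _
    have hPl : |τ - s| ^ (1 - α) ≤ |τ - s| ^ min β (1 - α) := by
      refine rpow_le_rpow_of_le_one (abs_nonneg _) ?_ (hs.alpha_pos.trans hs.alpha_lt)
        (min_le_right _ _)
      have q1 := hsS.2.trans (min_le_left _ _)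
      have q2 := hτ.2.trans (min_le_left _ _)
      exact abs_sub_le_iff.2 ⟨by linarith [hsS.1], by linarith [hτ.1]⟩
    constructor
    · beta_reduce
      rw [sub_sub_sub_cancel_right]
      refine (hL R hR τ (hmem τ hτ) s (hmem s hsS) _ _ (hbd τ hτ) (hbd s hsS)).trans ?_
      have := mul_le_mul_of_nonneg_left hd (hL0 R)
      nlinarith
    · beta_reduce
      rw [sub_sub_sub_cancel_right]
      refine (hs.sigma_lipschitz τ (hmem τ hτ) s (hmem s hsS) _ _).trans ?_
      have h1 := mul_le_mul_of_nonneg_left hPl (by positivity : 0 ≤ K₀ * (1 + R))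
      have h2 := mul_le_mul_of_nonneg_left (hd.trans h1) hM
      nlinarith
  · intro s hsS
    have hsT : s ∈ Icc t T := ⟨hsS.1, hsS.2.trans (min_le_right _ _)⟩
    simp only [add_sub_cancel]
    rw [← hX.2 s hsT]
    exact hXK s hsT

/-- Q is ∫U plus the error of freezing the integrand σ(t,x) + V at its initial value σ(t,x), because
V(t) = 0. The Young expansion makes that error O((s-t)^{1+l-α}), and ∫U is O((s-t)^{2-α}). -/
theorem YoungSystem.contingent_of_tangent {β : ℝ} (hs : YoungSystem α (min β (1 - α)) T M b σ g)
    (hT : Tangent α β T b σ g K) : Contingent α T b σ g K := by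
  obtain ⟨D, D', hD, hTan⟩ := hT
  have hM := hs.M_nonneg
  have ha := hs.one_sub_pos
  set l := min β (1 - α) with hl
  have hl0 : 0 < l := hs.alpha_pos.trans hs.alpha_lt
  have hla := hs.alpha_lt
  have hl1 := hs.l_le
  have hα := hs.alpha_pos
  -- Of the two terms M D' R, one bounds the Young remainder based at s and the other V(s)(g(τ) -
  -- g(s)). The exponent l - α lies in (0,1) because α < l ≤ 1-α. The window is cut to length at
  -- most 1 so that higher powers of time are smaller.
  refine ⟨fun R => D R + 2 * M * D' R, fun R => D R + M * D' R, fun _ => l - α,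
    fun R hR => ⟨?_, ?_, by linarith, by linarith⟩, ?_⟩
  · have := hD R hR; nlinarith
  · have := hD R hR; nlinarith
  intro t ht x hx
  obtain ⟨h, h0, U, V, hU, hV, hUV, hmem⟩ := hTan t ht x hx
  have hsub : Icc t (min (t + min h 1) T) ⊆ Icc t (min (t + h) T) :=
    Icc_subset_Icc_right (min_le_min_right _ (by linarith [min_le_left h 1]))
  have hlen : ∀ u ∈ Icc t (min (t + min h 1) T), u - t ≤ 1 ∧ u ≤ T := fun u hu =>
    ⟨by linarith [hu.2.trans (min_le_left _ _), min_le_right h 1], hu.2.trans (min_le_right _ _)⟩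
  obtain ⟨R₀, hR₀, hxR₀⟩ : ∃ R₀, 0 < R₀ ∧ ‖x‖ ≤ R₀ :=
    ⟨‖x‖ + 1, by positivity, by linarith⟩
  have hUc : ContinuousOn U (Icc t (min (t + h) T)) :=
    continuousOn_of_holder ha fun u hu v hv => (hUV R₀ hR₀ hxR₀ v hv u hu).1
  have hUi : ∀ u ∈ Icc t (min (t + h) T), ∀ v ∈ Icc t (min (t + h) T),
      IntervalIntegrable U volume u v := fun u hu v hv =>
    (hUc.mono (ordConnected_Icc.uIcc_subset hu hv)).intervalIntegrable
  set F : ℝ → Matrix (Fin d) (Fin k) ℝ := fun r => σ t x + V r with hF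
  have hY : ∀ R, 0 < R → ‖x‖ ≤ R → ∀ r s, t ≤ r → r ≤ s → s ∈ Icc t (min (t + h) T) →
      ‖stieltjesVec α t s F g - stieltjesVec α t r F g - mulVecE (F r) (g s - g r)‖ ≤
        M * D' R * (s - r) ^ (1 + l - α) := by
    intro R hR hxR r s htr hrs hsS
    refine hs.young F (D' R) t r s (hD R hR).2.le ht.1 htr hrs (hsS.2.trans (min_le_right _ _)) ?_
    intro u hu v hv
    have := (hUV R hR hxR v ⟨hv.1, hv.2.trans hsS.2⟩ u ⟨hu.1, hu.2.trans hsS.2⟩).2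
    simpa only [hF, add_sub_add_left_eq_sub] using this
  set Q : ℝ → Eucl d := fun s => (∫ r in t..s, (b t x + U r)) + stieltjesVec α t s F g -
    (s - t) • b t x - mulVecE (σ t x) (g s - g t) with hQ
  have htt : t ∈ Icc t (min (t + h) T) := ⟨le_rfl, le_min (by linarith) ht.2⟩
  have hQ' : ∀ s ∈ Icc t (min (t + h) T), Q s = (∫ r in t..s, U r) +
      (stieltjesVec α t s F g - mulVecE (σ t x) (g s - g t)) := by
    intro s hsS
    simp only [hQ]
    rw [intervalIntegral.integral_add intervalIntegrable_const (hUi t htt s hsS),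
      intervalIntegral.integral_const]
    abel
  have hUb : ∀ R, 0 < R → ‖x‖ ≤ R → ∀ u ∈ Icc t (min (t + h) T), ‖U u‖ ≤ D R * (u - t) ^ (1 - α) := by
    intro R hR hxR u hu
    have := (hUV R hR hxR t htt u hu).1
    rwa [hU, sub_zero, abs_of_nonneg (sub_nonneg.2 hu.1)] at this
  have hVb : ∀ R, 0 < R → ‖x‖ ≤ R → ∀ u ∈ Icc t (min (t + h) T), frob (V u) ≤ D' R * (u - t) ^ l := by
    intro R hR hxR u hu
    have := (hUV R hR hxR t htt u hu).2
    rwa [hV, sub_zero, abs_of_nonneg (sub_nonneg.2 hu.1)] at this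
  have hmain : ∀ R, 0 < R → ‖x‖ ≤ R → ∀ s ∈ Icc t (min (t + min h 1) T),
      ∀ τ ∈ Icc t (min (t + min h 1) T), s ≤ τ →
      ‖Q τ - Q s‖ ≤ (D R + 2 * M * D' R) * (τ - s) ^ (1 - α) := by
    intro R hR hxR s hsS τ hτ hsτ
    obtain ⟨hD0, hD'0⟩ := hD R hR
    have h0s := sub_nonneg.2 hsτ
    have h1s : τ - s ≤ 1 := by linarith [(hlen τ hτ).1, hsS.1]
    set P := (τ - s) ^ (1 - α)
    have hP0 : 0 ≤ P := Real.rpow_nonneg h0s _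
    have e1 : τ - s ≤ P := by
      have := rpow_le_rpow_of_le_one h0s h1s ha (by linarith : 1 - α ≤ 1)
      rwa [Real.rpow_one] at this
    have e2 : (τ - s) ^ (1 + l - α) ≤ P :=
      rpow_le_rpow_of_le_one h0s h1s ha (by linarith)
    have i1 : ‖∫ r in s..τ, U r‖ ≤ D R * (τ - s) := by
      have := intervalIntegral.norm_integral_le_of_norm_le_const (a := s) (b := τ) (f := U)
        (C := D R) ?_
      · rwa [abs_of_nonneg h0s] at this
      · intro u hu
        rw [uIoc_of_le hsτ] at hu
        have hu' : u ∈ Icc t (min (t + min h 1) T) := ⟨hsS.1.trans hu.1.le, hu.2.trans hτ.2⟩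
        refine (hUb R hR hxR u (hsub hu')).trans (mul_le_of_le_one_right hD0.le ?_)
        exact Real.rpow_le_one (sub_nonneg.2 hu'.1) (hlen u hu').1 ha.le
    have i2 := hY R hR hxR s τ hsS.1 hsτ (hsub hτ)
    have i3 : ‖mulVecE (V s) (g τ - g s)‖ ≤ D' R * (M * P) := by
      refine (norm_mulVecE_le _ _).trans (mul_le_mul ?_ ?_ (norm_nonneg _) hD'0.le)
      · refine (hVb R hR hxR s (hsub hsS)).trans (mul_le_of_le_one_right hD'0.le ?_)
        exact Real.rpow_le_one (sub_nonneg.2 hsS.1) (hlen s hsS).1 hl0.le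
      · have := hs.g_holder τ ⟨ht.1.trans hτ.1, (hlen τ hτ).2⟩ s ⟨ht.1.trans hsS.1, (hlen s hsS).2⟩
        rwa [abs_of_nonneg h0s] at this
    have hsum := intervalIntegral.integral_add_adjacent_intervals
      (hUi t htt s (hsub hsS)) (hUi s (hsub hsS) τ (hsub hτ))
    have eq : Q τ - Q s = (∫ r in s..τ, U r) +
        (stieltjesVec α t τ F g - stieltjesVec α t s F g - mulVecE (F s) (g τ - g s)) +
        mulVecE (V s) (g τ - g s) := by
      have eF : mulVecE (V s) (g τ - g s) = mulVecE (F s) (g τ - g s) - mulVecE (σ t x) (g τ - g s) := by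
        rw [← mulVecE_sub_left]; simp [hF]
      have eg : mulVecE (σ t x) (g τ - g s) =
          mulVecE (σ t x) (g τ - g t) - mulVecE (σ t x) (g s - g t) := by
        rw [← mulVecE_sub_right, sub_sub_sub_cancel_right]
      rw [hQ' τ (hsub hτ), hQ' s (hsub hsS), ← hsum, eF, eg]
      abel
    rw [eq]
    refine (norm_add₃_le).trans ?_
    have q1 := mul_le_mul_of_nonneg_left e1 hD0.le
    have q2 := mul_le_mul_of_nonneg_left e2 (mul_nonneg hM hD'0.le)
    nlinarith
  refine ⟨min h 1, lt_min h0 one_pos, Q, ?_, ?_⟩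
  · intro R hR hxR s hsS τ hτ
    constructor
    · rcases le_total s τ with h | h
      · rw [abs_of_nonneg (sub_nonneg.2 h)]; exact hmain R hR hxR s hsS τ hτ h
      · rw [norm_sub_rev, abs_sub_comm, abs_of_nonneg (sub_nonneg.2 h)]
        exact hmain R hR hxR τ hτ s hsS h
    · obtain ⟨hD0, hD'0⟩ := hD R hR
      have h0s := sub_nonneg.2 hsS.1
      have h1s := (hlen s hsS).1
      rw [hQ' s (hsub hsS), abs_of_nonneg h0s]
      have i1 : ‖∫ r in t..s, U r‖ ≤ D R * (s - t) ^ (1 - α) * (s - t) := by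
        have := intervalIntegral.norm_integral_le_of_norm_le_const (a := t) (b := s) (f := U)
          (C := D R * (s - t) ^ (1 - α)) ?_
        · rwa [abs_of_nonneg h0s] at this
        · intro u hu
          rw [uIoc_of_le hsS.1] at hu
          refine (hUb R hR hxR u (hsub ⟨hu.1.le, hu.2.trans hsS.2⟩)).trans ?_
          refine mul_le_mul_of_nonneg_left ?_ hD0.le
          exact Real.rpow_le_rpow (by linarith [hu.1]) (by linarith [hu.2]) ha.le
      have i2 := hY R hR hxR t s le_rfl hsS.1 (hsub hsS)
      rw [stieltjesVec_self, sub_zero] at i2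
      have eF : F t = σ t x := by simp [hF, hV]
      rw [eF] at i2
      have e1 : (s - t) ^ (1 - α) * (s - t) ≤ (s - t) ^ (1 + (l - α)) := by
        have : (s - t) ^ (1 - α) * (s - t) = (s - t) ^ (1 - α + 1) := by
          rw [Real.rpow_add_of_nonneg h0s ha.le zero_le_one, Real.rpow_one]
        rw [this]
        exact rpow_le_rpow_of_le_one h0s h1s (by linarith) (by linarith)
      have e2 := mul_le_mul_of_nonneg_left e1 hD0.le
      rw [show 1 + l - α = 1 + (l - α) by ring] at i2
      refine (norm_add_le _ _).trans ((add_le_add i1 i2).trans ?_)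
      nlinarith
  · intro s hsS
    have := hmem s (hsub hsS)
    convert this using 1
    simp only [hQ]
    abel

end

/-! ### Discrete sewing and Hölder bounds for chains in the tube. -/

section

theorem exists_switch {P : ℕ → Prop} {a c : ℕ} (hac : a ≤ c) (ha : P a) (hc : ¬P c) :
    ∃ i, a ≤ i ∧ i < c ∧ P i ∧ ¬P (i + 1) := by
  induction c, hac using Nat.le_induction with
  | base => exact absurd ha hc
  | succ c hac ih =>
    by_cases h : P c
    · exact ⟨c, hac, Nat.lt_succ_self c, h, hc⟩
    · obtain ⟨i, h1, h2, h3⟩ := ih h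
      exact ⟨i, h1, by omega, h3⟩

/-- The sewing constant. -/
def sewConst (θ : ℝ) : ℝ := 2 / (1 - (1 / 2) ^ θ)

theorem sewConst_spec {θ : ℝ} (hθ : 0 < θ) :
    0 ≤ sewConst θ ∧ 2 * (sewConst θ * (1 / 2) ^ (1 + θ)) + 2 = sewConst θ := by
  have h : ((1 / 2 : ℝ)) ^ θ < 1 := Real.rpow_lt_one (by norm_num) (by norm_num) hθ
  have h' : 1 - (1 / 2 : ℝ) ^ θ ≠ 0 := by linarith
  refine ⟨div_nonneg (by norm_num) (by linarith), ?_⟩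
  rw [sewConst, Real.rpow_add (by norm_num), Real.rpow_one]
  field_simp
  ring

/-- Discrete sewing lemma: an almost additive two-parameter family along a finite partition whose
increments over single steps are controlled additively. -/
theorem discrete_sewing {E : Type*} [NormedAddCommGroup E] {θ D : ℝ} (hθ : 0 < θ) {a n : ℕ}
    {τ w : ℕ → ℝ} {J : ℕ → ℕ → E} (hD : 0 ≤ D)
    (hτ : ∀ i j, a ≤ i → i < j → j ≤ n → τ i < τ j) (h0 : ∀ i, J i i = 0)
    (hstep : ∀ i, a ≤ i → i < n → ‖J i (i + 1)‖ ≤ w (i + 1) - w i)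
    (hdef : ∀ i j k, a ≤ i → i ≤ j → j ≤ k → k ≤ n →
      ‖J i k - J i j - J j k‖ ≤ D * (τ k - τ i) ^ (1 + θ)) :
    ∀ i k, a ≤ i → i ≤ k → k ≤ n →
      ‖J i k‖ ≤ w k - w i + sewConst θ * D * (τ k - τ i) ^ (1 + θ) := by
  obtain ⟨hc0, hc⟩ := sewConst_spec hθ
  set c := sewConst θ
  have main : ∀ N i k, k - i ≤ N → a ≤ i → i ≤ k → k ≤ n →
      ‖J i k‖ ≤ w k - w i + c * D * (τ k - τ i) ^ (1 + θ) := by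
    intro N
    induction N with
    | zero =>
      intro i k h ha hik hk
      obtain rfl : i = k := by omega
      rw [h0, norm_zero, sub_self, sub_self, Real.zero_rpow (by linarith)]; simp
    | succ N ih =>
      intro i k h ha hik hk
      rcases hik.eq_or_lt with rfl | hik
      · rw [h0, norm_zero, sub_self, sub_self, Real.zero_rpow (by linarith)]; simp
      have hlt := hτ i k ha hik hk
      -- j is the last index in the first half of the time interval. The pieces [i,j] and [j+1,k]
      -- last at most ℓ/2 each and are covered by induction on the number of steps; the step across
      -- the midpoint may be long and is charged to w.
      obtain ⟨j, hij, hjk, hj1, hj2⟩ := exists_switch (P := fun j => τ j ≤ (τ i + τ k) / 2) hik.le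
        (by linarith) (by linarith)
      set ℓ := τ k - τ i with hℓ
      have hℓ0 : 0 ≤ ℓ := by linarith
      have hjle : τ i ≤ τ j := by
        rcases hij.eq_or_lt with rfl | h'
        · exact le_rfl
        · exact (hτ i j ha h' (by omega)).le
      have hjle' : τ (j + 1) ≤ τ k := by
        rcases (Nat.succ_le_of_lt hjk).eq_or_lt with h' | h'
        · rw [← h']
        · exact (hτ (j + 1) k (by omega) h' hk).le
      have half : ∀ u, 0 ≤ u → u ≤ ℓ / 2 → u ^ (1 + θ) ≤ (1 / 2) ^ (1 + θ) * ℓ ^ (1 + θ) := by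
        intro u hu hu'
        rw [← Real.mul_rpow (by norm_num) hℓ0]
        exact Real.rpow_le_rpow hu (by linarith) (by linarith)
      have b1 := ih i j (by omega) ha hij (by omega)
      have b2 := ih (j + 1) k (by omega) (by omega) hjk hk
      have b3 := hstep j (by omega) (by omega)
      have b4 := hdef i j k ha hij hjk.le hk
      have b5 := hdef j (j + 1) k (by omega) (by omega) hjk hk
      have p1 := mul_le_mul_of_nonneg_left (half (τ j - τ i) (by linarith) (by linarith))
        (mul_nonneg hc0 hD)
      have p2 := mul_le_mul_of_nonneg_left (half (τ k - τ (j + 1)) (by linarith) (by linarith))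
        (mul_nonneg hc0 hD)
      have p3 : D * (τ k - τ j) ^ (1 + θ) ≤ D * ℓ ^ (1 + θ) :=
        mul_le_mul_of_nonneg_left (Real.rpow_le_rpow (by linarith) (by linarith) (by linarith)) hD
      have e : J i k = J i j + J j (j + 1) + J (j + 1) k + (J i k - J i j - J j k) +
          (J j k - J j (j + 1) - J (j + 1) k) := by abel
      have tri : ‖J i k‖ ≤ ‖J i j‖ + ‖J j (j + 1)‖ + ‖J (j + 1) k‖ + ‖J i k - J i j - J j k‖ +
          ‖J j k - J j (j + 1) - J (j + 1) k‖ := by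
        conv_lhs => rw [e]
        refine (norm_add_le _ _).trans (add_le_add_left ((norm_add_le _ _).trans
          (add_le_add_left norm_add₃_le _)) _)
      -- The two halves contribute 2 · c · 2^{-(1+θ)} and the two defects contribute 2; `sewConst`
      -- is the fixed point of this recursion, which exists because θ > 0.
      have fin : c * D * ℓ ^ (1 + θ) = c * D * ((1 / 2) ^ (1 + θ) * ℓ ^ (1 + θ)) * 2 +
          2 * (D * ℓ ^ (1 + θ)) := by
        conv_lhs => rw [← hc]
        ring
      rw [fin]
      linarith
  exact fun i k ha hik hk => main (k - i) i k le_rfl ha hik hk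

variable {d k : ℕ} {α l T M : ℝ} {b : ℝ → Eucl d → Eucl d}
  {σ : ℝ → Eucl d → Matrix (Fin d) (Fin k) ℝ} {g : ℝ → Eucl k} {K : ℝ → Set (Eucl d)}

/-- The remainder of the first order expansion between two points of space-time. -/
def remainder (b : ℝ → Eucl d → Eucl d) (σ : ℝ → Eucl d → Matrix (Fin d) (Fin k) ℝ)
    (g : ℝ → Eucl k) (r : ℝ) (x : Eucl d) (s : ℝ) (y : Eucl d) : Eucl d :=
  y - x - (s - r) • b r x - mulVecE (σ r x) (g s - g r)

theorem remainder_self (r : ℝ) (x : Eucl d) : remainder b σ g r x r x = 0 := by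
  ext i; simp [remainder, mulVecE]

/-- A finite chain of points in the tube, with mesh at most `ε` and cumulative errors `w`. -/
structure IsTubeChain (T : ℝ) (b : ℝ → Eucl d → Eucl d)
    (σ : ℝ → Eucl d → Matrix (Fin d) (Fin k) ℝ) (g : ℝ → Eucl k) (K : ℝ → Set (Eucl d)) (ε : ℝ)
    (n : ℕ) (τ : ℕ → ℝ) (X : ℕ → Eucl d) (w : ℕ → ℝ) : Prop where
  time_mem : ∀ i ≤ n, τ i ∈ Icc 0 T
  mem : ∀ i ≤ n, X i ∈ K (τ i)
  lt_succ : ∀ i < n, τ i < τ (i + 1)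
  mesh : ∀ i < n, τ (i + 1) - τ i ≤ ε
  step : ∀ i < n, ‖remainder b σ g (τ i) (X i) (τ (i + 1)) (X (i + 1))‖ ≤ w (i + 1) - w i
  err_le : ∀ i < n, w (i + 1) - w i ≤ τ (i + 1) - τ i

variable {ε : ℝ} {n : ℕ} {τ : ℕ → ℝ} {X : ℕ → Eucl d} {w : ℕ → ℝ}

theorem IsTubeChain.time_lt (hc : IsTubeChain T b σ g K ε n τ X w) {i j : ℕ} (hij : i < j)
    (hj : j ≤ n) : τ i < τ j := by
  induction j, hij using Nat.le_induction with
  | base => exact hc.lt_succ i hj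
  | succ j hij ih => exact (ih (by omega)).trans (hc.lt_succ j hj)

theorem IsTubeChain.time_le (hc : IsTubeChain T b σ g K ε n τ X w) {i j : ℕ} (hij : i ≤ j)
    (hj : j ≤ n) : τ i ≤ τ j := by
  rcases hij.eq_or_lt with rfl | h
  · exact le_rfl
  · exact (hc.time_lt h hj).le

/-- Times along a chain are distinct, so the chain is the restriction of a function of time. This
lets `exists_holder_window` treat chains and solutions alike. -/
theorem IsTubeChain.exists_path (hc : IsTubeChain T b σ g K ε n τ X w) :
    ∃ Z : ℝ → Eucl d, ∀ i ≤ n, Z (τ i) = X i := by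
  classical
  refine ⟨fun u => if h : ∃ i, i ≤ n ∧ τ i = u then X h.choose else 0, fun i hi => ?_⟩
  have h : ∃ j, j ≤ n ∧ τ j = τ i := ⟨i, hi, rfl⟩
  refine (dif_pos h).trans ?_
  obtain ⟨h1, h2⟩ := h.choose_spec
  congr 1
  rcases lt_trichotomy h.choose i with h3 | h3 | h3
  · exact absurd h2 (hc.time_lt h3 hi).ne
  · exact h3
  · exact absurd h2 (hc.time_lt h3 h1).ne'

/-- Finitely many ratios have a finite sum. The constant depends on the chain and serves only to
start the bootstrap. -/
theorem exists_holder_const_of_finite {E : Type*} [NormedAddCommGroup E] (n : ℕ) (τ : ℕ → ℝ)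
    (X : ℕ → E) {η : ℝ} :
    ∃ A, 0 ≤ A ∧ ∀ i ≤ n, ∀ j ≤ n, τ i < τ j → ‖X j - X i‖ ≤ A * (τ j - τ i) ^ η := by
  refine ⟨∑ i ∈ Finset.range (n + 1), ∑ j ∈ Finset.range (n + 1), ‖X j - X i‖ / |τ j - τ i| ^ η,
    by positivity, fun i hi j hj hij => ?_⟩
  have hpos : 0 < (τ j - τ i) ^ η := Real.rpow_pos_of_pos (sub_pos.2 hij) _
  rw [← div_le_iff₀ hpos]
  have h1 : ‖X j - X i‖ / |τ j - τ i| ^ η ≤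
      ∑ j ∈ Finset.range (n + 1), ‖X j - X i‖ / |τ j - τ i| ^ η :=
    Finset.single_le_sum (f := fun j => ‖X j - X i‖ / |τ j - τ i| ^ η)
      (fun j _ => by positivity) (Finset.mem_range.2 (Nat.lt_succ_of_le hj))
  have h2 : ∑ j ∈ Finset.range (n + 1), ‖X j - X i‖ / |τ j - τ i| ^ η ≤
      ∑ i ∈ Finset.range (n + 1), ∑ j ∈ Finset.range (n + 1), ‖X j - X i‖ / |τ j - τ i| ^ η :=
    Finset.single_le_sum
      (f := fun i => ∑ j ∈ Finset.range (n + 1), ‖X j - X i‖ / |τ j - τ i| ^ η)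
      (fun i _ => by positivity) (Finset.mem_range.2 (Nat.lt_succ_of_le hi))
  rw [abs_of_pos (sub_pos.2 hij)] at h1
  exact h1.trans h2

/-- Chains are Hölder on windows of uniform length, with a uniform constant. -/
theorem YoungSystem.exists_chain_window (hs : YoungSystem α l T M b σ g) :
    ∃ h K₀ : ℝ, 0 < h ∧ h ≤ 1 ∧ 0 ≤ K₀ ∧ ∀ (K : ℝ → Set (Eucl d)) (ε : ℝ) (n : ℕ) (τ : ℕ → ℝ)
      (X : ℕ → Eucl d) (w : ℕ → ℝ), IsTubeChain T b σ g K ε n τ X w →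
      ∀ a i j, a ≤ i → i ≤ j → j ≤ n → τ j ≤ τ a + h →
        ‖X j - X i‖ ≤ K₀ * (1 + ‖X a‖) * (τ j - τ i) ^ (1 - α) := by
  have hM := hs.M_nonneg
  have hθ : 0 < l - α := sub_pos.2 hs.alpha_lt
  have hl0 := hs.alpha_pos.trans hs.alpha_lt
  have hsc := (sewConst_spec hθ).1
  obtain ⟨h, K₀, h0, hh1, hK, hw⟩ := hs.exists_holder_window (c := sewConst (l - α) * (M * M))
    (by positivity)
  refine ⟨h, K₀, h0, hh1, hK, fun K ε n τ X w hc a i j hai hij hj hjh => ?_⟩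
  obtain ⟨Z, hZ⟩ := hc.exists_path
  set S : Set ℝ := {u | ∃ p, a ≤ p ∧ p ≤ n ∧ τ p ≤ τ a + h ∧ τ p = u} with hS
  have han : a ≤ n := by omega
  have hidx : ∀ {p q}, p ≤ n → q ≤ n → τ p ≤ τ q → p ≤ q := fun {p q} hp hq hpq => by
    by_contra hcon
    exact (hc.time_lt (not_le.1 hcon) hp).not_ge hpq
  have hval : ∀ {A : ℝ}, HolderWithOn A (1 - α) S Z → ∀ p q, a ≤ p → p ≤ q → q ≤ n → τ q ≤ τ a + h →
      ‖X q - X p‖ ≤ A * (τ q - τ p) ^ (1 - α) := by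
    intro A hA p q hap hpq hqn hqh
    have := hA (τ p) ⟨p, hap, hpq.trans hqn, (hc.time_le hpq hqn).trans hqh, rfl⟩ (τ q)
      ⟨q, hap.trans hpq, hqn, hqh, rfl⟩ (hc.time_le hpq hqn)
    rwa [hZ p (hpq.trans hqn), hZ q hqn] at this
  have key : HolderWithOn (K₀ * (1 + ‖Z (τ a)‖)) (1 - α) S Z := by
    refine hw S (τ a) Z ?_ ?_ ⟨a, le_rfl, han, by linarith, rfl⟩ ?_ ?_
    · rintro u ⟨p, hp, hpn, hph, rfl⟩
      exact ⟨hc.time_le hp hpn, hph⟩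
    · rintro u ⟨p, hp, hpn, hph, rfl⟩
      exact hc.time_mem p hpn
    · obtain ⟨A, hA, hAH⟩ := exists_holder_const_of_finite n τ X (η := 1 - α)
      refine ⟨A, hA, ?_⟩
      rintro u ⟨p, hp, hpn, hph, rfl⟩ v ⟨q, hq, hqn, hqh, rfl⟩ huv
      rw [hZ p hpn, hZ q hqn]
      rcases huv.eq_or_lt with h' | h'
      · obtain rfl : p = q := le_antisymm (hidx hpn hqn h'.le) (hidx hqn hpn h'.ge)
        simp only [sub_self, norm_zero]; rw [Real.zero_rpow hs.one_sub_pos.ne', mul_zero]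
      · exact hAH p hpn q hqn h'
    · intro A hA hAH u hu v hv huv
      obtain ⟨p, hp, hpn, hph, rfl⟩ := hu
      obtain ⟨q, hq, hqn, hqh, rfl⟩ := hv
      have hpq := hidx hpn hqn huv
      have hv := hval hAH
      rw [hZ p hpn, hZ q hqn, hZ a han]
      set N := ‖X a‖ + A * h ^ (1 - α) with hN
      have hbd : ∀ e, a ≤ e → e ≤ n → τ e ≤ τ a + h → ‖X e‖ ≤ N := by
        intro e hae hen heh
        have q1 := hv a e le_rfl hae hen heh
        have q2 : (τ e - τ a) ^ (1 - α) ≤ h ^ (1 - α) :=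
          Real.rpow_le_rpow (sub_nonneg.2 (hc.time_le hae hen)) (by linarith) hs.one_sub_pos.le
        have q3 := norm_le_norm_add_norm_sub' (X e) (X a)
        have := mul_le_mul_of_nonneg_left q2 hA
        linarith
      have hN0 : 0 ≤ N := by have := Real.rpow_nonneg h0.le (1 - α); positivity
      -- The drift is left out of J and put in the additive control w: a step costs at most M(1+N)
      -- per unit time for the drift and, by `err_le`, at most 1 for the chain error. The defect of
      -- J is (σ_j - σ_i)(g_m - g_j), of order l + (1-α) > 1.
      have sew := discrete_sewing (a := p) (n := q) (τ := τ) (D := M * M * (1 + A))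
        (w := fun i => (1 + M * (1 + N)) * τ i)
        (J := fun i j => X j - X i - mulVecE (σ (τ i) (X i)) (g (τ j) - g (τ i)))
        hθ (by positivity) ?_ ?_ ?_ ?_ p q le_rfl hpq le_rfl
      · refine sew.trans (le_of_eq ?_)
        rw [show 1 + l - α = 1 + (l - α) by ring]; ring
      · exact fun i j hi hij hj => hc.time_lt hij (hj.trans hqn)
      · intro i
        ext t; simp [mulVecE]
      · intro i hi hiq
        have hin : i < n := by omega
        have e : X (i + 1) - X i - mulVecE (σ (τ i) (X i)) (g (τ (i + 1)) - g (τ i)) =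
            remainder b σ g (τ i) (X i) (τ (i + 1)) (X (i + 1)) +
              (τ (i + 1) - τ i) • b (τ i) (X i) := by
          rw [remainder]; abel
        rw [e]
        have hΔ := sub_nonneg.2 (hc.lt_succ i hin).le
        have hiw : τ i ≤ τ a + h := (hc.time_le hiq.le hqn).trans hqh
        have hb : ‖(τ (i + 1) - τ i) • b (τ i) (X i)‖ ≤ (τ (i + 1) - τ i) * (M * (1 + N)) := by
          rw [norm_smul, Real.norm_of_nonneg hΔ]
          refine mul_le_mul_of_nonneg_left ((hs.b_growth _ (hc.time_mem i hin.le) _).trans ?_) hΔ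
          exact mul_le_mul_of_nonneg_left (by linarith [hbd i (by omega) hin.le hiw]) hM
        have h1 := (hc.step i hin).trans (hc.err_le i hin)
        refine (norm_add_le _ _).trans ((add_le_add h1 hb).trans_eq ?_)
        ring
      · intro i j m hi hij hjm hmq
        have hmn : m ≤ n := hmq.trans hqn
        have hjn : j ≤ n := hjm.trans hmn
        have hin : i ≤ n := hij.trans hjn
        have hmh : τ m ≤ τ a + h := (hc.time_le hmq hqn).trans hqh
        have hjh : τ j ≤ τ a + h := (hc.time_le hjm hmn).trans hmh
        have t1 := hc.time_le hij hjn
        have t2 := hc.time_le hjm hmn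
        have t3 := hc.time_le (hp.trans hi) hin
        have e : X m - X i - mulVecE (σ (τ i) (X i)) (g (τ m) - g (τ i)) -
            (X j - X i - mulVecE (σ (τ i) (X i)) (g (τ j) - g (τ i))) -
            (X m - X j - mulVecE (σ (τ j) (X j)) (g (τ m) - g (τ j))) =
            mulVecE (σ (τ j) (X j) - σ (τ i) (X i)) (g (τ m) - g (τ j)) := by
          have : mulVecE (σ (τ i) (X i)) (g (τ m) - g (τ j)) =
            mulVecE (σ (τ i) (X i)) (g (τ m) - g (τ i)) -
              mulVecE (σ (τ i) (X i)) (g (τ j) - g (τ i)) := by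
            rw [← mulVecE_sub_right, sub_sub_sub_cancel_right]
          rw [mulVecE_sub_left, this]; abel
        rw [e]
        have s1 : frob (σ (τ j) (X j) - σ (τ i) (X i)) ≤ M * (1 + A) * (τ m - τ i) ^ l := by
          refine (hs.sigma_lipschitz _ (hc.time_mem j hjn) _ (hc.time_mem i hin) _ _).trans ?_
          rw [mul_assoc]
          refine mul_le_mul_of_nonneg_left ?_ hM
          rw [abs_of_nonneg (sub_nonneg.2 t1)]
          have q1 := hv i j (hp.trans hi) hij hjn hjh
          have q2 := rpow_le_rpow_of_le_one (sub_nonneg.2 t1) (by linarith) hl0 hs.l_le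
          have q3 : (τ j - τ i) ^ l ≤ (τ m - τ i) ^ l :=
            Real.rpow_le_rpow (sub_nonneg.2 t1) (by linarith) hl0.le
          have := mul_le_mul_of_nonneg_left (q2.trans q3) hA
          linarith
        have s2 : ‖g (τ m) - g (τ j)‖ ≤ M * (τ m - τ i) ^ (1 - α) := by
          refine (hs.g_holder _ (hc.time_mem m hmn) _ (hc.time_mem j hjn)).trans ?_
          rw [abs_of_nonneg (sub_nonneg.2 t2)]
          exact mul_le_mul_of_nonneg_left
            (Real.rpow_le_rpow (sub_nonneg.2 t2) (by linarith) hs.one_sub_pos.le) hM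
        have t4 : 0 ≤ τ m - τ i := by linarith
        refine (norm_mulVecE_le _ _).trans ((mul_le_mul s1 s2 (norm_nonneg _)
          (mul_nonneg (by positivity) (Real.rpow_nonneg t4 _))).trans_eq ?_)
        rw [show 1 + (l - α) = l + (1 - α) by ring, Real.rpow_add_of_nonneg t4 hl0.le
          hs.one_sub_pos.le]
        ring
  rw [hZ a han] at key
  exact hval key i j hai hij hj hjh

end

/-! ### Bounds for chains on the whole interval, and concatenation. -/

section

variable {d k : ℕ} {α l T M : ℝ} {b : ℝ → Eucl d → Eucl d}
  {σ : ℝ → Eucl d → Matrix (Fin d) (Fin k) ℝ} {g : ℝ → Eucl k} {K : ℝ → Set (Eucl d)}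

/-- Each stretch of time h/2 multiplies 1 + |X| by at most 1 + K₀. Chain times need not meet the
grid, but with mesh at most h/2 the last chain time before a grid point is within h of every time up
to the next one. -/
theorem IsTubeChain.exists_norm_bound {ε h K₀ : ℝ} {n : ℕ} {τ : ℕ → ℝ} {X : ℕ → Eucl d} {w : ℕ → ℝ}
    (hc : IsTubeChain T b σ g K ε n τ X w) (hα : 0 ≤ 1 - α) (h0 : 0 < h) (hh1 : h ≤ 1) (hK : 0 ≤ K₀)
    (hε : ε ≤ h / 2)
    (hw : ∀ a i j, a ≤ i → i ≤ j → j ≤ n → τ j ≤ τ a + h →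
        ‖X j - X i‖ ≤ K₀ * (1 + ‖X a‖) * (τ j - τ i) ^ (1 - α)) (p : ℕ) :
    ∀ j ≤ n, τ j ≤ τ 0 + p * (h / 2) → 1 + ‖X j‖ ≤ (1 + K₀) ^ p * (1 + ‖X 0‖) := by
  induction p with
  | zero =>
    intro j hj hjp
    rcases Nat.eq_zero_or_pos j with rfl | h'
    · simp
    · have := hc.time_lt h' hj
      simp at hjp; linarith
  | succ p ih =>
    intro j hj hjp
    push_cast at hjp
    have hpow : 0 ≤ (1 + K₀) ^ p * (1 + ‖X 0‖) := by positivity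
    by_cases hcase : τ j ≤ τ 0 + p * (h / 2)
    · refine (ih j hj hcase).trans ?_
      rw [pow_succ]; nlinarith
    · obtain ⟨i, -, hij, hi1, hi2⟩ := exists_switch (P := fun i => τ i ≤ τ 0 + p * (h / 2))
        (Nat.zero_le j) (by have : 0 ≤ p * (h / 2) := by positivity
                            linarith) hcase
      have hmesh := hc.mesh i (by omega)
      have hji : τ j ≤ τ i + h := by linarith
      have h1 := hw i i j le_rfl hij.le hj hji
      have h2 : (τ j - τ i) ^ (1 - α) ≤ 1 :=
        Real.rpow_le_one (sub_nonneg.2 (hc.time_le hij.le hj)) (by linarith) hα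
      have h3 := mul_le_of_le_one_right (by positivity : 0 ≤ K₀ * (1 + ‖X i‖)) h2
      have h4 := norm_le_norm_add_norm_sub' (X j) (X i)
      have h5 := ih i (by omega) hi1
      have h6 := mul_le_mul_of_nonneg_left h5 (by linarith : 0 ≤ 1 + K₀)
      rw [pow_succ]
      nlinarith

/-- Uniform bounds for the chains that start in a given ball. -/
theorem YoungSystem.exists_chain_bounds (hs : YoungSystem α l T M b σ g) :
    ∃ η : ℝ, 0 < η ∧ ∀ R₀ : ℝ, 0 ≤ R₀ → ∃ Rb A C : ℝ, 0 ≤ Rb ∧ 0 ≤ A ∧ 0 ≤ C ∧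
      ∀ (K : ℝ → Set (Eucl d)) (ε : ℝ) (n : ℕ) (τ : ℕ → ℝ) (X : ℕ → Eucl d) (w : ℕ → ℝ),
        ε ≤ η → IsTubeChain T b σ g K ε n τ X w → ‖X 0‖ ≤ R₀ →
        (∀ i ≤ n, ‖X i‖ ≤ Rb) ∧
        (∀ i j, i ≤ j → j ≤ n → ‖X j - X i‖ ≤ A * (τ j - τ i) ^ (1 - α)) ∧
        ∀ i j, i ≤ j → j ≤ n → ‖remainder b σ g (τ i) (X i) (τ j) (X j)‖ ≤
          w j - w i + C * (τ j - τ i) ^ (1 + (l - α)) := by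
  have hM := hs.M_nonneg
  have hθ : 0 < l - α := sub_pos.2 hs.alpha_lt
  have hl0 := hs.alpha_pos.trans hs.alpha_lt
  have ha := hs.one_sub_pos
  have hT := hs.T_pos
  have hsc := (sewConst_spec hθ).1
  obtain ⟨h, K₀, h0, hh1, hK, hw⟩ := hs.exists_chain_window
  refine ⟨h / 2, by positivity, fun R₀ hR₀ => ?_⟩
  obtain ⟨p, hp⟩ := exists_nat_ge (T / (h / 2))
  rw [div_le_iff₀ (by positivity)] at hp
  set Rb := (1 + K₀) ^ p * (1 + R₀) with hRb
  have hRb0 : 0 ≤ Rb := by positivity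
  -- The first term serves pairs within one window; for pairs further apart than h, the trivial
  -- bound 2 Rb is divided by h^{1-α}.
  set A := K₀ * (1 + Rb) + 2 * Rb / h ^ (1 - α) with hA
  have hhp : 0 < h ^ (1 - α) := Real.rpow_pos_of_pos h0 _
  have hA0 : 0 ≤ A := by positivity
  obtain ⟨L, hL, hlip⟩ := hs.b_lipschitz Rb hRb0
  -- Time differences are now bounded by T only: c₁ lowers the exponent 1 + (1-α) of the drift
  -- defect to 1 + (l-α), and c₂ lowers 1-α to l.
  set c₁ := (1 + T) ^ (1 + (1 - α) - (1 + (l - α))) with hc₁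
  set c₂ := (1 + T) ^ (1 - α - l) with hc₂
  have hc₁0 : 0 ≤ c₁ := Real.rpow_nonneg (by linarith) _
  have hc₂0 : 0 ≤ c₂ := Real.rpow_nonneg (by linarith) _
  set D := L * (1 + A) * c₁ + M * M * (1 + A * c₂) with hD
  have hD0 : 0 ≤ D := by positivity
  refine ⟨Rb, A, sewConst (l - α) * D, hRb0, hA0, by positivity, ?_⟩
  intro K ε n τ X w hε hc hX0
  have hTτ : ∀ i j, i ≤ n → j ≤ n → τ j - τ i ≤ T := fun i j hi hj => by
    linarith [(hc.time_mem i hi).1, (hc.time_mem j hj).2]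
  have hbd : ∀ i ≤ n, ‖X i‖ ≤ Rb := by
    intro i hi
    have h1 := hc.exists_norm_bound ha.le h0 hh1 hK hε (hw K ε n τ X w hc) p i hi
      (by linarith [hTτ 0 i (Nat.zero_le _) hi])
    have h2 : (1 + K₀) ^ p * (1 + ‖X 0‖) ≤ Rb := by rw [hRb]; gcongr
    linarith
  have hhol : ∀ i j, i ≤ j → j ≤ n → ‖X j - X i‖ ≤ A * (τ j - τ i) ^ (1 - α) := by
    intro i j hij hj
    have ht := sub_nonneg.2 (hc.time_le hij hj)
    have htp : 0 ≤ (τ j - τ i) ^ (1 - α) := Real.rpow_nonneg ht _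
    by_cases hcase : τ j ≤ τ i + h
    · refine (hw K ε n τ X w hc i i j le_rfl hij hj hcase).trans ?_
      refine mul_le_mul_of_nonneg_right ?_ htp
      have : K₀ * (1 + ‖X i‖) ≤ K₀ * (1 + Rb) := by
        have := hbd i (hij.trans hj); gcongr
      have : 0 ≤ 2 * Rb / h ^ (1 - α) := by positivity
      linarith
    · have h1 : h ^ (1 - α) ≤ (τ j - τ i) ^ (1 - α) :=
        Real.rpow_le_rpow h0.le (by linarith) ha.le
      have h2 : ‖X j - X i‖ ≤ 2 * Rb := (norm_sub_le _ _).trans (by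
        linarith [hbd i (hij.trans hj), hbd j hj])
      have h3 : 2 * Rb ≤ 2 * Rb / h ^ (1 - α) * (τ j - τ i) ^ (1 - α) := by
        rw [div_mul_eq_mul_div, le_div_iff₀ hhp]
        exact mul_le_mul_of_nonneg_left h1 (by positivity)
      have h4 : 0 ≤ K₀ * (1 + Rb) * (τ j - τ i) ^ (1 - α) := by positivity
      rw [hA, add_mul]
      linarith
  refine ⟨hbd, hhol, fun i j hij hj => ?_⟩
  refine discrete_sewing (a := 0) (n := n) (τ := τ) (D := D) (w := w)
    (J := fun i j => remainder b σ g (τ i) (X i) (τ j) (X j)) hθ hD0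
    (fun i j _ hij hj => hc.time_lt hij hj) (fun i => remainder_self _ _)
    (fun i _ hi => hc.step i hi) ?_ i j (Nat.zero_le i) hij hj
  intro i j m _ hij hjm hmn
  have hjn := hjm.trans hmn
  have hin := hij.trans hjn
  have t1 := sub_nonneg.2 (hc.time_le hij hjn)
  have t2 := sub_nonneg.2 (hc.time_le hjm hmn)
  have t3 : 0 ≤ τ m - τ i := by linarith
  have e : remainder b σ g (τ i) (X i) (τ m) (X m) - remainder b σ g (τ i) (X i) (τ j) (X j) -
      remainder b σ g (τ j) (X j) (τ m) (X m) =
      (τ m - τ j) • (b (τ j) (X j) - b (τ i) (X i)) +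
      mulVecE (σ (τ j) (X j) - σ (τ i) (X i)) (g (τ m) - g (τ j)) := by
    have h1 : mulVecE (σ (τ i) (X i)) (g (τ m) - g (τ j)) =
      mulVecE (σ (τ i) (X i)) (g (τ m) - g (τ i)) -
        mulVecE (σ (τ i) (X i)) (g (τ j) - g (τ i)) := by
      rw [← mulVecE_sub_right, sub_sub_sub_cancel_right]
    simp only [remainder]
    rw [mulVecE_sub_left, h1]
    module
  set P := (τ m - τ i) ^ (1 - α) with hP
  have hP0 : 0 ≤ P := Real.rpow_nonneg t3 _
  have hji : (τ j - τ i) ^ (1 - α) ≤ P := Real.rpow_le_rpow t1 (by linarith) ha.le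
  have hX1 : ‖X j - X i‖ ≤ A * P := (hhol i j hij hjn).trans (mul_le_mul_of_nonneg_left hji hA0)
  have s0 : ‖(τ m - τ j) • (b (τ j) (X j) - b (τ i) (X i))‖ ≤ (τ m - τ i) * (L * ((1 + A) * P)) := by
    rw [norm_smul, Real.norm_of_nonneg t2]
    refine mul_le_mul (by linarith) ?_ (norm_nonneg _) t3
    refine (hlip _ (hc.time_mem j hjn) _ (hc.time_mem i hin) _ _ (hbd j hjn) (hbd i hin)).trans ?_
    rw [abs_of_nonneg t1]
    exact mul_le_mul_of_nonneg_left (by linarith) hL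
  have s1 : frob (σ (τ j) (X j) - σ (τ i) (X i)) ≤ M * ((1 + A * c₂) * (τ m - τ i) ^ l) := by
    refine (hs.sigma_lipschitz _ (hc.time_mem j hjn) _ (hc.time_mem i hin) _ _).trans ?_
    refine mul_le_mul_of_nonneg_left ?_ hM
    rw [abs_of_nonneg t1]
    have q2 : P ≤ c₂ * (τ m - τ i) ^ l := rpow_le_mul_rpow t3 (hTτ i m hin hmn) hl0 hs.l_le
    have q3 : (τ j - τ i) ^ l ≤ (τ m - τ i) ^ l := Real.rpow_le_rpow t1 (by linarith) hl0.le
    have := mul_le_mul_of_nonneg_left q2 hA0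
    linarith
  have s2 : ‖g (τ m) - g (τ j)‖ ≤ M * P := by
    refine (hs.g_holder _ (hc.time_mem m hmn) _ (hc.time_mem j hjn)).trans ?_
    rw [abs_of_nonneg t2]
    exact mul_le_mul_of_nonneg_left (Real.rpow_le_rpow t2 (by linarith) ha.le) hM
  have r1 : (τ m - τ i) * P ≤ c₁ * (τ m - τ i) ^ (1 + (l - α)) := by
    have := rpow_le_mul_rpow (p := 1 + (1 - α)) (q := 1 + (l - α)) t3 (hTτ i m hin hmn)
      (by linarith) (by linarith [hs.l_le, hs.alpha_pos])
    rwa [Real.rpow_add_of_nonneg t3 zero_le_one ha.le, Real.rpow_one] at this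
  have r2 : (τ m - τ i) ^ l * P = (τ m - τ i) ^ (1 + (l - α)) := by
    rw [hP, ← Real.rpow_add_of_nonneg t3 hl0.le ha.le]; congr 1; ring
  rw [e]
  refine (norm_add_le _ _).trans ?_
  have s3 := (norm_mulVecE_le (σ (τ j) (X j) - σ (τ i) (X i)) (g (τ m) - g (τ j))).trans
    (mul_le_mul s1 s2 (norm_nonneg _)
      (mul_nonneg hM (mul_nonneg (by positivity) (Real.rpow_nonneg t3 _))))
  have r3 := mul_le_mul_of_nonneg_left r1 (by positivity : 0 ≤ L * (1 + A))
  calc _ ≤ (τ m - τ i) * (L * ((1 + A) * P)) + M * ((1 + A * c₂) * (τ m - τ i) ^ l) * (M * P) :=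
        add_le_add s0 s3
    _ = L * (1 + A) * ((τ m - τ i) * P) + M * M * (1 + A * c₂) * ((τ m - τ i) ^ l * P) := by ring
    _ ≤ L * (1 + A) * (c₁ * (τ m - τ i) ^ (1 + (l - α))) +
        M * M * (1 + A * c₂) * (τ m - τ i) ^ (1 + (l - α)) := by
        rw [r2]; linarith
    _ = D * (τ m - τ i) ^ (1 + (l - α)) := by rw [hD]; ring

/-- There is a chain of total error `e` from `(s, y)` to `(s', y')`. -/
def ChainTo (T : ℝ) (b : ℝ → Eucl d → Eucl d)
    (σ : ℝ → Eucl d → Matrix (Fin d) (Fin k) ℝ) (g : ℝ → Eucl k) (K : ℝ → Set (Eucl d)) (ε : ℝ)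
    (s : ℝ) (y : Eucl d) (s' : ℝ) (y' : Eucl d) (e : ℝ) : Prop :=
  ∃ n τ X w, IsTubeChain T b σ g K ε n τ X w ∧ τ 0 = s ∧ X 0 = y ∧ τ n = s' ∧ X n = y' ∧
    w n - w 0 = e

variable {ε : ℝ}

/-- Concatenation of the sequences `f` (up to index `n`) and `f'`. -/
def seqJoin {β : Type*} (n : ℕ) (f f' : ℕ → β) (i : ℕ) : β := if i ≤ n then f i else f' (i - n)

theorem seqJoin_of_le {β : Type*} {n i : ℕ} (f f' : ℕ → β) (h : i ≤ n) :
    seqJoin n f f' i = f i := if_pos h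

theorem seqJoin_add {β : Type*} {n : ℕ} {f f' : ℕ → β} (h0 : f' 0 = f n) (i : ℕ) :
    seqJoin n f f' (n + i) = f' i := by
  rw [seqJoin]
  split_ifs with h
  · obtain rfl : i = 0 := by omega
    exact h0.symm
  · rw [Nat.add_sub_cancel_left]

theorem forall_le_add {P : ℕ → Prop} {n n' : ℕ} (h : ∀ i ≤ n, P i) (h' : ∀ i ≤ n', P (n + i)) :
    ∀ i ≤ n + n', P i := by
  intro i hi
  rcases le_total i n with hn | hn
  · exact h i hn
  · obtain ⟨p, rfl⟩ := Nat.exists_eq_add_of_le hn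
    exact h' p (by omega)

theorem forall_lt_add {P : ℕ → Prop} {n n' : ℕ} (h : ∀ i < n, P i) (h' : ∀ i < n', P (n + i)) :
    ∀ i < n + n', P i := by
  intro i hi
  rcases lt_or_ge i n with hn | hn
  · exact h i hn
  · obtain ⟨p, rfl⟩ := Nat.exists_eq_add_of_le hn
    exact h' p (by omega)

theorem ChainTo.trans {s s' s'' e e' : ℝ} {y y' y'' : Eucl d}
    (h : ChainTo T b σ g K ε s y s' y' e) (h' : ChainTo T b σ g K ε s' y' s'' y'' e') :
    ChainTo T b σ g K ε s y s'' y'' (e + e') := by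
  obtain ⟨n, τ, X, w, hc, h1, h2, h3, h4, h5⟩ := h
  obtain ⟨n', τ', X', w', hc', h1', h2', h3', h4', h5'⟩ := h'
  have jt := seqJoin_add (h1'.trans h3.symm)
  have jx := seqJoin_add (h2'.trans h4.symm)
  -- The cumulative error of the second chain is shifted to start where the first one ends; only its
  -- increments matter.
  have jw := seqJoin_add (f := w) (n := n) (f' := fun i => w n - w' 0 + w' i) (sub_add_cancel _ _)
  have lt := fun i (h : i ≤ n) => seqJoin_of_le τ τ' h
  have lx := fun i (h : i ≤ n) => seqJoin_of_le X X' h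
  have lw := fun i (h : i ≤ n) => seqJoin_of_le w (fun i => w n - w' 0 + w' i) h
  refine ⟨n + n', seqJoin n τ τ', seqJoin n X X', seqJoin n w fun i => w n - w' 0 + w' i,
    ⟨forall_le_add ?_ ?_, forall_le_add ?_ ?_, forall_lt_add ?_ ?_, forall_lt_add ?_ ?_,
      forall_lt_add ?_ ?_, forall_lt_add ?_ ?_⟩, ?_, ?_, ?_, ?_, ?_⟩
  · intro i hi; rw [lt i hi]; exact hc.time_mem i hi
  · intro i hi; rw [jt i]; exact hc'.time_mem i hi
  · intro i hi; rw [lt i hi, lx i hi]; exact hc.mem i hi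
  · intro i hi; rw [jt i, jx i]; exact hc'.mem i hi
  · intro i hi; rw [lt i hi.le, lt (i + 1) hi]; exact hc.lt_succ i hi
  · intro i hi; rw [add_assoc, jt i, jt (i + 1)]; exact hc'.lt_succ i hi
  · intro i hi; rw [lt i hi.le, lt (i + 1) hi]; exact hc.mesh i hi
  · intro i hi; rw [add_assoc, jt i, jt (i + 1)]; exact hc'.mesh i hi
  · intro i hi
    rw [lt i hi.le, lt (i + 1) hi, lx i hi.le, lx (i + 1) hi, lw i hi.le, lw (i + 1) hi]
    exact hc.step i hi
  · intro i hi
    rw [add_assoc, jt i, jt (i + 1), jx i, jx (i + 1), jw i, jw (i + 1), add_sub_add_left_eq_sub]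
    exact hc'.step i hi
  · intro i hi
    rw [lt i hi.le, lt (i + 1) hi, lw i hi.le, lw (i + 1) hi]
    exact hc.err_le i hi
  · intro i hi
    rw [add_assoc, jt i, jt (i + 1), jw i, jw (i + 1), add_sub_add_left_eq_sub]
    exact hc'.err_le i hi
  · rw [lt 0 (Nat.zero_le n), h1]
  · rw [lx 0 (Nat.zero_le n), h2]
  · rw [jt n', h3']
  · rw [jx n', h4']
  · rw [jw n', lw 0 (Nat.zero_le n), ← h5, ← h5']; ring

theorem chainTo_of_step {s s' e : ℝ} {y y' : Eucl d} (hs : s ∈ Icc 0 T) (hs' : s' ∈ Icc 0 T)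
    (hss' : s < s') (hy : y ∈ K s) (hy' : y' ∈ K s') (hε : s' - s ≤ ε)
    (hr : ‖remainder b σ g s y s' y'‖ ≤ e) (he : e ≤ s' - s) :
    ChainTo T b σ g K ε s y s' y' e := by
  refine ⟨1, fun i => if i = 0 then s else s', fun i => if i = 0 then y else y',
    fun i => if i = 0 then 0 else e, ⟨?_, ?_, ?_, ?_, ?_, ?_⟩, by simp, by simp, by simp, by simp,
    by simp⟩
  · intro i _; split_ifs <;> assumption
  · intro i _; split_ifs <;> assumption
  all_goals
    intro i hi
    obtain rfl : i = 0 := by omega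
    simp only [zero_add, one_ne_zero, if_true, if_false, sub_zero]
    assumption

end

/-! ### Chains of small error rate reach the terminal time. -/

section

variable {d k : ℕ} {α l T M : ℝ} {b : ℝ → Eucl d → Eucl d}
  {σ : ℝ → Eucl d → Matrix (Fin d) (Fin k) ℝ} {g : ℝ → Eucl k} {K : ℝ → Set (Eucl d)} {ε : ℝ}

theorem tendsto_mulVecE {ι : Type*} {F : Filter ι} {A : ι → Matrix (Fin d) (Fin k) ℝ}
    {A₀ : Matrix (Fin d) (Fin k) ℝ} {v : ι → Eucl k} {v₀ : Eucl k}
    (hA : Tendsto (fun i => frob (A i - A₀)) F (𝓝 0)) (hv : Tendsto v F (𝓝 v₀)) :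
    Tendsto (fun i => mulVecE (A i) (v i)) F (𝓝 (mulVecE A₀ v₀)) := by
  rw [tendsto_iff_norm_sub_tendsto_zero]
  have h1 : Tendsto (fun i => frob (A i - A₀) * ‖v i‖ + frob A₀ * ‖v i - v₀‖) F (𝓝 0) := by
    have := (hA.mul hv.norm).add ((tendsto_iff_norm_sub_tendsto_zero.1 hv).const_mul (frob A₀))
    simpa using this
  refine squeeze_zero (fun _ => norm_nonneg _) (fun i => ?_) h1
  have e : mulVecE (A i) (v i) - mulVecE A₀ v₀ = mulVecE (A i - A₀) (v i) + mulVecE A₀ (v i - v₀) := by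
    rw [mulVecE_sub_left, mulVecE_sub_right]; abel
  rw [e]
  exact (norm_add_le _ _).trans (add_le_add (norm_mulVecE_le _ _) (norm_mulVecE_le _ _))

theorem tendsto_rpow_zero {ι : Type*} {F : Filter ι} {u : ι → ℝ} {p : ℝ} (hp : 0 < p)
    (hu : Tendsto u F (𝓝 0)) : Tendsto (fun i => u i ^ p) F (𝓝 0) := by
  have : ContinuousAt (fun x : ℝ => x ^ p) 0 := Real.continuousAt_rpow_const _ _ (Or.inr hp.le)
  have h2 := this.tendsto.comp hu
  simpa [Function.comp_def, Real.zero_rpow hp.ne'] using h2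

theorem YoungSystem.tendsto_g (hs : YoungSystem α l T M b σ g) {ι : Type*} {F : Filter ι}
    {s : ι → ℝ} {s₀ : ℝ} (hsT : ∀ i, s i ∈ Icc 0 T) (hs₀ : s₀ ∈ Icc 0 T) (h : Tendsto s F (𝓝 s₀)) :
    Tendsto (fun i => g (s i)) F (𝓝 (g s₀)) := by
  have hc : ContinuousOn g (Icc 0 T) := continuousOn_of_holder hs.one_sub_pos hs.g_holder
  exact (hc s₀ hs₀).tendsto.comp
    (tendsto_nhdsWithin_iff.2 ⟨h, Eventually.of_forall hsT⟩)

/-- `(s', y')` can be reached from `(s, y)` by a chain of error rate less than `ε`. -/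
def Reach (T : ℝ) (b : ℝ → Eucl d → Eucl d)
    (σ : ℝ → Eucl d → Matrix (Fin d) (Fin k) ℝ) (g : ℝ → Eucl k) (K : ℝ → Set (Eucl d)) (ε : ℝ)
    (s : ℝ) (y : Eucl d) (s' : ℝ) (y' : Eucl d) : Prop :=
  s < s' ∧ ∃ e, e < ε * (s' - s) ∧ ChainTo T b σ g K ε s y s' y' e

theorem Reach.trans {s s' s'' : ℝ} {y y' y'' : Eucl d} (h : Reach T b σ g K ε s y s' y')
    (h' : Reach T b σ g K ε s' y' s'' y'') : Reach T b σ g K ε s y s'' y'' := by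
  obtain ⟨h1, e, he, hc⟩ := h
  obtain ⟨h1', e', he', hc'⟩ := h'
  exact ⟨h1.trans h1', e + e', by linarith, hc.trans hc'⟩

theorem ChainTo.left_mem {s s' e : ℝ} {y y' : Eucl d} (h : ChainTo T b σ g K ε s y s' y' e) :
    s ∈ Icc 0 T ∧ y ∈ K s := by
  obtain ⟨n, τ, X, w, hc, rfl, rfl, rfl, rfl, rfl⟩ := h
  exact ⟨hc.time_mem 0 (Nat.zero_le n), hc.mem 0 (Nat.zero_le n)⟩

theorem ChainTo.right_mem {s s' e : ℝ} {y y' : Eucl d} (h : ChainTo T b σ g K ε s y s' y' e) :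
    s' ∈ Icc 0 T ∧ y' ∈ K s' := by
  obtain ⟨n, τ, X, w, hc, rfl, rfl, rfl, rfl, rfl⟩ := h
  exact ⟨hc.time_mem n le_rfl, hc.mem n le_rfl⟩

/-- The contingency correction Q is exactly the remainder of a single step, and it is O(v^{1+γ});
for small v it is below ε v / 2. The length v also respects the window, the mesh ε and the horizon
T. -/
theorem Contingent.exists_reach (hC : Contingent α T b σ g K) (hε : 0 < ε) (hε1 : ε ≤ 1) {s : ℝ}
    {y : Eucl d} (hs : s ∈ Icc 0 T) (hsT : s < T) (hy : y ∈ K s) :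
    ∃ s' y', Reach T b σ g K ε s y s' y' := by
  obtain ⟨G, G', γ, hG, hcon⟩ := hC
  obtain ⟨h, h0, Q, hQ, hmem⟩ := hcon s hs y hy
  obtain ⟨R, hR, hyR⟩ : ∃ R, 0 < R ∧ ‖y‖ ≤ R := ⟨‖y‖ + 1, by positivity, by linarith⟩
  obtain ⟨-, hG', hγ, -⟩ := hG R hR
  obtain ⟨u, hu0, -, hu⟩ := exists_small_rpow (c := G' R) hγ (half_pos hε)
  set v := min (min u h) (min ε (T - s)) with hv
  have hv0 : 0 < v := lt_min (lt_min hu0 h0) (lt_min hε (sub_pos.2 hsT))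
  have hvu : v ≤ u := (min_le_left _ _).trans (min_le_left _ _)
  have hvh : v ≤ h := (min_le_left _ _).trans (min_le_right _ _)
  have hvε : v ≤ ε := (min_le_right _ _).trans (min_le_left _ _)
  have hvT : v ≤ T - s := (min_le_right _ _).trans (min_le_right _ _)
  have hin : s + v ∈ Icc s (min (s + h) T) := ⟨by linarith, le_min (by linarith) (by linarith)⟩
  have hKv := hmem (s + v) hin
  have hQv := (hQ R hR hyR (s + v) hin (s + v) hin).2
  rw [add_sub_cancel_left, abs_of_pos hv0, Real.rpow_add hv0, Real.rpow_one] at hQv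
  have hQ2 : ‖Q (s + v)‖ ≤ ε / 2 * v := by
    have h1 : G' R * v ^ γ R ≤ ε / 2 :=
      (mul_le_mul_of_nonneg_left (Real.rpow_le_rpow hv0.le hvu hγ.le) hG'.le).trans hu
    have := mul_le_mul_of_nonneg_right h1 hv0.le
    linarith
  refine ⟨s + v, _, by linarith, ε / 2 * v, by nlinarith, chainTo_of_step hs
    ⟨by linarith [hs.1], by linarith⟩ (by linarith) hy hKv (by linarith) ?_ (by nlinarith)⟩
  have e : remainder b σ g s y (s + v)
      (y + (s + v - s) • b s y + mulVecE (σ s y) (g (s + v) - g s) + Q (s + v)) = Q (s + v) := by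
    rw [remainder]; abel
  rw [e]
  exact hQ2

theorem Reach.of_lt {s : ℕ → ℝ} {y : ℕ → Eucl d}
    (h : ∀ i, Reach T b σ g K ε (s i) (y i) (s (i + 1)) (y (i + 1))) {i j : ℕ} (hij : i < j) :
    Reach T b σ g K ε (s i) (y i) (s j) (y j) := by
  induction j, hij using Nat.le_induction with
  | base => exact h i
  | succ j _ ih => exact ih.trans (h j)

/-- Infinite sequences of reachable points converge to a reachable point. -/
theorem YoungSystem.reach_limit (hs : YoungSystem α l T M b σ g) (hK : LeftClosed T K)
    (hε : 0 < ε) (hε1 : ε ≤ 1 / 2)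
    (hbounds : ∀ R₀ : ℝ, 0 ≤ R₀ → ∃ Rb A C : ℝ, 0 ≤ Rb ∧ 0 ≤ A ∧ 0 ≤ C ∧
      ∀ (n : ℕ) (τ : ℕ → ℝ) (X : ℕ → Eucl d) (w : ℕ → ℝ),
        IsTubeChain T b σ g K ε n τ X w → ‖X 0‖ ≤ R₀ →
        (∀ i ≤ n, ‖X i‖ ≤ Rb) ∧
        (∀ i j, i ≤ j → j ≤ n → ‖X j - X i‖ ≤ A * (τ j - τ i) ^ (1 - α)) ∧
        ∀ i j, i ≤ j → j ≤ n → ‖remainder b σ g (τ i) (X i) (τ j) (X j)‖ ≤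
          w j - w i + C * (τ j - τ i) ^ (1 + (l - α)))
    {s : ℕ → ℝ} {y : ℕ → Eucl d}
    (h : ∀ i, Reach T b σ g K ε (s i) (y i) (s (i + 1)) (y (i + 1))) :
    ∃ s' y', Tendsto s atTop (𝓝 s') ∧ ∀ i, Reach T b σ g K ε (s i) (y i) s' y' := by
  have hθ : 0 < l - α := sub_pos.2 hs.alpha_lt
  have ha := hs.one_sub_pos
  have hmem : ∀ i, s i ∈ Icc 0 T ∧ y i ∈ K (s i) := fun i => by
    obtain ⟨-, e, -, hc⟩ := h i
    exact hc.left_mem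
  have hmono : StrictMono s := strictMono_nat_of_lt_succ fun i => (h i).1
  have hbdd : BddAbove (range s) := ⟨T, by rintro _ ⟨i, rfl⟩; exact (hmem i).1.2⟩
  set s' := ⨆ i, s i with hs'
  have hlim : Tendsto s atTop (𝓝 s') := tendsto_atTop_ciSup hmono.monotone hbdd
  have hlt : ∀ i, s i < s' := fun i => (hmono (Nat.lt_succ_self i)).trans_le (le_ciSup hbdd (i + 1))
  have hs'T : s' ∈ Icc 0 T := ⟨(hmem 0).1.1.trans (hlt 0).le, ciSup_le fun i => (hmem i).1.2⟩
  have hsub : Tendsto (fun i => s' - s i) atTop (𝓝 0) := by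
    have := hlim.const_sub s'
    rwa [sub_self] at this
  -- The bounds are used twice: from y 0, to confine the whole sequence to a ball of radius Rb; then
  -- with starting radius Rb, for constants A and C common to all pairs.
  obtain ⟨Rb, _, _, hRb, _, _, hB⟩ := hbounds ‖y 0‖ (norm_nonneg _)
  have hyb : ∀ i, ‖y i‖ ≤ Rb := by
    intro i
    obtain ⟨-, e', -, n', τ', X', w', hc', h1', h2', h3', h4', h5'⟩ := h 0
    rcases Nat.eq_zero_or_pos i with rfl | hi
    · rw [← h2']; exact (hB n' τ' X' w' hc' (by rw [h2'])).1 0 (Nat.zero_le _)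
    · obtain ⟨-, e, -, n, τ, X, w, hc, h1, h2, h3, h4, h5⟩ := Reach.of_lt h hi
      rw [← h4]; exact (hB n τ X w hc (by rw [h2])).1 n le_rfl
  obtain ⟨_, A, C, _, hA, hC, hB2⟩ := hbounds Rb hRb
  have hpair : ∀ i j, i < j → ‖y j - y i‖ ≤ A * (s j - s i) ^ (1 - α) ∧
      ‖remainder b σ g (s i) (y i) (s j) (y j)‖ ≤
        ε * (s j - s i) + C * (s j - s i) ^ (1 + (l - α)) := by
    intro i j hij
    obtain ⟨-, e, he, n, τ, X, w, hc, h1, h2, h3, h4, h5⟩ := Reach.of_lt h hij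
    obtain ⟨-, q1, q2⟩ := hB2 n τ X w hc (h2 ▸ hyb i)
    have q1' := q1 0 n (Nat.zero_le _) le_rfl
    have q2' := q2 0 n (Nat.zero_le _) le_rfl
    rw [h1, h2, h3, h4] at q1' q2'
    exact ⟨q1', by linarith⟩
  have hcau : CauchySeq y := by
    refine cauchySeq_of_le_tendsto_0 (fun N => A * (s' - s N) ^ (1 - α)) ?_ ?_
    · have key : ∀ n m N, N ≤ n → n < m → dist (y n) (y m) ≤ A * (s' - s N) ^ (1 - α) := by
        intro n m N hN hnm
        rw [dist_comm, dist_eq_norm]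
        refine (hpair n m hnm).1.trans (mul_le_mul_of_nonneg_left ?_ hA)
        refine Real.rpow_le_rpow (sub_nonneg.2 (hmono hnm).le) ?_ ha.le
        linarith [hmono.monotone hN, hlt m]
      intro n m N hn hm
      rcases lt_trichotomy n m with h' | rfl | h'
      · exact key n m N hn h'
      · rw [dist_self]
        exact mul_nonneg hA (Real.rpow_nonneg (sub_nonneg.2 (hlt N).le) _)
      · rw [dist_comm]; exact key m n N hm h'
    · simpa using (tendsto_rpow_zero ha hsub).const_mul A
  obtain ⟨y', hy'⟩ := cauchySeq_tendsto_of_complete hcau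
  have hyK : y' ∈ K s' := hK s' hs'T s y y' (fun n => ⟨(hmem n).1.1, hlt n⟩)
    (fun n => (hmem n).2) hlim hy'
  have hrem : ∀ i, ‖remainder b σ g (s i) (y i) s' y'‖ ≤
      ε * (s' - s i) + C * (s' - s i) ^ (1 + (l - α)) := by
    intro i
    have t1 : Tendsto (fun j => remainder b σ g (s i) (y i) (s j) (y j)) atTop
        (𝓝 (remainder b σ g (s i) (y i) s' y')) := by
      have tg := hs.tendsto_g (fun j => (hmem j).1) hs'T hlim
      have tm := tendsto_mulVecE (A := fun _ : ℕ => σ (s i) (y i)) (A₀ := σ (s i) (y i))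
        (by simp [frob_zero]) (tg.sub_const (g (s i)))
      exact ((hy'.sub_const (y i)).sub ((hlim.sub_const (s i)).smul_const _)).sub tm
    have t2 : Tendsto (fun j => ε * (s j - s i) + C * (s j - s i) ^ (1 + (l - α))) atTop
        (𝓝 (ε * (s' - s i) + C * (s' - s i) ^ (1 + (l - α)))) := by
      have t3 := hlim.sub_const (s i)
      exact (t3.const_mul ε).add ((t3.rpow_const (Or.inr (by linarith))).const_mul C)
    refine le_of_tendsto_of_tendsto t1.norm t2 ?_
    filter_upwards [eventually_gt_atTop i] with j hj using (hpair i j hj).2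
  refine ⟨s', y', hlim, fun i => ⟨hlt i, ?_⟩⟩
  obtain ⟨hi1, e₀, he₀, hc₀⟩ := h i
  -- The jump from (s j, y j) to the limit costs ε(s' - s j) plus a term of higher order. The strict
  -- inequality in `Reach` leaves slack ε(s(i+1) - s i) - e₀ > 0 in the first step, which absorbs
  -- that term for large j. The condition `v2` keeps the jump within the mesh, and `v3` with ε ≤ 1/2
  -- keeps its error rate below 1.
  have v1 : ∀ᶠ j in atTop, C * (s' - s j) ^ (1 + (l - α)) < ε * (s (i + 1) - s i) - e₀ := by
    have := (tendsto_rpow_zero (by linarith : 0 < 1 + (l - α)) hsub).const_mul C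
    rw [mul_zero] at this
    exact this.eventually (gt_mem_nhds (by linarith))
  have v2 : ∀ᶠ j in atTop, s' - s j < ε := hsub.eventually (gt_mem_nhds hε)
  have v3 : ∀ᶠ j in atTop, C * (s' - s j) ^ (l - α) < 1 / 2 := by
    have := (tendsto_rpow_zero hθ hsub).const_mul C
    rw [mul_zero] at this
    exact this.eventually (gt_mem_nhds (by norm_num))
  obtain ⟨j, j1, j2, j3, hj⟩ := (v1.and (v2.and (v3.and (eventually_gt_atTop (i + 1))))).exists
  obtain ⟨-, e₁, he₁, hc₁⟩ := Reach.of_lt h hj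
  have hp := sub_pos.2 (hlt j)
  have hjump := chainTo_of_step (ε := ε) (hmem j).1 hs'T (hlt j) (hmem j).2 hyK j2.le (hrem j) (by
    rw [Real.rpow_add hp, Real.rpow_one]
    have := mul_le_mul_of_nonneg_right j3.le hp.le
    nlinarith)
  refine ⟨_, ?_, (hc₀.trans hc₁).trans hjump⟩
  linarith

/-- Greedy choice in place of transfinite iteration: each new point goes more than half-way to the
supremum of the times reachable from the previous one. If T were never reached, the limit point
could be continued to some s₂ > s'. By transitivity s₂ is reachable from every earlier point, so
each step covers at least half the distance to s₂, against convergence to s'. -/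
theorem exists_reach_end (hT : ∀ s y, s ∈ Icc 0 T → s < T → y ∈ K s →
      ∃ s' y', Reach T b σ g K ε s y s' y')
    (hlimit : ∀ (s : ℕ → ℝ) (y : ℕ → Eucl d),
      (∀ i, Reach T b σ g K ε (s i) (y i) (s (i + 1)) (y (i + 1))) →
      ∃ s' y', Tendsto s atTop (𝓝 s') ∧ ∀ i, Reach T b σ g K ε (s i) (y i) s' y')
    {t : ℝ} {x : Eucl d} (ht : t ∈ Icc 0 T) (htT : t < T) (hx : x ∈ K t) :
    ∃ y', Reach T b σ g K ε t x T y' := by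
  by_contra hcon
  push Not at hcon
  have hsucc : ∀ s y, (s ∈ Icc 0 T ∧ y ∈ K s ∧ s < T) → ∃ s' y', Reach T b σ g K ε s y s' y' :=
    fun s y h => hT s y h.1 h.2.2 h.2.1
  have hright : ∀ {s y s' y'}, Reach T b σ g K ε s y s' y' → s' ∈ Icc 0 T ∧ y' ∈ K s' := by
    rintro s y s' y' ⟨-, e, -, hc⟩
    exact hc.right_mem
  let S : Type := {z : ℝ × Eucl d // z = (t, x) ∨ Reach T b σ g K ε t x z.1 z.2}
  have hS : ∀ z : S, z.1.1 ∈ Icc 0 T ∧ z.1.2 ∈ K z.1.1 ∧ z.1.1 < T := by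
    rintro ⟨⟨s, y⟩, hz | hz⟩
    · obtain ⟨rfl, rfl⟩ := Prod.mk.inj hz
      exact ⟨ht, hx, htT⟩
    · obtain ⟨h1, h2⟩ := hright hz
      refine ⟨h1, h2, lt_of_le_of_ne h1.2 ?_⟩
      intro he
      simp only at he
      subst he
      exact hcon y hz
  let ρ : S → ℝ := fun z => sSup {s' | ∃ y', Reach T b σ g K ε z.1.1 z.1.2 s' y'}
  have hbdd : ∀ z : S, BddAbove {s' | ∃ y', Reach T b σ g K ε z.1.1 z.1.2 s' y'} := fun z =>
    ⟨T, by rintro s' ⟨y', h⟩; exact (hright h).1.2⟩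
  have hnext : ∀ z : S, ∃ z' : S, Reach T b σ g K ε z.1.1 z.1.2 z'.1.1 z'.1.2 ∧
      (z.1.1 + ρ z) / 2 < z'.1.1 := by
    intro z
    obtain ⟨s₁, y₁, h₁⟩ := hsucc _ _ (hS z)
    have hle : s₁ ≤ ρ z := le_csSup (hbdd z) ⟨y₁, h₁⟩
    obtain ⟨s', ⟨y', h'⟩, hlt⟩ := exists_lt_of_lt_csSup
      (s := {s' | ∃ y', Reach T b σ g K ε z.1.1 z.1.2 s' y'}) ⟨s₁, y₁, h₁⟩
      (show (z.1.1 + ρ z) / 2 < ρ z by linarith [h₁.1])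
    refine ⟨⟨(s', y'), Or.inr ?_⟩, h', hlt⟩
    rcases z.2 with hz | hz
    · rw [hz] at h'; exact h'
    · exact hz.trans h'
  choose next hnext1 hnext2 using hnext
  let z : ℕ → S := fun n => next^[n] ⟨(t, x), Or.inl rfl⟩
  have hz : ∀ n, z (n + 1) = next (z n) := fun n => Function.iterate_succ_apply' next n _
  have hstep : ∀ n, Reach T b σ g K ε (z n).1.1 (z n).1.2 (z (n + 1)).1.1 (z (n + 1)).1.2 := by
    intro n; rw [hz]; exact hnext1 (z n)
  obtain ⟨s', y', hlim, hreach⟩ := hlimit _ _ hstep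
  obtain ⟨s₂, y₂, h₂⟩ := hsucc s' y' (hS ⟨(s', y'), Or.inr (hreach 0)⟩)
  have hle : ∀ n, ((z n).1.1 + s₂) / 2 ≤ (z (n + 1)).1.1 := by
    intro n
    have h3 : s₂ ≤ ρ (z n) := le_csSup (hbdd (z n)) ⟨y₂, (hreach n).trans h₂⟩
    rw [hz]
    linarith [hnext2 (z n)]
  have h4 := le_of_tendsto_of_tendsto' ((hlim.add_const s₂).div_const 2)
    (hlim.comp (tendsto_add_atTop_nat 1)) hle
  linarith [h₂.1]

end

/-! ### Passage to the limit and construction of viable solutions. -/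

section

variable {d k : ℕ} {α l T M : ℝ} {b : ℝ → Eucl d → Eucl d}
  {σ : ℝ → Eucl d → Matrix (Fin d) (Fin k) ℝ} {g : ℝ → Eucl k} {K : ℝ → Set (Eucl d)} {ε : ℝ}

theorem IsTubeChain.exists_index (hε : 0 ≤ ε) {n : ℕ} {τ : ℕ → ℝ} {X : ℕ → Eucl d} {w : ℕ → ℝ}
    (hc : IsTubeChain T b σ g K ε n τ X w) :
    ∃ ι : ℝ → ℕ, Monotone ι ∧ (∀ s, ι s ≤ n) ∧ ι (τ 0) = 0 ∧
      ∀ s ∈ Icc (τ 0) (τ n), τ (ι s) ≤ s ∧ s - τ (ι s) ≤ ε := by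
  classical
  have hspec : ∀ s, τ 0 ≤ s → τ (Nat.findGreatest (fun i => τ i ≤ s) n) ≤ s := fun s h =>
    Nat.findGreatest_spec (P := fun i => τ i ≤ s) (Nat.zero_le n) h
  refine ⟨fun s => Nat.findGreatest (fun i => τ i ≤ s) n,
    fun r s hrs => Nat.findGreatest_mono_left (fun i (hi : τ i ≤ r) => hi.trans hrs) n,
    fun s => Nat.findGreatest_le n, ?_, fun s hsI => ⟨hspec s hsI.1, ?_⟩⟩
  · by_contra h
    have := hc.time_lt (Nat.pos_of_ne_zero h) (Nat.findGreatest_le n)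
    exact absurd (hspec (τ 0) le_rfl) this.not_ge
  · rcases (Nat.findGreatest_le (P := fun i => τ i ≤ s) n).eq_or_lt with h | h
    · beta_reduce
      rw [h]; linarith [hsI.2]
    · have h1 : ¬ τ (Nat.findGreatest (fun i => τ i ≤ s) n + 1) ≤ s :=
        Nat.findGreatest_is_greatest (P := fun i => τ i ≤ s) (Nat.lt_succ_self _) h
      have h2 := hc.mesh _ h
      linarith

/-- Approximate viable paths: step functions with values in the tube, with uniform bounds. -/
theorem YoungSystem.exists_approx (hs : YoungSystem α l T M b σ g) (hK : LeftClosed T K)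
    (hC : Contingent α T b σ g K) {t : ℝ} {x : Eucl d} (ht : t ∈ Icc 0 T) (htT : t < T)
    (hx : x ∈ K t) :
    ∃ R A C : ℝ, 0 ≤ R ∧ 0 ≤ A ∧ 0 ≤ C ∧ ∀ ε : ℝ, 0 < ε → ∃ (ρ : ℝ → ℝ) (Z : ℝ → Eucl d), Z t = x ∧
      (∀ s ∈ Icc t T, ρ s ∈ Icc t s ∧ s - ρ s ≤ ε ∧ Z s ∈ K (ρ s) ∧ ‖Z s‖ ≤ R) ∧
      ∀ r ∈ Icc t T, ∀ s ∈ Icc t T, r ≤ s → ‖Z s - Z r‖ ≤ A * (ρ s - ρ r) ^ (1 - α) ∧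
        ‖remainder b σ g (ρ r) (Z r) (ρ s) (Z s)‖ ≤
          ε * (T - t) + C * (ρ s - ρ r) ^ (1 + (l - α)) := by
  obtain ⟨η, hη, hbounds⟩ := hs.exists_chain_bounds
  obtain ⟨R, A, C, hR, hA, hC0, hB⟩ := hbounds ‖x‖ (norm_nonneg x)
  refine ⟨R, A, C, hR, hA, hC0, fun ε₀ hε₀ => ?_⟩
  -- The three upper bounds serve the uniform chain estimates, the jump to limit points, and the
  -- requested accuracy.
  obtain ⟨ε, hε, hεη, hε2, hεε⟩ : ∃ ε : ℝ, 0 < ε ∧ ε ≤ η ∧ ε ≤ 1 / 2 ∧ ε ≤ ε₀ :=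
    ⟨min η (min (1 / 2) ε₀), lt_min hη (lt_min (by norm_num) hε₀), min_le_left _ _,
      (min_le_right _ _).trans (min_le_left _ _), (min_le_right _ _).trans (min_le_right _ _)⟩
  obtain ⟨y', -, e, he, n, τ, X, w, hc, rfl, rfl, hτn, -, hw⟩ :=
    exists_reach_end (fun s y h1 h2 h3 => hC.exists_reach hε (by linarith) h1 h2 h3)
      (fun s y h => hs.reach_limit hK hε hε2 (fun R₀ hR₀ => by
        obtain ⟨Rb, A, C, h1, h2, h3, h4⟩ := hbounds R₀ hR₀
        exact ⟨Rb, A, C, h1, h2, h3, fun n τ X w => h4 K ε n τ X w hεη⟩) h) ht htT hx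
  obtain ⟨b1, b2, b3⟩ := hB K ε n τ X w hεη hc le_rfl
  obtain ⟨ι, hmono, hιn, hι0, hι⟩ := hc.exists_index hε.le
  rw [hτn] at hι
  have hwm : ∀ i j, i ≤ j → j ≤ n → w i ≤ w j := by
    intro i j hij
    induction j, hij using Nat.le_induction with
    | base => exact fun _ => le_rfl
    | succ j _ ih =>
      intro hj
      have := (norm_nonneg _).trans (hc.step j hj)
      linarith [ih (by omega)]
  refine ⟨fun s => τ (ι s), fun s => X (ι s), by beta_reduce; rw [hι0], fun s hsI => ?_, ?_⟩
  · exact ⟨⟨hc.time_le (Nat.zero_le _) (hιn s), (hι s hsI).1⟩, (hι s hsI).2.trans hεε,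
      hc.mem _ (hιn s), b1 _ (hιn s)⟩
  · intro r _ s _ hrs
    refine ⟨b2 _ _ (hmono hrs) (hιn s), (b3 _ _ (hmono hrs) (hιn s)).trans ?_⟩
    have h1 := hwm _ _ (Nat.zero_le (ι r)) (hιn r)
    have h2 := hwm _ _ (hιn s) le_rfl
    have h3 := mul_le_mul_of_nonneg_right hεε (sub_nonneg.2 htT.le)
    linarith

/-- A Hölder path with small remainders over all intervals solves the equation. -/
theorem YoungSystem.isSolution_of_remainder (hs : YoungSystem α l T M b σ g) {t A C : ℝ}
    {X : ℝ → Eucl d} (ht : 0 ≤ t) (hA : 0 ≤ A) (hX : HolderWithOn A (1 - α) (Icc t T) X)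
    (hrem : ∀ r s, t ≤ r → r ≤ s → s ≤ T →
      ‖remainder b σ g r (X r) s (X s)‖ ≤ C * (s - r) ^ (1 + (l - α))) :
    IsSolution α T b σ g t (X t) X := by
  have ha := hs.one_sub_pos
  have hα := hs.alpha_pos
  have hl0 : 0 < l := hα.trans hs.alpha_lt
  have hl1 := hs.l_le
  have hM := hs.M_nonneg
  refine ⟨⟨A, fun s hsI r hrI => hX.norm_sub_le hrI hsI⟩, ?_⟩
  rcases lt_or_ge T t with hTt | htT
  · intro s hsI
    exact absurd (hsI.1.trans hsI.2) hTt.not_ge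
  have hT0 : 0 ≤ T := ht.trans htT
  have hmem : ∀ u ∈ Icc t T, u ∈ Icc 0 T := fun u hu => ⟨ht.trans hu.1, hu.2⟩
  have habs : ∀ u ∈ Icc t T, ∀ v ∈ Icc t T, |u - v| ≤ T := fun u hu v hv =>
    abs_sub_le_iff.2 ⟨by linarith [hu.2, hv.1], by linarith [hv.2, hu.1]⟩
  set c := (1 + T) ^ (1 - α - l) with hc
  have hc0 : 0 ≤ c := Real.rpow_nonneg (by linarith) _
  have hfrob : ∀ u ∈ Icc t T, ∀ v ∈ Icc t T,
      frob (σ u (X u) - σ v (X v)) ≤ M * (1 + A * c) * |u - v| ^ l := by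
    intro u hu v hv
    refine (hs.sigma_lipschitz u (hmem u hu) v (hmem v hv) _ _).trans ?_
    rw [mul_assoc]
    refine mul_le_mul_of_nonneg_left ?_ hM
    have h1 := hX.norm_sub_le hv hu
    have h2 := mul_le_mul_of_nonneg_left
      (rpow_le_mul_rpow (abs_nonneg (u - v)) (habs u hu v hv) hl0 hl1) hA
    linarith
  obtain ⟨L, hL, hlip⟩ := hs.b_lipschitz (‖X t‖ + A * T ^ (1 - α))
    (by have := Real.rpow_nonneg hT0 (1 - α); positivity)
  have hbd : ∀ u ∈ Icc t T, ‖X u‖ ≤ ‖X t‖ + A * T ^ (1 - α) := by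
    intro u hu
    have q1 := hX t ⟨le_rfl, htT⟩ u hu hu.1
    have q2 : (u - t) ^ (1 - α) ≤ T ^ (1 - α) :=
      Real.rpow_le_rpow (by linarith [hu.1]) (by linarith [hu.2]) ha.le
    have q3 := norm_le_norm_add_norm_sub' (X u) (X t)
    have := mul_le_mul_of_nonneg_left q2 hA
    linarith
  have hcont := hs.continuousOn_drift ht le_rfl hA hX
  have hii : ∀ u ∈ Icc t T, ∀ v ∈ Icc t T,
      IntervalIntegrable (fun r => b r (X r)) volume u v := fun u hu v hv =>
    (hcont.mono (ordConnected_Icc.uIcc_subset hu hv)).intervalIntegrable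
  have hdrift : ∀ r s, t ≤ r → r ≤ s → s ≤ T →
      ‖(∫ u in r..s, b u (X u)) - (s - r) • b r (X r)‖ ≤
        L * (1 + A) * ((1 + T) ^ (1 - l) * (s - r) ^ (1 + (l - α))) := by
    intro r s htr hrs hsT
    have hsr := sub_nonneg.2 hrs
    have hr : r ∈ Icc t T := ⟨htr, hrs.trans hsT⟩
    have e : (∫ u in r..s, b u (X u)) - (s - r) • b r (X r) =
        ∫ u in r..s, (b u (X u) - b r (X r)) := by
      rw [intervalIntegral.integral_sub (hii r hr s ⟨htr.trans hrs, hsT⟩)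
        intervalIntegrable_const, intervalIntegral.integral_const]
    rw [e]
    have := intervalIntegral.norm_integral_le_of_norm_le_const (a := r) (b := s)
      (f := fun u => b u (X u) - b r (X r)) (C := L * (1 + A) * (s - r) ^ (1 - α)) ?_
    · refine this.trans ?_
      rw [abs_of_nonneg hsr, mul_assoc]
      refine mul_le_mul_of_nonneg_left ?_ (by positivity)
      have h2 := rpow_le_mul_rpow (p := 1 - α + 1) (q := 1 + (l - α)) hsr
        (by linarith : s - r ≤ T) (by linarith [hs.alpha_lt]) (by linarith)
      rw [show 1 - α + 1 - (1 + (l - α)) = 1 - l by ring] at h2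
      rwa [Real.rpow_add_of_nonneg hsr ha.le zero_le_one, Real.rpow_one] at h2
    · intro u hu
      rw [uIoc_of_le hrs] at hu
      have huI : u ∈ Icc t T := ⟨htr.trans hu.1.le, hu.2.trans hsT⟩
      refine (hlip u (hmem u huI) r (hmem r hr) _ _ (hbd u huI) (hbd r hr)).trans ?_
      have h1 := hX.norm_sub_le hr huI
      have h2 : |u - r| ^ (1 - α) ≤ (s - r) ^ (1 - α) :=
        Real.rpow_le_rpow (abs_nonneg _) (by rw [abs_of_nonneg] <;> linarith [hu.1, hu.2]) ha.le
      have h3 := mul_le_mul_of_nonneg_left h2 hA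
      rw [mul_assoc]
      exact mul_le_mul_of_nonneg_left (by linarith) hL
  -- Y is the discrepancy in the equation. Its increments combine three errors of order 1 + (l-α):
  -- the remainder of X, the freezing of the drift, and the Young expansion. So Y is constant.
  set Y : ℝ → Eucl d := fun s =>
    X s - (∫ u in t..s, b u (X u)) - stieltjesVec α t s (fun u => σ u (X u)) g with hY
  have hYt : Y t = X t := by simp [hY, stieltjesVec_self]
  have hYc := eq_of_norm_sub_le_rpow (Y := Y) (a := t) (b := T)
    (C := C + L * (1 + A) * (1 + T) ^ (1 - l) + M * (M * (1 + A * c)))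
    (sub_pos.2 hs.alpha_lt) (fun r s htr hrs hsT => by
      have h1 := hrem r s htr hrs hsT
      have h2 := hdrift r s htr hrs hsT
      have h3 := hs.young (fun u => σ u (X u)) (M * (1 + A * c)) t r s (by positivity) ht htr hrs
        hsT (fun x hx y hy => hfrob x ⟨hx.1, hx.2.trans hsT⟩ y ⟨hy.1, hy.2.trans hsT⟩)
      rw [show 1 + l - α = 1 + (l - α) by ring] at h3
      have e : Y s - Y r = remainder b σ g r (X r) s (X s) -
          ((∫ u in r..s, b u (X u)) - (s - r) • b r (X r)) -
          (stieltjesVec α t s (fun u => σ u (X u)) g - stieltjesVec α t r (fun u => σ u (X u)) g -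
            mulVecE (σ r (X r)) (g s - g r)) := by
        simp only [hY, remainder]
        rw [← intervalIntegral.integral_add_adjacent_intervals
          (hii t ⟨le_rfl, htT⟩ r ⟨htr, hrs.trans hsT⟩)
          (hii r ⟨htr, hrs.trans hsT⟩ s ⟨htr.trans hrs, hsT⟩)]
        abel
      rw [e]
      refine (norm_sub_le _ _).trans ((add_le_add ((norm_sub_le _ _).trans (add_le_add h1 h2))
        h3).trans_eq (by ring)))
  intro s hsI
  have := hYc s hsI
  rw [hYt] at this
  rw [← this]
  simp only [hY]
  abel

/-- The drift is Lipschitz on balls only, whence the common bound R on the base points. -/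
theorem YoungSystem.tendsto_remainder (hs : YoungSystem α l T M b σ g) {ι : Type*} {F : Filter ι}
    {r s : ι → ℝ} {x y : ι → Eucl d} {r₀ s₀ R : ℝ} {x₀ y₀ : Eucl d}
    (hr : ∀ i, r i ∈ Icc 0 T) (hr₀ : r₀ ∈ Icc 0 T) (hs' : ∀ i, s i ∈ Icc 0 T) (hs₀ : s₀ ∈ Icc 0 T)
    (hx : ∀ i, ‖x i‖ ≤ R) (hx₀ : ‖x₀‖ ≤ R) (hrr : Tendsto r F (𝓝 r₀)) (hss : Tendsto s F (𝓝 s₀))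
    (hxx : Tendsto x F (𝓝 x₀)) (hyy : Tendsto y F (𝓝 y₀)) :
    Tendsto (fun i => remainder b σ g (r i) (x i) (s i) (y i)) F
      (𝓝 (remainder b σ g r₀ x₀ s₀ y₀)) := by
  have hnx : Tendsto (fun i => ‖x i - x₀‖) F (𝓝 0) := tendsto_iff_norm_sub_tendsto_zero.1 hxx
  have hnr : Tendsto (fun i => |r i - r₀|) F (𝓝 0) := by
    simpa using tendsto_iff_norm_sub_tendsto_zero.1 hrr
  have hbt : Tendsto (fun i => b (r i) (x i)) F (𝓝 (b r₀ x₀)) := by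
    obtain ⟨L, -, hL⟩ := hs.b_lipschitz R ((norm_nonneg _).trans hx₀)
    rw [tendsto_iff_norm_sub_tendsto_zero]
    refine squeeze_zero (fun _ => norm_nonneg _)
      (fun i => hL _ (hr i) _ hr₀ _ _ (hx i) hx₀) ?_
    simpa using ((tendsto_rpow_zero hs.one_sub_pos hnr).add hnx).const_mul L
  have hσt : Tendsto (fun i => frob (σ (r i) (x i) - σ r₀ x₀)) F (𝓝 0) := by
    refine squeeze_zero (fun _ => frob_nonneg _)
      (fun i => hs.sigma_lipschitz _ (hr i) _ hr₀ _ _) ?_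
    simpa using
      ((tendsto_rpow_zero (hs.alpha_pos.trans hs.alpha_lt) hnr).add hnx).const_mul M
  exact ((hyy.sub hxx).sub ((hss.sub hrr).smul hbt)).sub
    (tendsto_mulVecE hσt ((hs.tendsto_g hs' hs₀ hss).sub (hs.tendsto_g hr hr₀ hrr)))

/-- Left-closedness speaks of strictly earlier times. If the times equal s frequently, closedness of
K(s) decides; otherwise they are eventually strictly earlier, and a sequence is extracted from the
closure since the filter is arbitrary. -/
theorem LeftClosed.mem_of_tendsto (hK : LeftClosed T K) (hKcl : ∀ t ∈ Icc 0 T, IsClosed (K t))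
    {ι : Type*} {F : Filter ι} [F.NeBot] {r : ι → ℝ} {y : ι → Eucl d} {s : ℝ} {z : Eucl d}
    (hsT : s ∈ Icc 0 T) (hr : ∀ i, r i ∈ Icc 0 s) (hy : ∀ i, y i ∈ K (r i))
    (hrs : Tendsto r F (𝓝 s)) (hyz : Tendsto y F (𝓝 z)) : z ∈ K s := by
  by_cases h : ∃ᶠ i in F, r i = s
  · rw [← (hKcl s hsT).closure_eq]
    exact mem_closure_of_frequently_of_tendsto (h.mono fun i hi => hi ▸ hy i) hyz
  · have hcl : (s, z) ∈ closure {p : ℝ × Eucl d | p.1 ∈ Ico 0 s ∧ p.2 ∈ K p.1} := by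
      refine mem_closure_of_tendsto (hrs.prodMk_nhds hyz) ?_
      filter_upwards [not_frequently.1 h] with i hi
      exact ⟨⟨(hr i).1, lt_of_le_of_ne (hr i).2 hi⟩, hy i⟩
    obtain ⟨p, hp, hlim⟩ := mem_closure_iff_seq_limit.1 hcl
    rw [Prod.tendsto_iff] at hlim
    exact hK s hsT _ _ z (fun n => (hp n).1) (fun n => (hp n).2) hlim.1 hlim.2

/-- The approximations are step functions, bounded uniformly, with Hölder and remainder estimates in
terms of the nearby chain times ρ(s). Pointwise limits along one ultrafilter exist by compactness of
balls, and the estimates pass to them because ρ(s) → s and the accumulated error tends to 0; no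
equicontinuity argument is needed. -/
theorem YoungSystem.viable_of_contingent (hs : YoungSystem α l T M b σ g)
    (hKcl : ∀ t ∈ Icc 0 T, IsClosed (K t)) (hK : LeftClosed T K)
    (hC : Contingent α T b σ g K) : Viable α T b σ g K := by
  intro t ht x hx
  rcases ht.2.eq_or_lt with rfl | htT
  -- At t = T the interval is a single point and the constant path suffices.
  · refine ⟨fun _ => x, hs.isSolution_of_remainder (A := 0) (C := 0) (X := fun _ => x) ht.1 le_rfl
      (fun r _ s _ _ => by simp) (fun r s htr hrs hst => ?_), fun s hsI => ?_⟩
    · obtain rfl : r = s := le_antisymm hrs (hst.trans htr)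
      rw [remainder_self]; simp
    · rwa [le_antisymm hsI.2 hsI.1]
  obtain ⟨R, A, C, hR, hA, hC0, happ⟩ := hs.exists_approx hK hC ht htT hx
  choose ρ Z hZt hρ hZ using fun N : ℕ => happ (1 / ((N : ℝ) + 1)) (by positivity)
  set F : Filter ℕ := (hyperfilter ℕ).toFilter
  have hlim : ∀ s, ∃ y, s ∈ Icc t T → ‖y‖ ≤ R ∧ Tendsto (fun N => Z N s) F (𝓝 y) := by
    intro s
    by_cases hsI : s ∈ Icc t T
    · obtain ⟨y, hy, hle⟩ := (isCompact_closedBall (0 : Eucl d) R).ultrafilter_le_nhds'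
        ((hyperfilter ℕ).map fun N => Z N s) (Ultrafilter.mem_map.2 (univ_mem' fun N =>
          mem_closedBall_zero_iff.2 (hρ N s hsI).2.2.2))
      exact ⟨y, fun _ => ⟨mem_closedBall_zero_iff.1 hy, hle⟩⟩
    · exact ⟨0, fun h => absurd h hsI⟩
  choose X hX using hlim
  have hε : Tendsto (fun N : ℕ => 1 / ((N : ℝ) + 1)) F (𝓝 0) :=
    tendsto_one_div_add_atTop_nhds_zero_nat.mono_left Nat.hyperfilter_le_atTop
  have hρlim : ∀ s ∈ Icc t T, Tendsto (fun N => ρ N s) F (𝓝 s) := by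
    intro s hsI
    have h1 : Tendsto (fun N : ℕ => s - 1 / ((N : ℝ) + 1)) F (𝓝 s) := by
      simpa using hε.const_sub s
    exact tendsto_of_tendsto_of_tendsto_of_le_of_le h1 tendsto_const_nhds
      (fun N => by have := (hρ N s hsI).2.1; simp only; linarith) (fun N => (hρ N s hsI).1.2)
  have hmem : ∀ s ∈ Icc t T, s ∈ Icc 0 T := fun s hsI => ⟨ht.1.trans hsI.1, hsI.2⟩
  have hρmem : ∀ s ∈ Icc t T, ∀ N, ρ N s ∈ Icc 0 T := fun s hsI N =>
    ⟨ht.1.trans (hρ N s hsI).1.1, (hρ N s hsI).1.2.trans hsI.2⟩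
  have hXt : X t = x := by
    refine tendsto_nhds_unique (hX t ⟨le_rfl, ht.2⟩).2 ?_
    simp only [hZt]
    exact tendsto_const_nhds
  refine ⟨X, hXt ▸ hs.isSolution_of_remainder (A := A) (C := C) ht.1 hA ?_ ?_, fun s hsI => ?_⟩
  · intro r hr s hsI hrs
    refine le_of_tendsto_of_tendsto' ((hX s hsI).2.sub (hX r hr).2).norm
      ((((hρlim s hsI).sub (hρlim r hr)).rpow_const (Or.inr hs.one_sub_pos.le)).const_mul A)
      fun N => (hZ N r hr s hsI hrs).1
  · intro r s htr hrs hsT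
    have hr : r ∈ Icc t T := ⟨htr, hrs.trans hsT⟩
    have hsI : s ∈ Icc t T := ⟨htr.trans hrs, hsT⟩
    have h1 := hs.tendsto_remainder (hρmem r hr) (hmem r hr) (hρmem s hsI) (hmem s hsI)
      (fun N => (hρ N r hr).2.2.2) (hX r hr).1 (hρlim r hr) (hρlim s hsI) (hX r hr).2 (hX s hsI).2
    have h2 := (hε.mul_const (T - t)).add
      ((((hρlim s hsI).sub (hρlim r hr)).rpow_const (p := 1 + (l - α))
        (Or.inr (by linarith [hs.alpha_lt]))).const_mul C)
    rw [zero_mul, zero_add] at h2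
    exact le_of_tendsto_of_tendsto' h1.norm h2 fun N => (hZ N r hr s hsI hrs).2
  · exact hK.mem_of_tendsto hKcl (hmem s hsI)
      (fun N => ⟨ht.1.trans (hρ N s hsI).1.1, (hρ N s hsI).1.2⟩)
      (fun N => (hρ N s hsI).2.2.1) (hρlim s hsI) (hX s hsI).2

end

end FracViability

end

theorem mainTheorem2 {d k : ℕ} (T α β δ μ : ℝ) (hT : 0 < T)
    (b : ℝ → FracViability.Eucl d → FracViability.Eucl d)
    (σ : ℝ → FracViability.Eucl d → Matrix (Fin d) (Fin k) ℝ)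
    (g : ℝ → FracViability.Eucl k)
    (K : ℝ → Set (FracViability.Eucl d))
    (hσ : FracViability.HypSigma T β δ σ)
    (hb : FracViability.HypDrift T β δ μ b)
    (hα : 1 - μ < α) (hα₀ : α < FracViability.alphaZero β δ)
    (hg : FracViability.MemTildeW α 0 T g)
    (hKne : ∀ t ∈ Set.Icc 0 T, (K t).Nonempty)
    (hKcl : ∀ t ∈ Set.Icc 0 T, IsClosed (K t)) :
    (FracViability.LeftClosed T K →
      List.TFAE [FracViability.Viable α T b σ g K,
        FracViability.Tangent α β T b σ g K,
        FracViability.Contingent α T b σ g K]) ∧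
    (FracViability.Viable α T b σ g K → FracViability.LeftClosed T K) ∧
    (FracViability.Tangent α β T b σ g K → FracViability.Contingent α T b σ g K) := by
  obtain ⟨M, hs⟩ := FracViability.exists_youngSystem hT hσ hb hα hα₀ hg
  refine ⟨fun hK => ?_, hs.leftClosed_of_viable hKcl, hs.contingent_of_tangent⟩
  tfae_have 1 → 2 := hs.tangent_of_viable
  tfae_have 2 → 3 := hs.contingent_of_tangent
  tfae_have 3 → 1 := hs.viable_of_contingent hKcl hK
  tfae_finish
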